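/- Biquandles. A biquandle is a set $X$ with operations $\circ,*$ such that: $x\circ x=x*x$; for each $y$ the maps $x\mapsto x*y$ and $x\mapsto x\circ y$ are bijections of $X$; the map $(x,y)\mapsto(y*x,x\circ y)$ is a bijection of $X\times X$; and $(x\circ z)\circ(y\circ z)=(x\circ y)\circ(z*y)$, $(y\circ z)*(x\circ z)=(y*x)\circ(z*x)$, $(z*x)*(y*x)=(z*y)*(x\circ y)$. Diagrams. An oriented virtual link diagram is considered combinatorially: it is a finite oriented $4$-valent graph (closed components without vertices are allowed) whose vertices are classical crossings, with a sign and an over- and an under-strand, or virtual crossings. No planarity of the graph is required, so diagrams drawn in the plane are included. Two diagrams represent the same link if they are related by isomorphisms of diagrams, all oriented Reidemeister moves $\Omega_1,\Omega_2,\Omega_3$ and detour moves (removing and creating virtual crossings). Colourings. An $X$-colouring $f$ of a diagram $L$ assigns an element of $X$ to each edge (edges run from one classical crossing to the next, through virtual crossings; a closed component without classical crossings is one edge), so that at each classical crossing there are $x,y\in X$ for which: at a positive crossing the incoming under-edge, outgoing under-edge, outgoing over-edge and incoming over-edge have the colours $x,\ x\circ y,\ y,\ y*x$ respectively; at a negative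 crossing the outgoing under-edge, incoming under-edge, incoming over-edge and outgoing over-edge have the colours $x,\ x\circ y,\ y,\ y*x$ respectively. We say that the crossing is coloured by $(x,y)$. Bracket data. Let $X$ be a finite biquandle and $R$ a commutative ring with unity. Let $\beta=(A,B,C,D,E,F)$ be maps $X\times X\to R$, and let $\delta\in R$, $w\in R^\times$, be such that for all $x,y,z\in X$: (i) $\delta A_{x,x}+B_{x,x}=w$, $\ \delta D_{x,x}+E_{x,x}=w^{-1}$, $\ C_{x,x}=F_{x,x}=0$; (ii) $A_{x,y}F_{x,y}=C_{x,y}D_{x,y}=B_{x,y}F_{x,y}=C_{x,y}E_{x,y}=0$, $\ A_{x,y}D_{x,y}=B_{x,y}E_{x,y}=1-C_{x,y}F_{x,y}$, $\ \delta A_{x,y}D_{x,y}=-A_{x,y}E_{x,y}-B_{x,y}D_{x,y}$; (iii) writing, for $P,Q,S\in\{A,B,C\}$, $[PQS]=P_{x,y}\,Q_{y,z}\,S_{x\circ y,z*y}$ and $\langle PQS\rangle=P_{x,z}\,Q_{y*x,z*x}\,S_{x\circ z,y\circ z}$, \begin{gather*} [AAA]+[CCA]=\langle AAA\rangle+\langle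 ACC\rangle,\quad [ABB]+[CBC]=\langle BBA\rangle+\langle CBC\rangle,\\ [BAB]+[BCC]=\langle BAB\rangle+\langle CCB\rangle,\quad [ACA]+[CAA]=\langle CAA\rangle,\\ [AAC]=\langle AAC\rangle+\langle ACA\rangle,\quad [ACB]=\langle BBC\rangle+\langle CBA\rangle,\quad [BCB]+[BAC]=\langle BAC\rangle,\\ [ABC]+[CBB]=\langle BCA\rangle,\quad [CAB]=\langle BCB\rangle+\langle CAB\rangle,\\ [CCB]=\langle BCC\rangle,\quad [ACC]=\langle CCA\rangle,\quad [CAC]=\langle CAC\rangle,\\ [BCA]=[CBA]=[BBC]=[CCC]=0,\quad \langle ABC\rangle=\langle ACB\rangle=\langle CBB\rangle=\langle CCC\rangle=0,\\ [AAB]=\langle ABA\rangle+\langle AAB\rangle+\delta\langle ABB\rangle+\langle BBB\rangle,\quad \langle BAA\rangle=[BAA]+[ABA]+\delta[BBA]+[BBB]. \end{gather*} Values. A framed $4$-graph is a finite $4$-valent graph, possibly with circle components, in which the four half-edges at each vertex are split into two pairs of opposite half-edges. Let $R\mathfrak G_\delta$ be the $R$-module of formal linear combinations of framed $4$-graphs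 (up to isomorphism) modulo $G\sqcup\bigcirc=\delta G$ and $G=G'$ whenever $G,G'$ differ by a second Reidemeister move (two edges are made to cross each other at two new vertices, consecutive on both; in each new vertex the half-edges of the same edge are opposite). A state $s$ of $L$ chooses for each classical crossing the smoothing respecting the orientation, the smoothing not respecting it, or a graphical vertex (opposite half-edges stay opposite); virtual crossings are disregarded, and the result is a framed $4$-graph $L_s$. The weight of a crossing coloured by $(x,y)$ is $A_{x,y},B_{x,y},C_{x,y}$ for these three choices if the crossing is positive, and $D_{x,y},E_{x,y},F_{x,y}$ if it is negative. For an $X$-colouring $f$ of $L$ put $$\beta(f)_{gr}=w^{-\mathrm{wr}(L)}\sum_s\Big(\prod_{c}\mathrm{weight}(c,s,f)\Big)L_s\in R\mathfrak G_\delta ,$$ where $\mathrm{wr}(L)$ is the sum of the signs of the classical crossings. Theorem. If two oriented virtual link diagrams $L_1,L_2$ represent the same virtual link, then the multisets $\{\beta(f)_{gr}\mid f\text{ an }X\text{-colouring of }L_1\}$ and $\{\beta(f)_{gr}\mid f\text{ an }X\text{-colouring of }L_2\}$ of elements of $R\mathfrak G_\delta$ are equal. -/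

import Mathlib

/-! ### Biquandles -/

/-- A biquandle: a set with two binary operations `circ` (written `x ∘ y`) and `ast`
(written `x * y`) satisfying axioms (R1)-(R4). -/
structure Biquandle (X : Type*) where
  circ : X → X → X
  ast : X → X → X
  circ_self : ∀ x, circ x x = ast x x
  ast_bijective : ∀ y, Function.Bijective fun x => ast x y
  circ_bijective : ∀ y, Function.Bijective fun x => circ x y
  sideways_bijective : Function.Bijective fun p : X × X => (ast p.2 p.1, circ p.1 p.2)
  exchange_circ_circ : ∀ x y z, circ (circ x z) (circ y z) = circ (circ x y) (ast z y)
  exchange_circ_ast : ∀ x y z, ast (circ y z) (circ x z) = circ (ast y x) (ast z x)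
  exchange_ast_ast : ∀ x y z, ast (ast z x) (ast y x) = ast (ast z y) (circ x y)

/-! ### Oriented virtual link diagrams -/

/-- The strand passages of a diagram with classical crossings `C`, virtual crossings `V` and
marked points `M`. Each crossing is passed twice: a classical one by its over-strand and its
under-strand, a virtual one by its two strands (numbered by `Bool`; the numbering carries no
information). A marked point is a two-valent point on an edge; it is passed once. -/
inductive Passage (C V M : Type) : Type
  | over (c : C) : Passage C V M
  | under (c : C) : Passage C V M
  | virt (v : V) (i : Bool) : Passage C V M
  | mark (m : M) : Passage C V M

/-- The map on passages induced by maps of crossings and marked points. -/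
def Passage.map {C V M C' V' M' : Type} (fC : C → C') (fV : V → V') (fM : M → M') :
    Passage C V M → Passage C' V' M'
  | .over c => .over (fC c)
  | .under c => .under (fC c)
  | .virt v i => .virt (fV v) i
  | .mark m => .mark (fM m)

instance {C V M : Type} [Finite C] [Finite V] [Finite M] : Finite (Passage C V M) := by
  let g : Passage C V M → ((C ⊕ C) ⊕ ((V × Bool) ⊕ M)) := fun p =>
    match p with
    | .over c => .inl (.inl c)
    | .under c => .inl (.inr c)
    | .virt v i => .inr (.inl (v, i))
    | .mark m => .inr (.inr m)
  refine Finite.of_injective g ?_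
  rintro (a | a | ⟨a, i⟩ | a) (b | b | ⟨b, j⟩ | b) h <;> simp_all [g]

/-- An oriented virtual link diagram, as a finite oriented four-valent graph: `sign` is the sign
of a classical crossing, and following the orientation from the passage `p` along one edge leads
to the passage `next p`. At a crossing, the two half-edges of one passage are opposite; the cyclic
order of the four half-edges at a classical crossing is given by the sign and the over/under
information. The unicursal components are the cycles of `next`. Marked points subdivide edges;
a closed component without crossings is a cycle of marked points.

No planarity is imposed on how the vertices are joined, so every diagram in the plane (with its
virtual crossings) is a diagram in this sense. -/
structure VirtualDiagram where
  C : Type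
  V : Type
  M : Type
  [fintypeC : Fintype C]
  [finiteV : Finite V]
  [finiteM : Finite M]
  sign : C → ℤˣ
  next : Equiv.Perm (Passage C V M)

namespace VirtualDiagram

attribute [instance] VirtualDiagram.fintypeC VirtualDiagram.finiteV VirtualDiagram.finiteM

/-- The passages of a diagram. The edge of the diagram that leaves a passage `p` (and enters
`D.next p`) is referred to as the edge `p`. -/
abbrev Pass (D : VirtualDiagram) : Type := Passage D.C D.V D.M

/-- The writhe number. -/
def writhe (D : VirtualDiagram) : ℤ := ∑ c, (D.sign c : ℤ)

/-- `D'` has, besides the crossings and marked points of `D`, new classical crossings `NC`, new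
virtual crossings `NV` and new marked points `NM`. -/
structure Extension (D D' : VirtualDiagram) (NC NV NM : Type) where
  eC : D.C ⊕ NC ≃ D'.C
  eV : D.V ⊕ NV ≃ D'.V
  eM : D.M ⊕ NM ≃ D'.M
  sign_old : ∀ c, D'.sign (eC (Sum.inl c)) = D.sign c

namespace Extension

variable {D D' : VirtualDiagram} {NC NV NM : Type}

/-- The passages of `D` as passages of `D'`. -/
def old (E : Extension D D' NC NV NM) : D.Pass → D'.Pass :=
  Passage.map (fun c => E.eC (Sum.inl c)) (fun v => E.eV (Sum.inl v)) (fun m => E.eM (Sum.inl m))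

/-- The new passages. -/
def new (E : Extension D D' NC NV NM) : Passage NC NV NM → D'.Pass :=
  Passage.map (fun c => E.eC (Sum.inr c)) (fun v => E.eV (Sum.inr v)) (fun m => E.eM (Sum.inr m))

/-- The edge `p` of `D` runs in `D'` through the new passages in the list `l`, in this order. -/
def Inserts (E : Extension D D' NC NV NM) (p : D.Pass) (l : List (Passage NC NV NM)) : Prop :=
  List.IsChain (fun a b => D'.next a = b) (E.old p :: (l.map E.new ++ [E.old (D.next p)]))

end Extension

/-- `u` and `v` are consecutive passages: `v` follows `u` if `t = 1`, and `u` follows `v` if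
`t = -1`. -/
def Consecutive (D : VirtualDiagram) (t : ℤˣ) (u v : D.Pass) : Prop :=
  (t = 1 ∧ D.next u = v) ∨ (t = -1 ∧ D.next v = u)

open Classical in
/-- The permutation of passages which exchanges, on each of three strands crossing each other at
`tm`, `tb` and `mb`, the two passages of the strand. -/
noncomputable def exchange (D : VirtualDiagram) (tm tb mb : D.C) : Equiv.Perm D.Pass :=
  Equiv.swap (.over tm) (.over tb) * Equiv.swap (.under tm) (.over mb)
    * Equiv.swap (.under tb) (.under mb)

/-- Elementary moves between oriented virtual link diagrams. -/
inductive Move : VirtualDiagram → VirtualDiagram → Prop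
  /-- Isomorphism of diagrams. -/
  | iso {D D' : VirtualDiagram} (e : D.Pass ≃ D'.Pass)
      (eC : D.C ≃ D'.C) (eV : D.V ≃ D'.V) (eM : D.M ≃ D'.M)
      (h_over : ∀ c, e (.over c) = .over (eC c)) (h_under : ∀ c, e (.under c) = .under (eC c))
      (h_virt : ∀ v i, ∃ j, e (.virt v i) = .virt (eV v) j)
      (h_mark : ∀ m, e (.mark m) = .mark (eM m))
      (h_sign : ∀ c, D'.sign (eC c) = D.sign c)
      (h_next : ∀ p, D'.next (e p) = e (D.next p)) : Move D D'
  /-- Subdivision of the edge `p` by a marked point. -/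
  | subdivide {D D' : VirtualDiagram} (E : Extension D D' Empty Empty Unit) (p : D.Pass)
      (hp : E.Inserts p [.mark ()])
      (h_rest : ∀ r, r ≠ p → E.Inserts r []) : Move D D'
  /-- The first Reidemeister moves: a kink, of either sign and with either strand first, is
  created on the edge `p`. -/
  | reidemeister1 {D D' : VirtualDiagram} (E : Extension D D' Unit Empty Empty) (p : D.Pass)
      (hp : E.Inserts p [.over (), .under ()] ∨ E.Inserts p [.under (), .over ()])
      (h_rest : ∀ r, r ≠ p → E.Inserts r []) : Move D D'
  /-- The second Reidemeister moves: the edge `p` is pulled over the edge `q`, the two edges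
  having the same direction or opposite directions. (An edge is pulled over itself after a
  subdivision.) -/
  | reidemeister2 {D D' : VirtualDiagram} (E : Extension D D' Bool Empty Empty) (p q : D.Pass)
      (hpq : p ≠ q)
      (h_sign : D'.sign (E.eC (Sum.inr true)) = -D'.sign (E.eC (Sum.inr false)))
      (hp : E.Inserts p [.over false, .over true])
      (hq : E.Inserts q [.under false, .under true] ∨ E.Inserts q [.under true, .under false])
      (h_rest : ∀ r, r ≠ p → r ≠ q → E.Inserts r []) : Move D D'
  /-- The third Reidemeister moves. A top, a middle and a bottom strand cross each other at the
  crossings `tm`, `tb`, `mb`; on each strand the two passages are consecutive, and the move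
  exchanges them. With all three strands directed as in a braid the three crossings have the same
  sign `ε`; reversing a strand reverses the order of its two passages and changes the signs of its
  two crossings. The units `t`, `m`, `b` record the directions of the three strands. -/
  | reidemeister3 {D : VirtualDiagram} (tm tb mb : D.C) (ε t m b : ℤˣ)
      (h1 : tm ≠ tb) (h2 : tm ≠ mb) (h3 : tb ≠ mb)
      (h_top : D.Consecutive t (.over tm) (.over tb))
      (h_mid : D.Consecutive m (.under tm) (.over mb))
      (h_bot : D.Consecutive b (.under tb) (.under mb))
      (s_tm : D.sign tm = ε * (t * m)) (s_tb : D.sign tb = ε * (t * b))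
      (s_mb : D.sign mb = ε * (m * b)) :
      Move D { D with next := D.exchange tm tb mb * D.next * (D.exchange tm tb mb)⁻¹ }
  /-- Creation of a virtual crossing between the edges `p` and `q`. A detour move removes, one
  after another, the virtual crossings on an arc and creates, one after another, those on the
  new arc. -/
  | detour {D D' : VirtualDiagram} (E : Extension D D' Empty Unit Empty) (p q : D.Pass)
      (hpq : p ≠ q)
      (hp : E.Inserts p [.virt () false]) (hq : E.Inserts q [.virt () true])
      (h_rest : ∀ r, r ≠ p → r ≠ q → E.Inserts r []) : Move D D'

/-- Two diagrams represent the same oriented virtual link: they are related by a finite sequence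
of moves and inverse moves. -/
def SameLink : VirtualDiagram → VirtualDiagram → Prop := Relation.EqvGen Move

section Coloring

variable {X : Type*}

/-- For an assignment `f` of elements of `X` to the edges, the pair `(x, y)` at the classical
crossing `c`: at a positive crossing, `x` belongs to the incoming under-edge and `y` to the
outgoing over-edge; at a negative crossing, `x` belongs to the outgoing under-edge and `y` to the
incoming over-edge. -/
def leftPair (D : VirtualDiagram) (f : D.Pass → X) (c : D.C) : X × X :=
  if D.sign c = 1 then (f (D.next.symm (.under c)), f (.over c))
  else (f (.under c), f (D.next.symm (.over c)))

/-- The elements at the other two edges of the crossing `c`, the one of the under-strand first. -/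
def rightPair (D : VirtualDiagram) (f : D.Pass → X) (c : D.C) : X × X :=
  if D.sign c = 1 then (f (.under c), f (D.next.symm (.over c)))
  else (f (D.next.symm (.under c)), f (.over c))

/-- `f` is a biquandle colouring. The crossing relations: if `(x, y)` is the pair at a classical
crossing, then the other under-edge has colour `x ∘ y` and the other over-edge has colour `y * x`.
Colours do not change at virtual crossings and marked points. -/
def IsColoring (Q : Biquandle X) (D : VirtualDiagram) (f : D.Pass → X) : Prop :=
  (∀ c, D.rightPair f c =
    (Q.circ (D.leftPair f c).1 (D.leftPair f c).2, Q.ast (D.leftPair f c).2 (D.leftPair f c).1)) ∧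
  (∀ v i, f (.virt v i) = f (D.next.symm (.virt v i))) ∧
  (∀ m, f (.mark m) = f (D.next.symm (.mark m)))

/-- The biquandle colourings of a diagram. -/
abbrev Coloring (Q : Biquandle X) (D : VirtualDiagram) : Type _ :=
  {f : D.Pass → X // D.IsColoring Q f}

end Coloring

end VirtualDiagram

/-! ### Framed four-valent graphs -/

/-- A finite four-valent graph with a cross structure, possibly with circle components. `H` is the
set of half-edges, `mate h` the other half of the edge of `h`, `node` the relation of being
adjacent to the same vertex, and `opp h` the half-edge opposite to `h` at its vertex. At most two
pairs of opposite half-edges meet at a vertex, so its valence is four or two. The two-valent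
points only subdivide edges and carry circles without vertices; graphs which differ by a
subdivision are identified in `PictureModule` below. -/
structure FramedGraph where
  H : Type
  [finiteH : Finite H]
  mate : H → H
  mate_mate : ∀ h, mate (mate h) = h
  mate_ne : ∀ h, mate h ≠ h
  opp : H → H
  opp_opp : ∀ h, opp (opp h) = h
  opp_ne : ∀ h, opp h ≠ h
  node : Setoid H
  node_opp : ∀ h, node.r h (opp h)
  valence : ∀ h k l, node.r h k → node.r h l →
    k = h ∨ k = opp h ∨ l = h ∨ l = opp h ∨ l = k ∨ l = opp k

namespace FramedGraph

/-- Isomorphism of framed graphs. -/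
def Iso (G G' : FramedGraph) : Prop :=
  ∃ e : G.H ≃ G'.H, (∀ h, G'.mate (e h) = e (G.mate h)) ∧ (∀ h, G'.opp (e h) = e (G.opp h)) ∧
    ∀ h k, G'.node.r (e h) (e k) ↔ G.node.r h k

/-- `G'` has the vertices and two-valent points of `G` and those formed by further half-edges
`N`, with the given opposite half-edges and vertices. Nothing is said about the edges. -/
structure Extends (G G' : FramedGraph) {N : Type} (oppN : N → N) (nodeN : N → N → Prop)
    (e : G.H ⊕ N ≃ G'.H) : Prop where
  opp_old : ∀ h, G'.opp (e (Sum.inl h)) = e (Sum.inl (G.opp h))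
  opp_new : ∀ n, G'.opp (e (Sum.inr n)) = e (Sum.inr (oppN n))
  node_old : ∀ h k, G'.node.r (e (Sum.inl h)) (e (Sum.inl k)) ↔ G.node.r h k
  node_new : ∀ n n', G'.node.r (e (Sum.inr n)) (e (Sum.inr n')) ↔ nodeN n n'
  node_old_new : ∀ h n, ¬ G'.node.r (e (Sum.inl h)) (e (Sum.inr n))

/-- `G'` is `G` with the edge of `h₀` subdivided by a two-valent point. -/
def Subdivision (G G' : FramedGraph) : Prop :=
  ∃ (e : G.H ⊕ Bool ≃ G'.H) (h₀ : G.H), Extends G G' not (fun _ _ => True) e ∧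
    G'.mate (e (Sum.inl h₀)) = e (Sum.inr false) ∧
    G'.mate (e (Sum.inr true)) = e (Sum.inl (G.mate h₀)) ∧
    ∀ h, h ≠ h₀ → h ≠ G.mate h₀ → G'.mate (e (Sum.inl h)) = e (Sum.inl (G.mate h))

/-- `G'` is the disjoint union of `G` and a circle. -/
def AddCircle (G G' : FramedGraph) : Prop :=
  ∃ e : G.H ⊕ Bool ≃ G'.H, Extends G G' not (fun _ _ => True) e ∧
    (∀ i, G'.mate (e (Sum.inr i)) = e (Sum.inr (!i))) ∧
    ∀ h, G'.mate (e (Sum.inl h)) = e (Sum.inl (G.mate h))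

/-- `G'` is obtained from `G` by an increasing second Reidemeister move: two different edges, those
of `h₀ false` and `h₀ true`, are made to cross twice. The new half-edge `(v, s, i)` is the first
(`i = false`) or second (`i = true`) half-edge at the new vertex `v` met on the edge of `h₀ s` when
it is followed from `h₀ s`; the vertex `false` comes first on both edges. -/
def SecondMove (G G' : FramedGraph) : Prop :=
  ∃ (e : G.H ⊕ (Bool × Bool × Bool) ≃ G'.H) (h₀ : Bool → G.H),
    h₀ true ≠ h₀ false ∧ h₀ true ≠ G.mate (h₀ false) ∧
    Extends G G' (fun n => (n.1, n.2.1, !n.2.2)) (fun n n' => n.1 = n'.1) e ∧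
    (∀ s, G'.mate (e (Sum.inl (h₀ s))) = e (Sum.inr (false, s, false)) ∧
      G'.mate (e (Sum.inr (false, s, true))) = e (Sum.inr (true, s, false)) ∧
      G'.mate (e (Sum.inr (true, s, true))) = e (Sum.inl (G.mate (h₀ s)))) ∧
    ∀ h, (∀ s, h ≠ h₀ s ∧ h ≠ G.mate (h₀ s)) → G'.mate (e (Sum.inl h)) = e (Sum.inl (G.mate h))

/-- The relations imposed on formal linear combinations of framed graphs: graphs are considered up
to isomorphism, subdivision of edges and second Reidemeister moves, and a disjoint circle is
replaced by the factor `δ`. -/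
inductive Relator {R : Type*} [CommRing R] (δ : R) : (FramedGraph →₀ R) → Prop
  | iso {G G' : FramedGraph} (h : Iso G G') :
      Relator δ (Finsupp.single G' 1 - Finsupp.single G 1)
  | subdivision {G G' : FramedGraph} (h : Subdivision G G') :
      Relator δ (Finsupp.single G' 1 - Finsupp.single G 1)
  | secondMove {G G' : FramedGraph} (h : SecondMove G G') :
      Relator δ (Finsupp.single G' 1 - Finsupp.single G 1)
  | circle {G G' : FramedGraph} (h : AddCircle G G') :
      Relator δ (Finsupp.single G' 1 - Finsupp.single G δ)

/-- The submodule generated by the relations. -/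
noncomputable def relations {R : Type*} [CommRing R] (δ : R) : Submodule R (FramedGraph →₀ R) :=
  Submodule.span R {a | Relator δ a}

end FramedGraph

/-- The module of `R`-linear combinations of framed four-valent graphs modulo second Reidemeister
moves and the relation that a disjoint circle equals `δ`. -/
abbrev PictureModule {R : Type*} [CommRing R] (δ : R) : Type _ :=
  (FramedGraph →₀ R) ⧸ FramedGraph.relations δ

/-- The class of a framed graph. -/
noncomputable def FramedGraph.toModule {R : Type*} [CommRing R] (δ : R) (G : FramedGraph) :
    PictureModule δ :=
  (FramedGraph.relations δ).mkQ (Finsupp.single G 1)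

/-! ### States -/

/-- The three states of a classical crossing: the smoothing respecting the orientation, the
smoothing not respecting it, and the graphical vertex. -/
inductive CrossingState : Type
  | oriented
  | disoriented
  | vertex

instance : Fintype CrossingState where
  elems := ⟨Multiset.ofList [.oriented, .disoriented, .vertex], by simp⟩
  complete := by intro s; cases s <;> simp

namespace VirtualDiagram

variable (D : VirtualDiagram)

/-- The other half of an edge of the diagram. The half-edge `(p, true)` leaves the passage `p`, the
half-edge `(p, false)` enters it. -/
def edgeMate (h : D.Pass × Bool) : D.Pass × Bool :=
  if h.2 then (D.next h.1, false) else (D.next.symm h.1, true)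

/-- The half-edge with which a half-edge is joined after the crossings have been replaced according
to the state `s`. At a graphical vertex these are the opposite half-edges; the oriented smoothing
joins the incoming half-edge of each strand to the outgoing one of the other, and the disoriented
smoothing joins the two incoming half-edges and the two outgoing ones. Virtual crossings are
disregarded: each strand passes straight on. -/
def stateOpp (s : D.C → CrossingState) : D.Pass × Bool → D.Pass × Bool
  | (.over c, i) =>
    match s c with
    | .oriented => (.under c, !i)
    | .disoriented => (.under c, i)
    | .vertex => (.over c, !i)
  | (.under c, i) =>
    match s c with
    | .oriented => (.over c, !i)
    | .disoriented => (.over c, i)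
    | .vertex => (.under c, !i)
  | (.virt v j, i) => (.virt v j, !i)
  | (.mark m, i) => (.mark m, !i)

/-- A label for the point of the state at which a half-edge ends: a graphical vertex is labelled by
its over-passage, and the two points into which a smoothing splits a crossing by the two passages
of the crossing. -/
def stateNode (s : D.C → CrossingState) : D.Pass × Bool → D.Pass
  | (.over c, i) =>
    match s c with
    | .oriented => if i then .under c else .over c
    | .disoriented => if i then .under c else .over c
    | .vertex => .over c
  | (.under c, i) =>
    match s c with
    | .oriented => if i then .over c else .under c
    | .disoriented => if i then .under c else .over c
    | .vertex => .over c
  | (.virt v j, _) => .virt v j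
  | (.mark m, _) => .mark m

/-- A half-edge ends at a point which comes from the node of the diagram where it ends. -/
theorem stateNode_origin (s : D.C → CrossingState) (p : D.Pass) (i : Bool) :
    (∀ c, D.stateNode s (p, i) = .over c ∨ D.stateNode s (p, i) = .under c →
      p = .over c ∨ p = .under c) ∧
    (∀ v j, D.stateNode s (p, i) = .virt v j → p = .virt v j) ∧
    (∀ m, D.stateNode s (p, i) = .mark m → p = .mark m) := by
  rcases p with c | c | ⟨v, j⟩ | m
  · cases h : s c <;> cases i <;> simp [stateNode, h]
  · cases h : s c <;> cases i <;> simp [stateNode, h]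
  · simp [stateNode]
  · simp [stateNode]

theorem stateGraph_valence (s : D.C → CrossingState) (h k l : D.Pass × Bool)
    (hk : Setoid.ker (D.stateNode s) h k) (hl : Setoid.ker (D.stateNode s) h l) :
    k = h ∨ k = D.stateOpp s h ∨ l = h ∨ l = D.stateOpp s h ∨ l = k ∨ l = D.stateOpp s k := by
  obtain ⟨p, i⟩ := h
  obtain ⟨q, j⟩ := k
  obtain ⟨r, n⟩ := l
  change D.stateNode s _ = D.stateNode s _ at hk hl
  have hq := D.stateNode_origin s q j
  have hr := D.stateNode_origin s r n
  rw [← hk] at hq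
  rw [← hl] at hr
  rcases p with c | c | ⟨v, t⟩ | m
  iterate 2
    have hq' : q = .over c ∨ q = .under c := hq.1 c (by
      cases h : s c <;> cases i <;> simp [stateNode, h])
    have hr' : r = .over c ∨ r = .under c := hr.1 c (by
      cases h : s c <;> cases i <;> simp [stateNode, h])
    clear hq hr
    cases h : s c <;> rcases hq' with rfl | rfl <;> rcases hr' with rfl | rfl <;>
      cases i <;> cases j <;> cases n <;> simp [stateNode, stateOpp, h] at hk hl ⊢
  · obtain rfl := hq.2.1 v t rfl
    cases i <;> cases j <;> simp [stateOpp]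
  · obtain rfl := hq.2.2 m rfl
    cases i <;> cases j <;> simp [stateOpp]

/-- The framed graph obtained from a diagram by replacing the crossings according to the state
`s`. -/
def stateGraph (s : D.C → CrossingState) : FramedGraph where
  H := D.Pass × Bool
  mate := D.edgeMate
  mate_mate := by rintro ⟨p, _ | _⟩ <;> simp [edgeMate]
  mate_ne := by rintro ⟨p, _ | _⟩ <;> simp [edgeMate]
  opp := D.stateOpp s
  opp_opp := by
    rintro ⟨c | c | ⟨v, j⟩ | m, i⟩
    · cases h : s c <;> simp [stateOpp, h]
    · cases h : s c <;> simp [stateOpp, h]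
    · simp [stateOpp]
    · simp [stateOpp]
  opp_ne := by
    rintro ⟨c | c | ⟨v, j⟩ | m, i⟩
    · cases h : s c <;> simp [stateOpp, h]
    · cases h : s c <;> simp [stateOpp, h]
    · simp [stateOpp]
    · simp [stateOpp]
  node := Setoid.ker (D.stateNode s)
  node_opp := by
    rintro ⟨c | c | ⟨v, j⟩ | m, i⟩ <;> change D.stateNode s _ = D.stateNode s _
    · cases h : s c <;> cases i <;> simp [stateOpp, stateNode, h]
    · cases h : s c <;> cases i <;> simp [stateOpp, stateNode, h]
    · simp [stateOpp, stateNode]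
    · simp [stateOpp, stateNode]
  valence := D.stateGraph_valence s

end VirtualDiagram

/-! ### The parity-biquandle bracket -/

/-- The data `β = (A, B, C, D, E, F)` with the distinguished elements `δ` and `w`, satisfying the
relations (i)-(iii). -/
structure ParityBiquandleBracket {X : Type*} (Q : Biquandle X) (R : Type*) [CommRing R] where
  A : X → X → R
  B : X → X → R
  C : X → X → R
  D : X → X → R
  E : X → X → R
  F : X → X → R
  δ : R
  w : Rˣ
  i_1 : ∀ x, δ * A x x + B x x = w
  i_2 : ∀ x, δ * D x x + E x x = (w⁻¹ : Rˣ)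
  i_3 : ∀ x, C x x = 0
  i_4 : ∀ x, F x x = 0
  ii_1 : ∀ x y, A x y * F x y = 0
  ii_2 : ∀ x y, C x y * D x y = 0
  ii_3 : ∀ x y, B x y * F x y = 0
  ii_4 : ∀ x y, C x y * E x y = 0
  ii_5 : ∀ x y, A x y * D x y = 1 - C x y * F x y
  ii_6 : ∀ x y, B x y * E x y = 1 - C x y * F x y
  ii_7 : ∀ x y, δ * (A x y * D x y) = -(A x y * E x y) - B x y * D x y
  iii_1 : ∀ x y z,
      A x y * A y z * A (Q.circ x y) (Q.ast z y)
        + C x y * C y z * A (Q.circ x y) (Q.ast z y)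
      = A x z * A (Q.ast y x) (Q.ast z x) * A (Q.circ x z) (Q.circ y z)
        + A x z * C (Q.ast y x) (Q.ast z x) * C (Q.circ x z) (Q.circ y z)
  iii_2 : ∀ x y z,
      A x y * B y z * B (Q.circ x y) (Q.ast z y)
        + C x y * B y z * C (Q.circ x y) (Q.ast z y)
      = B x z * B (Q.ast y x) (Q.ast z x) * A (Q.circ x z) (Q.circ y z)
        + C x z * B (Q.ast y x) (Q.ast z x) * C (Q.circ x z) (Q.circ y z)
  iii_3 : ∀ x y z,
      B x y * A y z * B (Q.circ x y) (Q.ast z y)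
        + B x y * C y z * C (Q.circ x y) (Q.ast z y)
      = B x z * A (Q.ast y x) (Q.ast z x) * B (Q.circ x z) (Q.circ y z)
        + C x z * C (Q.ast y x) (Q.ast z x) * B (Q.circ x z) (Q.circ y z)
  iii_4 : ∀ x y z,
      A x y * C y z * A (Q.circ x y) (Q.ast z y)
        + C x y * A y z * A (Q.circ x y) (Q.ast z y)
      = C x z * A (Q.ast y x) (Q.ast z x) * A (Q.circ x z) (Q.circ y z)
  iii_5 : ∀ x y z,
      A x y * A y z * C (Q.circ x y) (Q.ast z y)
      = A x z * A (Q.ast y x) (Q.ast z x) * C (Q.circ x z) (Q.circ y z)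
        + A x z * C (Q.ast y x) (Q.ast z x) * A (Q.circ x z) (Q.circ y z)
  iii_6 : ∀ x y z,
      A x y * C y z * B (Q.circ x y) (Q.ast z y)
      = B x z * B (Q.ast y x) (Q.ast z x) * C (Q.circ x z) (Q.circ y z)
        + C x z * B (Q.ast y x) (Q.ast z x) * A (Q.circ x z) (Q.circ y z)
  iii_7 : ∀ x y z,
      B x y * C y z * B (Q.circ x y) (Q.ast z y)
        + B x y * A y z * C (Q.circ x y) (Q.ast z y)
      = B x z * A (Q.ast y x) (Q.ast z x) * C (Q.circ x z) (Q.circ y z)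
  iii_8 : ∀ x y z,
      A x y * B y z * C (Q.circ x y) (Q.ast z y)
        + C x y * B y z * B (Q.circ x y) (Q.ast z y)
      = B x z * C (Q.ast y x) (Q.ast z x) * A (Q.circ x z) (Q.circ y z)
  iii_9 : ∀ x y z,
      C x y * A y z * B (Q.circ x y) (Q.ast z y)
      = B x z * C (Q.ast y x) (Q.ast z x) * B (Q.circ x z) (Q.circ y z)
        + C x z * A (Q.ast y x) (Q.ast z x) * B (Q.circ x z) (Q.circ y z)
  iii_10 : ∀ x y z,
      C x y * C y z * B (Q.circ x y) (Q.ast z y)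
      = B x z * C (Q.ast y x) (Q.ast z x) * C (Q.circ x z) (Q.circ y z)
  iii_11 : ∀ x y z,
      A x y * C y z * C (Q.circ x y) (Q.ast z y)
      = C x z * C (Q.ast y x) (Q.ast z x) * A (Q.circ x z) (Q.circ y z)
  iii_12 : ∀ x y z,
      C x y * A y z * C (Q.circ x y) (Q.ast z y)
      = C x z * A (Q.ast y x) (Q.ast z x) * C (Q.circ x z) (Q.circ y z)
  iii_13 : ∀ x y z,
      B x y * C y z * A (Q.circ x y) (Q.ast z y)
      = 0
  iii_14 : ∀ x y z,
      C x y * B y z * A (Q.circ x y) (Q.ast z y)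
      = 0
  iii_15 : ∀ x y z,
      B x y * B y z * C (Q.circ x y) (Q.ast z y)
      = 0
  iii_16 : ∀ x y z,
      C x y * C y z * C (Q.circ x y) (Q.ast z y)
      = 0
  iii_17 : ∀ x y z,
      A x z * B (Q.ast y x) (Q.ast z x) * C (Q.circ x z) (Q.circ y z)
      = 0
  iii_18 : ∀ x y z,
      A x z * C (Q.ast y x) (Q.ast z x) * B (Q.circ x z) (Q.circ y z)
      = 0
  iii_19 : ∀ x y z,
      C x z * B (Q.ast y x) (Q.ast z x) * B (Q.circ x z) (Q.circ y z)
      = 0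
  iii_20 : ∀ x y z,
      C x z * C (Q.ast y x) (Q.ast z x) * C (Q.circ x z) (Q.circ y z)
      = 0
  iii_21 : ∀ x y z,
      A x y * A y z * B (Q.circ x y) (Q.ast z y)
      = A x z * B (Q.ast y x) (Q.ast z x) * A (Q.circ x z) (Q.circ y z)
        + A x z * A (Q.ast y x) (Q.ast z x) * B (Q.circ x z) (Q.circ y z)
        + δ * (A x z * B (Q.ast y x) (Q.ast z x) * B (Q.circ x z) (Q.circ y z))
        + B x z * B (Q.ast y x) (Q.ast z x) * B (Q.circ x z) (Q.circ y z)
  iii_22 : ∀ x y z,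
      B x z * A (Q.ast y x) (Q.ast z x) * A (Q.circ x z) (Q.circ y z)
      = B x y * A y z * A (Q.circ x y) (Q.ast z y)
        + A x y * B y z * A (Q.circ x y) (Q.ast z y)
        + δ * (B x y * B y z * A (Q.circ x y) (Q.ast z y))
        + B x y * B y z * B (Q.circ x y) (Q.ast z y)

namespace ParityBiquandleBracket

variable {X : Type*} {Q : Biquandle X} {R : Type*} [CommRing R]

/-- The skein coefficients: `A`, `B`, `C` for the oriented smoothing, the disoriented smoothing and
the graphical vertex at a positive crossing, and `D`, `E`, `F` at a negative crossing. -/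
def coeff (β : ParityBiquandleBracket Q R) (sign : ℤˣ) (s : CrossingState) (x y : X) : R :=
  match s with
  | .oriented => if sign = 1 then β.A x y else β.D x y
  | .disoriented => if sign = 1 then β.B x y else β.E x y
  | .vertex => if sign = 1 then β.C x y else β.F x y

open Classical in
/-- The parity-biquandle bracket value of a coloured diagram: the sum over all states of the
product of the skein coefficients times the framed graph of the state, multiplied by
`w ^ (-writhe)`. -/
noncomputable def value (β : ParityBiquandleBracket Q R) (L : VirtualDiagram) (f : L.Coloring Q) :
    PictureModule β.δ :=
  ((β.w ^ (-L.writhe) : Rˣ) : R) •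
    ∑ s : L.C → CrossingState,
      (∏ c, β.coeff (L.sign c) (s c) (L.leftPair f.1 c).1 (L.leftPair f.1 c).2) •
        (L.stateGraph s).toModule β.δ

/-- The parity-biquandle bracket multiset of a diagram. -/
noncomputable def multiset [Finite X] (β : ParityBiquandleBracket Q R) (L : VirtualDiagram) :
    Multiset (PictureModule β.δ) :=
  letI : Fintype (L.Coloring Q) := Fintype.ofFinite _
  (Finset.univ : Finset (L.Coloring Q)).val.map (β.value L)

end ParityBiquandleBracket

/-!
The multiset of values of the colourings is preserved by each move on diagrams.

A move replaces passages of one part of a diagram and leaves the rest alone. The state graphs are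
treated accordingly: the state graph of a diagram with additional passages is obtained by gluing a
tangle, formed by the new passages, into an outer part which depends only on the state of the old
crossings and not on the side of the move (`VirtualDiagram.stateGraph_eq_glue`). Gluing respects
the relations of the picture module, so circles and bigons may be removed inside the tangle
(`Tangle.glue_reduce`, `Tangle.glue_bigonStep`). Whether two simplified tangles coincide is a
finite question about matchings of the half-edges of at most three crossings, decided in the kernel.

Summed over the states of the new crossings, the tangles of a move satisfy the skein relations of
the bracket: `sum_kink` for a first move, whose crossing is coloured by `(x, x)`, follows from the
relations (i), `sum_clasp` for a second move from the relations (ii), and `sum_triangle` for the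
third move of three strands directed as in a braid with positive crossings from the relations (iii).
A colouring of the rest of the diagram extends in one way over the new passages, by the axioms of a
biquandle. `value_eq_of_extension` and `multiset_eq_of_extension` turn these two local facts into
an equality of the multisets of values. Marked points and virtual crossings have no skein
coefficients, which gives `multiset_subdivide` and `multiset_detour`.

The relations (iii) concern one of the oriented third moves only (`multiset_markedTriangle`). The
others follow by second moves. A clasp of the two strands of a crossing `k` of the triangle is
created beyond the third strand; the new crossing next to that strand forms, with the other two
crossings, a triangle whose sides on the strands of `k` lead in the opposite direction. After the
third move at that triangle, `k` and this new crossing form a clasp, and its removal yields the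
diagram which the third move at the original triangle produces (`Clasped`,
`multiset_exchanged_of_clasped`). Together with the inverses of the moves, this reaches all
directions and signs from a single case (`ParityBiquandleBracket.invariant`).
-/

set_option linter.unusedSectionVars false
set_option linter.unusedSimpArgs false

/-! ### Tangles inside framed graphs -/

/-- The part of a framed graph outside a tangle. The ends `P` are those half-edges of the outer
part whose mates may lie in the tangle; every other half-edge `K` has its mate in `K`. -/
structure Outer (P : Type) where
  K : Type
  [finiteK : Finite K]
  mate : K → K
  mate_mate : ∀ k, mate (mate k) = k
  mate_ne : ∀ k, mate k ≠ k
  opp : K ⊕ P → K ⊕ P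
  opp_opp : ∀ q, opp (opp q) = q
  opp_ne : ∀ q, opp q ≠ q
  node : Setoid (K ⊕ P)
  node_opp : ∀ q, node.r q (opp q)
  valence : ∀ h k l, node.r h k → node.r h l →
    k = h ∨ k = opp h ∨ l = h ∨ l = opp h ∨ l = k ∨ l = opp k

attribute [instance] Outer.finiteK

/-- `m` restricts to an involution without fixed points of the set `S`. -/
structure IsMatching {β : Type} (m : β → β) (S : β → Prop) : Prop where
  mem : ∀ z, S z → S (m z)
  invol : ∀ z, S z → m (m z) = z
  ne : ∀ z, S z → m z ≠ z

/-- The matching obtained from `m` by joining `u` and `v`. -/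
def rejoin {β : Type} [DecidableEq β] (u v : β) (m : β → β) (z : β) : β :=
  if z = u then v else if z = v then u else m z

namespace IsMatching

variable {β : Type} {m : β → β} {S S' : β → Prop}

theorem congr (h : IsMatching m S) (hS : ∀ z, S' z ↔ S z) : IsMatching m S' := by
  obtain rfl : S' = S := funext fun z => propext (hS z)
  exact h

/-- If two points are removed, their partners can be matched with each other. -/
theorem rejoin [DecidableEq β] (h : IsMatching m S) {x y : β} (hx : S x) (hy : S y) (hxy : x ≠ y)
    (hne : m x ≠ y) :
    IsMatching (_root_.rejoin (m x) (m y) m) (fun z => S z ∧ z ≠ x ∧ z ≠ y) := by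
  obtain ⟨h1, h2, h3⟩ := h
  have := h1 x hx
  have := h1 y hy
  have := h2 x hx
  have := h2 y hy
  have := h3 x hx
  have := h3 y hy
  constructor <;> intro z hz <;> have := h1 z <;> have := h2 z <;> have := h3 z <;>
    unfold _root_.rejoin <;> split_ifs <;> clear h1 h2 h3 <;> grind

theorem remove (h : IsMatching m S) {x y : β} (hx : S x) (hne : m x = y) :
    IsMatching m (fun z => S z ∧ z ≠ x ∧ z ≠ y) := by
  obtain ⟨h1, h2, h3⟩ := h
  have := h1 x hx
  have := h2 x hx
  constructor <;> intro z hz <;> have := h1 z <;> have := h2 z <;> have := h3 z <;>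
    clear h1 h2 h3 <;> grind

end IsMatching

/-- Whether an element of `P ⊕ α` is an end or one of the half-edges singled out by `live`. -/
def liveEnd {P α : Type} (live : α → Bool) : P ⊕ α → Bool := Sum.elim (fun _ => true) live

/-- The part of a framed graph inside a tangle with ends `P`. Its half-edges are the elements of
`α` with `live a = true`; two of them are at the same node if they have the same label
`node a`. The edges join half-edges and ends, as given by `mate`. The values of `mate` at elements
that are not live carry no information. -/
structure Tangle (P α : Type) where
  live : α → Bool
  mate : P ⊕ α → P ⊕ α
  opp : α → α
  node : α → α
  live_opp : ∀ a, live (opp a) = live a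
  opp_opp : ∀ a, opp (opp a) = a
  opp_ne : ∀ a, opp a ≠ a
  node_opp : ∀ a, node (opp a) = node a
  valence : ∀ h k l, node h = node k → node h = node l →
    k = h ∨ k = opp h ∨ l = h ∨ l = opp h ∨ l = k ∨ l = opp k
  matching : IsMatching mate (fun z => liveEnd live z)

namespace Tangle

variable {P α : Type}

theorem live_mate (T : Tangle P α) (z : P ⊕ α) : liveEnd T.live z → liveEnd T.live (T.mate z) :=
  T.matching.mem z

theorem mate_mate (T : Tangle P α) (z : P ⊕ α) : liveEnd T.live z → T.mate (T.mate z) = z :=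
  T.matching.invol z

theorem mate_ne (T : Tangle P α) (z : P ⊕ α) : liveEnd T.live z → T.mate z ≠ z :=
  T.matching.ne z

/-- The ends and half-edges of a tangle. -/
abbrev End (T : Tangle P α) : Type := {z : P ⊕ α // liveEnd T.live z}

/-- The half-edges of the graph `T.glue O`. -/
abbrev GlueH (T : Tangle P α) (O : Outer P) : Type := O.K ⊕ T.End

/-- A half-edge of the glued graph, as a half-edge of the outer part or of the tangle. -/
def place {O : Outer P} {T : Tangle P α} : T.GlueH O → (O.K ⊕ P) ⊕ α
  | .inl k => .inl (.inl k)
  | .inr ⟨.inl p, _⟩ => .inl (.inr p)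
  | .inr ⟨.inr a, _⟩ => .inr a

theorem place_injective {O : Outer P} {T : Tangle P α} :
    Function.Injective (place : T.GlueH O → _) := by
  rintro (k | ⟨p | a, h⟩) (k' | ⟨p' | a', h'⟩) <;> simp [place]

/-- A half-edge of the outer part, as a half-edge of the glued graph. -/
def outside (O : Outer P) (T : Tangle P α) : O.K ⊕ P → T.GlueH O
  | .inl k => .inl k
  | .inr p => .inr ⟨.inl p, rfl⟩

@[simp] theorem place_outside (O : Outer P) (T : Tangle P α) (q : O.K ⊕ P) :
    place (outside O T q) = .inl q := by
  rcases q with k | p <;> rfl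

/-- The opposite half-edge in the glued graph. -/
def glueOpp (O : Outer P) (T : Tangle P α) : T.GlueH O → T.GlueH O
  | .inl k => outside O T (O.opp (.inl k))
  | .inr ⟨.inl p, _⟩ => outside O T (O.opp (.inr p))
  | .inr ⟨.inr a, h⟩ => .inr ⟨.inr (T.opp a), by simpa [liveEnd, T.live_opp] using h⟩

theorem place_glueOpp (O : Outer P) (T : Tangle P α) (h : T.GlueH O) :
    place (glueOpp O T h) = Sum.map O.opp T.opp (place h) := by
  rcases h with k | ⟨p | a, h⟩
  · exact place_outside O T _
  · exact place_outside O T _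
  · rfl

/-- The node of a half-edge of the glued graph. -/
def glueNode (O : Outer P) (T : Tangle P α) (h : T.GlueH O) : Quotient O.node ⊕ α :=
  Sum.map (Quotient.mk O.node) T.node (place h)

/-- The framed graph obtained by putting the tangle `T` into the outer part `O`. -/
def glue [Finite P] [Finite α] (T : Tangle P α) (O : Outer P) : FramedGraph where
  H := T.GlueH O
  mate := Sum.map O.mate fun z => ⟨T.mate z.1, T.live_mate _ z.2⟩
  mate_mate := by
    rintro (k | z)
    · simp [O.mate_mate]
    · simp [T.mate_mate _ z.2]
  mate_ne := by
    rintro (k | z) h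
    · exact O.mate_ne k (by simpa using h)
    · exact T.mate_ne _ z.2 (congrArg Subtype.val (Sum.inr_injective h))
  opp := glueOpp O T
  opp_opp := by
    intro h
    apply place_injective
    simp only [place_glueOpp]
    rcases place h with q | a <;> simp [O.opp_opp, T.opp_opp]
  opp_ne := by
    intro h e
    have := congrArg place e
    rw [place_glueOpp] at this
    rcases hq : place h with q | a <;> rw [hq] at this
    · exact O.opp_ne q (by simpa using this)
    · exact T.opp_ne a (by simpa using this)
  node := Setoid.ker (glueNode O T)
  node_opp := by
    intro h
    change glueNode O T h = glueNode O T _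
    simp only [glueNode, place_glueOpp]
    rcases place h with q | a
    · simpa using Quotient.sound (O.node_opp q)
    · simp [T.node_opp]
  valence := by
    intro h k l hk hl
    change glueNode O T h = glueNode O T k at hk
    change glueNode O T h = glueNode O T l at hl
    simp only [← place_injective.eq_iff, place_glueOpp]
    simp only [glueNode] at hk hl
    revert hk hl
    rcases place h with q | a <;> rcases place k with q' | a' <;> rcases place l with q'' | a'' <;>
      simp only [Sum.map_inl, Sum.map_inr, Sum.inl.injEq, Sum.inr.injEq, reduceCtorEq, false_or,
        IsEmpty.forall_iff, implies_true, Quotient.eq] <;> intro hk hl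
    · exact O.valence q q' q'' hk hl
    · exact T.valence a a' a'' hk hl

variable [Finite P] [Finite α]

section Remove

variable [DecidableEq P] [DecidableEq α] (T : Tangle P α)

theorem liveEnd_and (f g : α → Bool) (z : P ⊕ α) :
    liveEnd (fun a => f a && g a) z = (liveEnd f z && liveEnd g z) := by
  rcases z with p | a <;> rfl

theorem liveEnd_ne (x y : α) (z : P ⊕ α) :
    liveEnd (fun a => a != x && a != y) z = true ↔ z ≠ .inr x ∧ z ≠ .inr y := by
  rcases z with p | a <;> simp [liveEnd]

theorem live_opp_remove (x a : α) : (T.live (T.opp a) && (T.opp a != x && T.opp a != T.opp x)) =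
    (T.live a && (a != x && a != T.opp x)) := by
  have := T.live_opp a
  have h1 := T.opp_opp a
  have h2 := T.opp_opp x
  grind

/-- The tangle without the node formed by `x` and `T.opp x`, which is assumed to subdivide an
edge. -/
def removePoint (x : α) (hx : T.live x) (hne : T.mate (.inr x) ≠ .inr (T.opp x)) :
    Tangle P α :=
  { T with
    live := fun a => T.live a && (a != x && a != T.opp x)
    mate := rejoin (T.mate (.inr x)) (T.mate (.inr (T.opp x))) T.mate
    live_opp := T.live_opp_remove x
    matching := (T.matching.rejoin (x := .inr x) (y := .inr (T.opp x)) hx (by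
        simpa [liveEnd, T.live_opp] using hx)
      (fun e => T.opp_ne x (Sum.inr_injective e).symm) hne).congr fun z => by
        rw [liveEnd_and, Bool.and_eq_true, liveEnd_ne] }

/-- The tangle without the circle formed by `x` and `T.opp x`. -/
def removeCircle (x : α) (hx : T.live x) (he : T.mate (.inr x) = .inr (T.opp x)) :
    Tangle P α :=
  { T with
    live := fun a => T.live a && (a != x && a != T.opp x)
    live_opp := T.live_opp_remove x
    matching := (T.matching.remove (x := .inr x) hx he).congr fun z => by
        rw [liveEnd_and, Bool.and_eq_true, liveEnd_ne] }

/-- The half-edges `a` and `c` lie at the same node, their opposite half-edges are joined to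
half-edges `b` and `d` lying at another node, and no other edge connects these two nodes. -/
structure IsBigon (a b c d : α) : Prop where
  live_a : T.live a
  live_b : T.live b
  live_c : T.live c
  live_d : T.live d
  node_ac : T.node a = T.node c
  node_bd : T.node b = T.node d
  node_ne : T.node a ≠ T.node b
  ac : a ≠ c ∧ a ≠ T.opp c
  bd : b ≠ d ∧ b ≠ T.opp d
  mate_b : T.mate (.inr (T.opp a)) = .inr b
  mate_d : T.mate (.inr (T.opp c)) = .inr d
  free : ∀ u, u ∈ [a, T.opp b, c, T.opp d] → ∀ v, T.mate (.inr u) = .inr v →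
    T.node v ≠ T.node a ∧ T.node v ≠ T.node b

/-- A node with two different pairs of opposite half-edges has no further half-edges. -/
theorem node_eq_iff {a c : α} (hac : T.node a = T.node c) (h : a ≠ c ∧ a ≠ T.opp c) (v : α) :
    T.node v = T.node a ↔ v = a ∨ v = T.opp a ∨ v = c ∨ v = T.opp c := by
  have := T.valence a c v hac
  have := T.opp_opp a
  have := T.opp_opp c
  have := T.opp_opp v
  have := T.node_opp a
  have := T.node_opp c
  grind

theorem liveEnd_bigon {a b c d : α} (h : T.IsBigon a b c d) (z : P ⊕ α) :
    liveEnd (fun v => T.node v != T.node a && T.node v != T.node b) z = true ↔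
      (z ≠ .inr a ∧ z ≠ .inr (T.opp a) ∧ z ≠ .inr c ∧ z ≠ .inr (T.opp c)) ∧
      z ≠ .inr b ∧ z ≠ .inr (T.opp b) ∧ z ≠ .inr d ∧ z ≠ .inr (T.opp d) := by
  rcases z with p | v
  · simp [liveEnd]
  · have ha := T.node_eq_iff h.node_ac h.ac v
    have hb := T.node_eq_iff h.node_bd h.bd v
    simp only [liveEnd, Sum.elim_inr, Bool.and_eq_true, bne_iff_ne, ne_eq, Sum.inr.injEq, ha, hb,
      not_or]

theorem IsBigon.free' {a b c d : α} (h : T.IsBigon a b c d) {u : α}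
    (hm : u ∈ [a, T.opp b, c, T.opp d]) :
    liveEnd (fun v => T.node v != T.node a && T.node v != T.node b) (T.mate (.inr u)) = true := by
  have := h.free u hm
  rcases hz : T.mate (.inr u) with p | v
  · rfl
  · simpa [liveEnd] using this v hz

theorem IsBigon.distinct {a b c d : α} (h : T.IsBigon a b c d) :
    [a, T.opp a, b, T.opp b, c, T.opp c, d, T.opp d].Nodup := by
  have := h.ac
  have := h.bd
  have := T.opp_ne a
  have := T.opp_ne b
  have := T.opp_ne c
  have := T.opp_ne d
  have := T.opp_opp a
  have := T.opp_opp b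
  have := T.opp_opp c
  have := T.opp_opp d
  have := T.node_opp a
  have := T.node_opp b
  have := T.node_opp c
  have := T.node_opp d
  have := h.node_ac
  have := h.node_bd
  have := h.node_ne
  simp only [List.nodup_cons, List.mem_cons, List.not_mem_nil, or_false, not_or,
    not_false_eq_true, List.nodup_nil, and_true]
  clear h
  and_intros <;> grind

/-- The tangle in which the two nodes of a bigon have been removed by a second Reidemeister
move. -/
def removeBigon {a b c d : α} (h : T.IsBigon a b c d) : Tangle P α :=
  { T with
    live := fun v => T.live v && (T.node v != T.node a && T.node v != T.node b)
    mate := rejoin (T.mate (.inr c)) (T.mate (.inr (T.opp d)))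
      (rejoin (T.mate (.inr a)) (T.mate (.inr (T.opp b))) T.mate)
    live_opp := by
      intro v
      rw [T.live_opp, T.node_opp]
    matching := by
      have hd := h.distinct
      simp only [List.nodup_cons, List.mem_cons, List.not_mem_nil, or_false, not_or] at hd
      have hfa := (T.liveEnd_bigon h _).1 (h.free' T (u := a) (by simp))
      have hfb := (T.liveEnd_bigon h _).1 (h.free' T (u := T.opp b) (by simp))
      have mb := h.mate_b
      have md := h.mate_d
      have la : ∀ v, T.live v → liveEnd T.live (.inr v : P ⊕ α) := fun v hv => hv
      have lb : T.live (T.opp b) := by rw [T.live_opp]; exact h.live_b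
      have lc : T.live (T.opp c) := by rw [T.live_opp]; exact h.live_c
      have ld : T.live (T.opp d) := by rw [T.live_opp]; exact h.live_d
      have la' : T.live (T.opp a) := by rw [T.live_opp]; exact h.live_a
      have lla := h.live_a
      have llc := h.live_c
      have ma := T.mate_mate (.inr (T.opp a)) la'
      -- The eight half-edges are removed in pairs: the two outer ones of each strand are cut out
      -- and their partners joined, which leaves the inner edge of the strand as a closed pair.
      have M1 := T.matching.rejoin (x := .inr a) (y := .inr (T.opp b)) h.live_a lb
        (by grind) (by grind)
      set m1 := rejoin (T.mate (.inr a)) (T.mate (.inr (T.opp b))) T.mate with hm1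
      have e : ∀ v, v ∈ [T.opp a, c, T.opp c, T.opp d] → m1 (.inr v) = T.mate (.inr v) := by
        intro v hv
        simp only [List.mem_cons, List.not_mem_nil, or_false] at hv
        rw [hm1, rejoin, if_neg (by grind), if_neg (by grind)]
      have ea := e (T.opp a) (by simp)
      have ec := e c (by simp)
      have ec' := e (T.opp c) (by simp)
      have ed := e (T.opp d) (by simp)
      have M2 := M1.remove (x := .inr (T.opp a)) (y := .inr b) (by grind) (by rw [ea, mb])
      have hfc := (T.liveEnd_bigon h _).1 (h.free' T (u := c) (by simp))
      have M3 := M2.rejoin (x := .inr c) (y := .inr (T.opp d)) (by grind) (by grind)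
        (by grind) (by grind)
      rw [ec, ed] at M3
      have hfd := (T.liveEnd_bigon h _).1 (h.free' T (u := T.opp d) (by simp))
      have M4 := M3.remove (x := .inr (T.opp c)) (y := .inr d) (by grind) (by
        rw [rejoin, if_neg (by grind), if_neg (by grind), ec', md])
      refine M4.congr fun z => ?_
      rw [liveEnd_and, Bool.and_eq_true, T.liveEnd_bigon h]
      tauto }

end Remove

/-- The half-edges of a glued graph as half-edges of a larger one. -/
def widen (O : Outer P) {T T' : Tangle P α} (h : ∀ z : P ⊕ α, liveEnd T'.live z → liveEnd T.live z)
    :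
    T'.GlueH O → T.GlueH O :=
  Sum.map id (Subtype.map id h)

theorem place_widen (O : Outer P) {T T' : Tangle P α}
    (h : ∀ z, liveEnd T'.live z → liveEnd T.live z) (x : T'.GlueH O) :
    place (widen O h x) = place x := by
  rcases x with k | ⟨p | a, _⟩ <;> rfl

section Relations

variable {R : Type*} [CommRing R] (δ : R) (O : Outer P)

omit [Finite P] [Finite α] in
theorem _root_.FramedGraph.toModule_eq {G G' : FramedGraph}
    (h : FramedGraph.Relator δ (Finsupp.single G' 1 - Finsupp.single G 1)) :
    G'.toModule δ = G.toModule δ := by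
  have : _ ∈ FramedGraph.relations δ := Submodule.subset_span h
  rwa [← Submodule.ker_mkQ (FramedGraph.relations δ), LinearMap.mem_ker, map_sub,
    sub_eq_zero] at this

omit [Finite P] [Finite α] in
theorem _root_.FramedGraph.toModule_eq_smul {G G' : FramedGraph} (h : FramedGraph.AddCircle G G') :
    G'.toModule δ = δ • G.toModule δ := by
  have : _ ∈ FramedGraph.relations δ := Submodule.subset_span (.circle h)
  rw [← Submodule.ker_mkQ (FramedGraph.relations δ), LinearMap.mem_ker, map_sub,
    sub_eq_zero] at this
  rw [FramedGraph.toModule, this, FramedGraph.toModule, ← map_smul, Finsupp.smul_single,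
    smul_eq_mul, mul_one]

variable [DecidableEq P] [DecidableEq α] (T : Tangle P α)

/-- The half-edges of a glued graph, as those of a graph with fewer half-edges and further
half-edges indexed by `N`. -/
noncomputable def growEquiv (O : Outer P) {T T' : Tangle P α} {N : Type} (ν : N → α)
    (hν : Function.Injective ν)
    (hl : ∀ a, T.live a ↔ T'.live a ∨ ∃ n, ν n = a) (hd : ∀ n, ¬ T'.live (ν n)) :
    T'.GlueH O ⊕ N ≃ T.GlueH O :=
  Equiv.ofBijective (Sum.elim
    (widen O (by rintro (p | a) h; exacts [rfl, (hl a).2 (.inl h)]))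
    fun n => .inr ⟨.inr (ν n), (hl _).2 (.inr ⟨n, rfl⟩)⟩) (by
    have key : ∀ (g : T'.GlueH O) (n : N), place g ≠ .inr (ν n) := by
      rintro (k | ⟨p | a, hp⟩) n h
      · simp [place] at h
      · simp [place] at h
      · obtain rfl : a = ν n := by simpa [place] using h
        exact hd n hp
    constructor
    · rintro (g | i) (g' | j) h <;> have h := congrArg place h
      · simp only [Sum.elim_inl, place_widen] at h
        rw [place_injective h]
      · exact absurd ((place_widen O _ g).symm.trans h) (key g j)
      · exact absurd ((place_widen O _ g').symm.trans h.symm) (key g' i)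
      · exact congrArg Sum.inr (hν (by simpa [place] using h))
    · rintro (k | ⟨p | a, ha⟩)
      · exact ⟨.inl (.inl k), rfl⟩
      · exact ⟨.inl (.inr ⟨.inl p, rfl⟩), rfl⟩
      · rcases (hl a).1 ha with h | ⟨n, rfl⟩
        · exact ⟨.inl (.inr ⟨.inr a, h⟩), rfl⟩
        · exact ⟨.inr n, rfl⟩)

section

variable (O : Outer P) {T T' : Tangle P α} {N : Type} {ν : N → α} (hν : Function.Injective ν)
    (hl : ∀ a, T.live a ↔ T'.live a ∨ ∃ n, ν n = a) (hd : ∀ n, ¬ T'.live (ν n))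

theorem place_growEquiv_inl (g : T'.GlueH O) :
    place (growEquiv O ν hν hl hd (.inl g)) = place g :=
  place_widen O _ g

theorem place_growEquiv_inr (n : N) : place (growEquiv O ν hν hl hd (.inr n)) = .inr (ν n) := rfl

/-- If half-edges of a tangle that form whole nodes are taken away, then the glued graph extends the
smaller one. The edges of the two graphs are not compared. -/
theorem glue_extends (ho : T'.opp = T.opp) (hn : T'.node = T.node) {oppN : N → N}
    {nodeN : N → N → Prop} (hoN : ∀ n, T.opp (ν n) = ν (oppN n))
    (hnN : ∀ n n', T.node (ν n) = T.node (ν n') ↔ nodeN n n')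
    (h2 : ∀ n y, T'.live y → T.node y ≠ T.node (ν n)) :
    FramedGraph.Extends (T'.glue O) (T.glue O) oppN nodeN (growEquiv O ν hν hl hd) where
  opp_old h := by
    apply place_injective
    refine (place_glueOpp O T _).trans ?_
    refine Eq.trans ?_ (place_growEquiv_inl O hν hl hd _).symm
    refine Eq.trans ?_ (place_glueOpp O T' _).symm
    rw [ho]
    exact congrArg _ (place_growEquiv_inl O hν hl hd _)
  opp_new n := by
    apply place_injective
    refine (place_glueOpp O T (growEquiv O ν hν hl hd (.inr n))).trans ?_
    refine Eq.trans ?_ (place_growEquiv_inr O hν hl hd (oppN n)).symm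
    rw [place_growEquiv_inr, Sum.map_inr, hoN]
  node_old h k := by
    change glueNode O T _ = glueNode O T _ ↔ glueNode O T' _ = glueNode O T' _
    simp only [glueNode]
    erw [place_growEquiv_inl, place_growEquiv_inl]
    rw [hn]
  node_new n n' := by
    change glueNode O T _ = glueNode O T _ ↔ _
    simp only [glueNode]
    erw [place_growEquiv_inr, place_growEquiv_inr]
    simpa using hnN n n'
  node_old_new h n := by
    change ¬ glueNode O T _ = glueNode O T _
    simp only [glueNode]
    erw [place_growEquiv_inr, place_growEquiv_inl]
    rcases h with k | ⟨p | a, ha⟩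
    · simp [place]
    · simp [place]
    · simpa [place] using h2 n a ha

end

/-- The half-edges at the point formed by `x` and `T.opp x`. -/
def pointHalf (x : α) (i : Bool) : α := if i then T.opp x else x

theorem pointHalf_injective (x : α) : Function.Injective (T.pointHalf x) := by
  have := T.opp_ne x
  rintro (_ | _) (_ | _) <;> simp [pointHalf, this, this.symm]

section

variable {T} {T' : Tangle P α} {x : α} (hx : T.live x)
    (hl : ∀ a, T'.live a = (T.live a && (a != x && a != T.opp x)))
include hx hl

theorem live_iff_point (a : α) : T.live a ↔ T'.live a ∨ ∃ i, T.pointHalf x i = a := by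
  have := T.live_opp x
  simp only [hl, pointHalf, Bool.exists_bool]
  grind

theorem not_live_point (i : Bool) : ¬ T'.live (T.pointHalf x i) := by
  cases i <;> simp [hl, pointHalf]

theorem point_extends (O : Outer P) (ho : T'.opp = T.opp) (hn : T'.node = T.node)
    (h2 : ∀ y, T.live y → T.node y = T.node x → y = x ∨ y = T.opp x) :
    FramedGraph.Extends (T'.glue O) (T.glue O) not (fun _ _ => True)
      (growEquiv O (T.pointHalf x) (T.pointHalf_injective x) (live_iff_point hx hl)
        (not_live_point hx hl)) := by
  refine glue_extends O _ _ _ ho hn ?_ ?_ ?_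
  · rintro (_ | _) <;> simp [pointHalf, T.opp_opp]
  · rintro (_ | _) (_ | _) <;> simp [pointHalf, T.node_opp]
  · intro i y hy e
    have : T.node y = T.node x := by cases i <;> simpa [pointHalf, T.node_opp] using e
    have := h2 y
    rw [hl] at hy
    grind

end

/-- Removing a two-valent node from an edge inverts a subdivision. -/
theorem glue_removePoint (x : α) (hx : T.live x) (hne : T.mate (.inr x) ≠ .inr (T.opp x))
    (h2 : ∀ y, T.live y → T.node y = T.node x → y = x ∨ y = T.opp x) :
    (T.glue O).toModule δ = ((T.removePoint x hx hne).glue O).toModule δ := by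
  refine FramedGraph.toModule_eq δ (.subdivision
    ⟨_, .inr ⟨T.mate (.inr x), ?_⟩,
      point_extends hx (fun _ => rfl) O rfl rfl h2, ?_, ?_, ?_⟩)
  · have h1 := T.live_mate (.inr x) hx
    have m1 := T.mate_mate (.inr x) hx
    have n1 := T.mate_ne (.inr x) hx
    have o1 := T.opp_opp x
    change liveEnd (fun a => T.live a && (a != x && a != T.opp x)) _ = true
    rw [liveEnd_and, Bool.and_eq_true, liveEnd_ne]
    grind
  · have m1 := T.mate_mate (.inr x) hx
    exact congrArg Sum.inr (Subtype.ext m1)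
  · refine congrArg Sum.inr (Subtype.ext ?_)
    change T.mate _ = rejoin _ _ _ _
    simp [pointHalf, rejoin]
  · rintro (k | z) h h'
    · rfl
    · refine congrArg Sum.inr (Subtype.ext ?_)
      have hz : z.1 ≠ T.mate (.inr x) := fun e => h (congrArg Sum.inr (Subtype.ext e))
      have hz' : z.1 ≠ T.mate (.inr (T.opp x)) := fun e => h' (congrArg Sum.inr (Subtype.ext (by
        simp [removePoint, rejoin, e])))
      change T.mate z.1 = rejoin _ _ _ z.1
      simp [rejoin, hz, hz']

theorem glue_removeCircle (x : α) (hx : T.live x) (he : T.mate (.inr x) = .inr (T.opp x))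
    (h2 : ∀ y, T.live y → T.node y = T.node x → y = x ∨ y = T.opp x) :
    (T.glue O).toModule δ = δ • ((T.removeCircle x hx he).glue O).toModule δ := by
  refine FramedGraph.toModule_eq_smul δ
    ⟨_, point_extends hx (fun _ => rfl) O rfl rfl h2, ?_, ?_⟩
  · intro i
    refine congrArg Sum.inr (Subtype.ext ?_)
    have m1 := T.mate_mate (.inr x) hx
    cases i
    · simpa [pointHalf] using he
    · simpa [he, pointHalf] using m1
  · rintro (k | z)
    · rfl
    · rfl

/-- The half-edges of the two nodes of a bigon: the node, the strand, and whether the half-edge is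
the first or the second one met on the strand. -/
def bigonHalf (a b c d : α) : Bool × Bool × Bool → α
  | (false, false, i) => T.pointHalf a i
  | (false, true, i) => T.pointHalf c i
  | (true, false, i) => T.pointHalf b i
  | (true, true, i) => T.pointHalf d i

theorem bigonHalf_injective {a b c d : α} (h : T.IsBigon a b c d) :
    Function.Injective (T.bigonHalf a b c d) := by
  have hd := h.distinct
  simp only [List.nodup_cons, List.mem_cons, List.not_mem_nil, or_false, not_or] at hd
  rintro ⟨_ | _, _ | _, _ | _⟩ ⟨_ | _, _ | _, _ | _⟩ <;> simp only [bigonHalf, pointHalf] <;> grind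

/-- Removing a bigon inverts a second Reidemeister move of framed graphs. -/
theorem glue_removeBigon {a b c d : α} (h : T.IsBigon a b c d) :
    (T.glue O).toModule δ = ((T.removeBigon h).glue O).toModule δ := by
  have hd := h.distinct
  simp only [List.nodup_cons, List.mem_cons, List.not_mem_nil, or_false, not_or] at hd
  have hna := T.node_eq_iff h.node_ac h.ac
  have hnb := T.node_eq_iff h.node_bd h.bd
  have lb : T.live (T.opp b) := by rw [T.live_opp]; exact h.live_b
  have lc : T.live (T.opp c) := by rw [T.live_opp]; exact h.live_c
  have ld : T.live (T.opp d) := by rw [T.live_opp]; exact h.live_d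
  have la : T.live (T.opp a) := by rw [T.live_opp]; exact h.live_a
  have hab := h.node_ne
  have hac := h.node_ac
  have hbd := h.node_bd
  have hl : ∀ v, T.live v ↔ (T.removeBigon h).live v ∨ ∃ n, T.bigonHalf a b c d n = v := by
    intro v
    simp only [removeBigon, Bool.and_eq_true, bne_iff_ne, ne_eq, hna, hnb, Prod.exists,
      Bool.exists_bool, bigonHalf, pointHalf]
    have := h.live_a
    have := h.live_b
    have := h.live_c
    have := h.live_d
    grind
  have hdj : ∀ n, ¬ (T.removeBigon h).live (T.bigonHalf a b c d n) := by
    rintro ⟨_ | _, _ | _, _ | _⟩ <;>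
      simp [removeBigon, bigonHalf, pointHalf, T.node_opp, hac, hbd]
  have fr : ∀ u ∈ [a, T.opp b, c, T.opp d], T.live u →
      liveEnd (T.removeBigon h).live (T.mate (.inr u)) := by
    intro u hu hu'
    change liveEnd (fun v => T.live v && (T.node v != T.node a && T.node v != T.node b)) _ = true
    rw [liveEnd_and, Bool.and_eq_true]
    exact ⟨T.live_mate _ hu', h.free' T hu⟩
  have ma := T.mate_mate (.inr a) h.live_a
  have mc := T.mate_mate (.inr c) h.live_c
  have mb := T.mate_mate (.inr (T.opp b)) lb
  have md := T.mate_mate (.inr (T.opp d)) ld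
  have r1 : (T.removeBigon h).mate (T.mate (.inr a)) = T.mate (.inr (T.opp b)) := by
    change rejoin _ _ (rejoin _ _ _) _ = _
    simp only [rejoin]
    grind
  have r2 : (T.removeBigon h).mate (T.mate (.inr c)) = T.mate (.inr (T.opp d)) := by
    change rejoin _ _ (rejoin _ _ _) _ = _
    simp only [rejoin]
    grind
  -- The strands are followed from the half-edges joined to `a` and to `c`.
  let h₀ : Bool → (T.removeBigon h).GlueH O := fun s =>
    if s then .inr ⟨T.mate (.inr c), fr c (by simp) h.live_c⟩
    else .inr ⟨T.mate (.inr a), fr a (by simp) h.live_a⟩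
  refine FramedGraph.toModule_eq δ (.secondMove
    ⟨growEquiv O _ (T.bigonHalf_injective h) hl hdj, h₀, ?_, ?_,
      glue_extends O (T.bigonHalf_injective h) hl hdj (by exact rfl) (by exact rfl) ?_ ?_ ?_, ?_,
          ?_⟩)
  · intro e
    have : T.mate (.inr c) = T.mate (.inr a) := congrArg Subtype.val (Sum.inr_injective e)
    grind
  · intro e
    have : T.mate (.inr c) = (T.removeBigon h).mate (T.mate (.inr a)) :=
      congrArg Subtype.val (Sum.inr_injective e)
    grind
  · rintro ⟨_ | _, _ | _, _ | _⟩ <;> simp [bigonHalf, pointHalf, T.opp_opp]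
  · rintro ⟨_ | _, _ | _, _ | _⟩ ⟨_ | _, _ | _, _ | _⟩ <;>
      simp [bigonHalf, pointHalf, T.node_opp, hac, hbd] <;> grind
  · rintro ⟨_ | _, _ | _, _ | _⟩ y hy <;>
      simp only [removeBigon, Bool.and_eq_true, bne_iff_ne] at hy <;>
      simp only [bigonHalf, pointHalf, T.node_opp] <;> grind
  · rintro (_ | _)
    · refine ⟨congrArg Sum.inr (Subtype.ext ma), congrArg Sum.inr (Subtype.ext h.mate_b),
        congrArg Sum.inr (Subtype.ext r1.symm)⟩
    · refine ⟨congrArg Sum.inr (Subtype.ext mc), congrArg Sum.inr (Subtype.ext h.mate_d),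
        congrArg Sum.inr (Subtype.ext r2.symm)⟩
  · rintro (k | z) hz
    · rfl
    · refine congrArg Sum.inr (Subtype.ext ?_)
      have z1 : z.1 ≠ T.mate (.inr a) := fun e => (hz false).1 (congrArg Sum.inr (Subtype.ext e))
      have z2 : z.1 ≠ T.mate (.inr (T.opp b)) := fun e =>
        (hz false).2 (congrArg Sum.inr (Subtype.ext (e.trans r1.symm)))
      have z3 : z.1 ≠ T.mate (.inr c) := fun e => (hz true).1 (congrArg Sum.inr (Subtype.ext e))
      have z4 : z.1 ≠ T.mate (.inr (T.opp d)) := fun e =>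
        (hz true).2 (congrArg Sum.inr (Subtype.ext (e.trans r2.symm)))
      change T.mate z.1 = rejoin _ _ (rejoin _ _ _) z.1
      simp [rejoin, z1, z2, z3, z4]

/-- A bijection between the half-edges of two tangles which respects opposite half-edges, nodes
and edges. -/
structure IsRelabelling (T T' : Tangle P α) (e : α → α) : Prop where
  bijective : Function.Bijective e
  live : ∀ a, T'.live (e a) = T.live a
  opp : ∀ a, T.live a → e (T.opp a) = T'.opp (e a)
  node : ∀ a b, T.live a → T.live b → (T'.node (e a) = T'.node (e b) ↔ T.node a = T.node b)
  mate : ∀ z, liveEnd T.live z → T'.mate (Sum.map id e z) = Sum.map id e (T.mate z)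

omit [DecidableEq P] [DecidableEq α] in
theorem glue_relabel {T T' : Tangle P α} {e₀ : α → α} (h : IsRelabelling T T' e₀) :
    (T'.glue O).toModule δ = (T.glue O).toModule δ := by
  let e : Equiv.Perm α := Equiv.ofBijective e₀ h.bijective
  have hlive : ∀ z : P ⊕ α, liveEnd T'.live (Equiv.sumCongr (Equiv.refl P) e z) = liveEnd T.live z
      := by
    rintro (p | a)
    · rfl
    · exact h.live a
  let E : T.End ≃ T'.End := Equiv.subtypeEquiv (Equiv.sumCongr (Equiv.refl P) e) fun z => by
    rw [hlive]
  have hp : ∀ g : T.GlueH O, place (Equiv.sumCongr (Equiv.refl O.K) E g) = Sum.map id e (place g) :=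
      by
    rintro (k | ⟨p | a, ha⟩) <;> rfl
  refine FramedGraph.toModule_eq δ (.iso ⟨Equiv.sumCongr (Equiv.refl _) E, ?_, ?_, ?_⟩)
  · rintro (k | z)
    · rfl
    · exact congrArg Sum.inr (Subtype.ext (h.mate z.1 z.2))
  · intro g
    apply place_injective
    refine (place_glueOpp O T' _).trans ?_
    refine Eq.trans ?_ (hp _).symm
    erw [hp g, place_glueOpp O T g]
    rcases g with k | ⟨p | a, ha⟩
    · rfl
    · rfl
    · exact congrArg Sum.inr (h.opp a ha).symm
  · intro g g'
    change glueNode O T' _ = glueNode O T' _ ↔ glueNode O T g = glueNode O T g'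
    simp only [glueNode]
    erw [hp g, hp g']
    rcases g with k | ⟨p | a, ha⟩ <;> rcases g' with k' | ⟨p' | a', ha'⟩ <;> simp [place]
    exact h.node a a' ha ha'

end Relations

end Tangle

/-! ### Simplification of tangles -/

namespace Tangle

variable {P α : Type} [Finite P] [Finite α] [DecidableEq P] [DecidableEq α]

/-- The result of removing the two-valent node of `x` from `T`, together with the number of
circles that have been split off. -/
def step (T : Tangle P α) (x : α) : ℕ × Tangle P α :=
  if h : T.live x then
    if he : T.mate (.inr x) = .inr (T.opp x) then (1, T.removeCircle x h he)
    else (0, T.removePoint x h he)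
  else (0, T)

theorem step_opp (T : Tangle P α) (x : α) : (T.step x).2.opp = T.opp := by
  unfold step
  split_ifs <;> rfl

theorem step_node (T : Tangle P α) (x : α) : (T.step x).2.node = T.node := by
  unfold step
  split_ifs <;> rfl

/-- The two-valent nodes given by a list of half-edges are removed one after another, and the
circles that split off are counted. -/
def reduce : List α → Tangle P α → ℕ × Tangle P α
  | [], T => (0, T)
  | x :: l, T => ((T.step x).1 + (reduce l (T.step x).2).1, (reduce l (T.step x).2).2)

/-- The node of `x` is two-valent. -/
def IsPoint (T : Tangle P α) (x : α) : Prop := ∀ y, T.node y = T.node x → y = x ∨ y = T.opp x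

section

variable {R : Type*} [CommRing R] (δ : R) (O : Outer P)

theorem glue_step (T : Tangle P α) (x : α) (h : T.IsPoint x) :
    (T.glue O).toModule δ = δ ^ (T.step x).1 • ((T.step x).2.glue O).toModule δ := by
  unfold step
  split_ifs with h1 h2
  · rw [pow_one]
    exact T.glue_removeCircle δ O x h1 h2 fun y _ hy => h y hy
  · rw [pow_zero, one_smul]
    exact T.glue_removePoint δ O x h1 h2 fun y _ hy => h y hy
  · rw [pow_zero, one_smul]

theorem glue_reduce (l : List α) (T : Tangle P α) (h : ∀ x ∈ l, T.IsPoint x) :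
    (T.glue O).toModule δ = δ ^ (reduce l T).1 • ((reduce l T).2.glue O).toModule δ := by
  induction l generalizing T with
  | nil => simp [reduce]
  | cons x l ih =>
    rw [T.glue_step δ O x (h x (by simp)), ih (T.step x).2, smul_smul, reduce, pow_add]
    intro y hy
    unfold IsPoint
    rw [step_opp, step_node]
    exact h y (by simp [hy])

end

/-- The tangle consists of arcs without half-edges which join the ends as given by `m`. -/
def IsArcs (T : Tangle P α) (m : P → P) : Prop :=
  (∀ a, T.live a = false) ∧ ∀ p, T.mate (.inl p) = .inl (m p)

instance [Fintype P] [Fintype α] (T : Tangle P α) (m : P → P) : Decidable (T.IsArcs m) := by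
  unfold IsArcs
  infer_instance

/-- A tangle without half-edges is determined by the ends it joins. The values of `opp` and `node`
do
not matter, as no half-edge is live. -/
theorem IsArcs.glue_eq {R : Type*} [CommRing R] (δ : R) (O : Outer P) {T T' : Tangle P α}
    {m : P → P} (h : T.IsArcs m) (h' : T'.IsArcs m) :
    (T.glue O).toModule δ = (T'.glue O).toModule δ := by
  refine glue_relabel δ O (e₀ := id) ⟨Function.bijective_id, ?_, ?_, ?_, ?_⟩
  · simp [h.1, h'.1]
  · simp [h'.1]
  · simp [h'.1]
  · rintro (p | a) hz
    · simp [h.2, h'.2]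
    · simp [liveEnd, h'.1] at hz

instance [Fintype P] [Fintype α] (T T' : Tangle P α) (e : α → α) :
    Decidable (IsRelabelling T T' e) :=
  decidable_of_iff (Function.Bijective e ∧ (∀ a, T'.live (e a) = T.live a) ∧
      (∀ a, T.live a → e (T.opp a) = T'.opp (e a)) ∧
      (∀ a b, T.live a → T.live b → (T'.node (e a) = T'.node (e b) ↔ T.node a = T.node b)) ∧
      ∀ z, liveEnd T.live z → T'.mate (Sum.map id e z) = Sum.map id e (T.mate z))
    ⟨fun ⟨h1, h2, h3, h4, h5⟩ => ⟨h1, h2, h3, h4, h5⟩,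
      fun ⟨h1, h2, h3, h4, h5⟩ => ⟨h1, h2, h3, h4, h5⟩⟩

instance [Fintype P] [Fintype α] (T : Tangle P α) (a b c d : α) : Decidable (T.IsBigon a b c d) :=
  decidable_of_iff (T.live a ∧ T.live b ∧ T.live c ∧ T.live d ∧ T.node a = T.node c ∧
      T.node b = T.node d ∧ T.node a ≠ T.node b ∧ (a ≠ c ∧ a ≠ T.opp c) ∧
      (b ≠ d ∧ b ≠ T.opp d) ∧ T.mate (.inr (T.opp a)) = .inr b ∧
      T.mate (.inr (T.opp c)) = .inr d ∧
      ∀ u, u ∈ [a, T.opp b, c, T.opp d] → ∀ v, T.mate (.inr u) = .inr v →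
        T.node v ≠ T.node a ∧ T.node v ≠ T.node b)
    ⟨fun ⟨h1, h2, h3, h4, h5, h6, h7, h8, h9, h10, h11, h12⟩ =>
        ⟨h1, h2, h3, h4, h5, h6, h7, h8, h9, h10, h11, h12⟩,
      fun ⟨h1, h2, h3, h4, h5, h6, h7, h8, h9, h10, h11, h12⟩ =>
        ⟨h1, h2, h3, h4, h5, h6, h7, h8, h9, h10, h11, h12⟩⟩

end Tangle

/-! ### Tangles of crossings -/

instance : DecidableEq CrossingState
  | .oriented, .oriented | .disoriented, .disoriented | .vertex, .vertex => .isTrue rfl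
  | .oriented, .disoriented | .oriented, .vertex | .disoriented, .oriented
  | .disoriented, .vertex | .vertex, .oriented | .vertex, .disoriented => .isFalse (by simp)

/-- The half-edges at crossings `N`: the crossing, whether the strand is the under-strand, and
whether the half-edge is outgoing. -/
abbrev Half (N : Type) : Type := N × Bool × Bool

/-- The analogue of `VirtualDiagram.stateOpp` for the half-edges at crossings `N`. -/
def smoothOpp {N : Type} (s : N → CrossingState) (a : Half N) : Half N :=
  match s a.1 with
  | .oriented => (a.1, !a.2.1, !a.2.2)
  | .disoriented => (a.1, !a.2.1, a.2.2)
  | .vertex => (a.1, a.2.1, !a.2.2)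

/-- The analogue of `VirtualDiagram.stateNode` for the half-edges at crossings `N`. -/
def smoothNode {N : Type} (s : N → CrossingState) (a : Half N) : Half N :=
  match s a.1 with
  | .oriented => (a.1, xor a.2.1 a.2.2, false)
  | .disoriented => (a.1, a.2.2, false)
  | .vertex => (a.1, false, false)

/-- The tangle formed by crossings `N` in the state `s`, with edges given by `mate`. -/
def crossingTangle {P N : Type} (mate : P ⊕ Half N → P ⊕ Half N) (h : ∀ z, mate (mate z) = z)
    (hne : ∀ z, mate z ≠ z) (s : N → CrossingState) : Tangle P (Half N) where
  live _ := true
  mate := mate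
  opp := smoothOpp s
  node := smoothNode s
  live_opp _ := rfl
  opp_opp := by rintro ⟨c, p, i⟩; cases h : s c <;> simp [smoothOpp, h]
  opp_ne := by rintro ⟨c, p, i⟩; cases h : s c <;> simp [smoothOpp, h]
  node_opp := by rintro ⟨c, p, i⟩; cases h : s c <;> simp [smoothOpp, smoothNode, h]
  valence := by
    rintro ⟨c, p, i⟩ ⟨c', p', i'⟩ ⟨c'', p'', i''⟩ h1 h2
    have e1 : c = c' := by
      have := congrArg Prod.fst h1
      cases h : s c <;> cases h' : s c' <;> simpa [smoothNode, h, h'] using this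
    have e2 : c = c'' := by
      have := congrArg Prod.fst h2
      cases h : s c <;> cases h' : s c'' <;> simpa [smoothNode, h, h'] using this
    subst e1 e2
    revert h1 h2
    cases h : s c <;> cases p <;> cases p' <;> cases p'' <;> cases i <;> cases i' <;> cases i'' <;>
      simp [smoothNode, smoothOpp, h]
  matching := ⟨fun z _ => by rcases mate z with p | a <;> rfl, fun z _ => h z, fun z _ => hne z⟩

/-- One half-edge at each of the two-valent nodes into which the crossing `c` is split. -/
def splitPoints {N : Type} (s : N → CrossingState) (c : N) : List (Half N) :=
  match s c with
  | .oriented => [(c, false, false), (c, true, false)]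
  | .disoriented => [(c, false, false), (c, false, true)]
  | .vertex => []

theorem isPoint_of_mem_splitPoints {P N : Type} {mate : P ⊕ Half N → P ⊕ Half N}
    (h : ∀ z, mate (mate z) = z) (hne : ∀ z, mate z ≠ z) (s : N → CrossingState) (l : List N) :
    ∀ x ∈ l.flatMap (splitPoints s), (crossingTangle mate h hne s).IsPoint x := by
  intro x hx
  obtain ⟨c, -, hx⟩ := List.mem_flatMap.1 hx
  rintro ⟨c', p, i⟩ hy
  have e : c' = x.1 := by
    have := congrArg Prod.fst hy
    change (smoothNode s _).1 = (smoothNode s _).1 at this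
    cases h : s c' <;> cases h' : s x.1 <;> simpa [smoothNode, h, h'] using this
  subst e
  change smoothNode s _ = smoothNode s _ at hy
  change _ ∨ _ = smoothOpp s x
  cases h : s c <;> simp only [splitPoints, h, List.mem_cons, List.not_mem_nil, or_false] at hx
  all_goals
    rcases hx with rfl | rfl <;> revert hy <;> cases p <;> cases i <;>
      simp [smoothNode, smoothOpp, h]

theorem sum_crossingState {M : Type*} [AddCommMonoid M] (f : CrossingState → M) :
    ∑ s, f s = f .oriented + f .disoriented + f .vertex := by
  change Multiset.sum (Multiset.map f (Multiset.ofList [.oriented, .disoriented, .vertex])) = _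
  simp [add_assoc]

/-- The two ends of each strand are joined. -/
def straight {ι : Type} (z : ι × Bool) : ι × Bool := (z.1, !z.2)

section Kink

/-- The edges of a kink. The end `((), i)` is the beginning or the end of the strand; the strand
passes first below if `u` is true. -/
def kinkMate (u : Bool) : (Unit × Bool) ⊕ Half Unit → (Unit × Bool) ⊕ Half Unit
  | .inl (_, i) => .inr ((), xor u i, i)
  | .inr (_, p, i) => if p = xor u i then .inl ((), i) else .inr ((), !p, !i)

/-- The tangle of a kink in the state `s`. -/
def kink (u : Bool) (s : Unit → CrossingState) : Tangle (Unit × Bool) (Half Unit) :=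
  crossingTangle (kinkMate u) (by revert u; decide) (by revert u; decide) s

variable {R : Type*} [CommRing R]

open Tangle in
/-- The sum over the states of a kink. The oriented smoothing splits off a circle, and the
disoriented one
does not; the graphical vertex has coefficient zero. -/
theorem sum_kink (δ : R) (O : Outer (Unit × Bool)) (u : Bool) (k : CrossingState → R) (w : R)
    (h : δ * k .oriented + k .disoriented = w) (h' : k .vertex = 0) {T : Tangle (Unit × Bool) (Half
        Unit)}
    (hT : T.IsArcs straight) :
    ∑ s : Unit → CrossingState, (∏ c, k (s c)) • ((kink u s).glue O).toModule δ =
      w • (T.glue O).toModule δ := by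
  have red : ∀ s, _ := fun s => glue_reduce δ O _ (kink u s)
    (isPoint_of_mem_splitPoints _ _ s [()])
  rw [Fintype.sum_equiv (Equiv.funUnique Unit CrossingState) _
    (fun s => k s • ((kink u fun _ => s).glue O).toModule δ) (fun s => by
      simp only [Finset.univ_unique, Finset.prod_singleton]; rfl),
    sum_crossingState, h', zero_smul, add_zero, red, red]
  have e : ∀ s, s ≠ .vertex → ∀ u,
      (reduce ([()].flatMap (splitPoints fun _ => s)) (kink u fun _ => s)).1 =
        (if s = .oriented then 1 else 0) ∧
      (reduce ([()].flatMap (splitPoints fun _ => s)) (kink u fun _ => s)).2.IsArcs straight := by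
    decide +kernel
  have e1 := e .oriented (by simp)
  have e2 := e .disoriented (by simp)
  rw [(e1 u).1, (e2 u).1, (e1 u).2.glue_eq δ O hT, (e2 u).2.glue_eq δ O hT, ← h,
    if_pos rfl, if_neg (by simp)]
  module

end Kink

section Clasp

/-- The edges of the tangle of a second Reidemeister move. The ends of the over-strand are
`(false, i)`, those of the under-strand `(true, i)`, where `i` is true at the end of the strand.
The over-strand passes the crossing `false` first; the under-strand does so if `r` is false. -/
def claspMate (r : Bool) : (Bool × Bool) ⊕ Half Bool → (Bool × Bool) ⊕ Half Bool
  | .inl (p, i) => .inr (xor (p && r) i, p, i)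
  | .inr (c, p, i) => if c = xor (p && r) i then .inl (p, i) else .inr (!c, p, !i)

/-- The tangle of a second Reidemeister move in the state `s`. -/
def clasp (r : Bool) (s : Bool → CrossingState) : Tangle (Bool × Bool) (Half Bool) :=
  crossingTangle (claspMate r) (by revert r; decide) (by revert r; decide) s

/-- The clasp in the state `s` without two-valent nodes, and the number of its circles. -/
def claspReduce (r : Bool) (a b : CrossingState) : ℕ × Tangle (Bool × Bool) (Half Bool) :=
  Tangle.reduce ([false, true].flatMap (splitPoints (Bool.rec a b))) (clasp r (Bool.rec a b))

/-- The ends of different strands are joined: equal ends (both beginnings or both ends) if `r`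
is false, opposite ones if `r` is true. -/
def turned (r : Bool) (z : Bool × Bool) : Bool × Bool := (!z.1, xor z.2 r)

/-- The strands into which the smoothings of a clasp join its ends, and the number of circles split
off. A circle arises when the two smoothings are of the same kind and the strands inside the bigon
are turned back. -/
theorem claspReduce_arcs :
    ∀ r, ((claspReduce r .oriented .oriented).1 = r.toNat ∧
        (claspReduce r .oriented .oriented).2.IsArcs (if r then turned r else straight)) ∧
      ((claspReduce r .disoriented .disoriented).1 = (!r).toNat ∧
        (claspReduce r .disoriented .disoriented).2.IsArcs (if r then straight else turned r)) ∧
      ((claspReduce r .oriented .disoriented).1 = 0 ∧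
        (claspReduce r .oriented .disoriented).2.IsArcs (turned r)) ∧
      ((claspReduce r .disoriented .oriented).1 = 0 ∧
        (claspReduce r .disoriented .oriented).2.IsArcs (turned r)) := by
  decide +kernel

theorem clasp_isBigon : ∀ r, (clasp r fun _ => .vertex).IsBigon (false, false, false)
    (true, false, false) (false, true, r) (true, true, r) := by
  decide +kernel

theorem clasp_removeBigon_arcs :
    ∀ r, ((clasp r fun _ => .vertex).removeBigon (clasp_isBigon r)).IsArcs straight := by
  decide +kernel

variable {R : Type*} [CommRing R]

open Tangle in
/-- The sum over the states of a clasp. The smoothed state with straight strands and the state with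
two vertices, which is a bigon, give the straight tangle with total coefficient one, and the three
smoothed states with turned strands cancel. -/
theorem sum_clasp (δ : R) (O : Outer (Bool × Bool)) (r : Bool) (k : Bool → CrossingState → R)
    (h1 : k false .oriented * k true .vertex = 0) (h2 : k false .vertex * k true .oriented = 0)
    (h3 : k false .disoriented * k true .vertex = 0)
    (h4 : k false .vertex * k true .disoriented = 0)
    (h5 : k false .oriented * k true .oriented = 1 - k false .vertex * k true .vertex)
    (h6 : k false .disoriented * k true .disoriented = 1 - k false .vertex * k true .vertex)
    (h7 : δ * (k false .oriented * k true .oriented) =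
      -(k false .oriented * k true .disoriented) - k false .disoriented * k true .oriented)
    {T : Tangle (Bool × Bool) (Half Bool)} (hT : T.IsArcs straight) :
    ∑ s : Bool → CrossingState, (∏ c, k c (s c)) • ((clasp r s).glue O).toModule δ =
      (T.glue O).toModule δ := by
  have red : ∀ a b, ((clasp r (Bool.rec a b)).glue O).toModule δ =
      δ ^ (claspReduce r a b).1 • ((claspReduce r a b).2.glue O).toModule δ :=
    fun a b => glue_reduce δ O _ (clasp r _) (isPoint_of_mem_splitPoints _ _ _ [false, true])
  rw [Fintype.sum_equiv (Equiv.boolArrowEquivProd CrossingState) _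
    (fun s => (k false s.1 * k true s.2) • ((clasp r (Bool.rec s.1 s.2)).glue O).toModule δ)
    (fun s => by
      rw [Fintype.prod_bool, mul_comm]
      congr
      funext b
      cases b <;> rfl),
    Fintype.sum_prod_type]
  simp only [sum_crossingState, h1, h2, h3, h4, zero_smul, add_zero, zero_add]
  obtain ⟨⟨n1, a1⟩, ⟨n2, a2⟩, ⟨n3, a3⟩, ⟨n4, a4⟩⟩ := claspReduce_arcs r
  have e5 : ((clasp r (Bool.rec .vertex .vertex)).glue O).toModule δ = (T.glue O).toModule δ := by
    have : (Bool.rec .vertex .vertex : Bool → CrossingState) = fun _ => .vertex := by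
      funext b
      cases b <;> rfl
    rw [this, glue_removeBigon δ O _ (clasp_isBigon r), (clasp_removeBigon_arcs r).glue_eq δ O hT]
  rw [red, red, red, red, e5, n1, n2, n3, n4, a4.glue_eq δ O a3, h5, h6]
  rw [h5] at h7
  -- If the strands have the same direction, the two oriented smoothings give straight strands and
  -- the two disoriented ones a circle; for opposite directions their roles are exchanged.
  cases r
  · rw [if_neg (by simp)] at a1 a2
    rw [a1.glue_eq δ O hT, a2.glue_eq δ O a3]
    simp only [Bool.toNat_false, Bool.not_false, Bool.toNat_true]
    linear_combination (norm := module) h7 • ((claspReduce false .oriented .disoriented).2.glue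
        O).toModule δ
  · rw [if_pos rfl] at a1 a2
    rw [a2.glue_eq δ O hT, a1.glue_eq δ O a3]
    simp only [Bool.toNat_false, Bool.not_true, Bool.toNat_true]
    linear_combination (norm := module) h7 • ((claspReduce true .oriented .disoriented).2.glue
        O).toModule δ

end Clasp

/-! ### The tangles of a third Reidemeister move -/

section Triangle

/-- The passages of the three strands of a triangle, as crossings and whether the strand passes
below. The strands `0`, `1`, `2` are the top, the middle and the bottom strand; the crossings `0`,
`1`, `2` are those of top and middle, of top and bottom, and of middle and bottom strand. -/
def trianglePassage : Fin 3 × Bool → Fin 3 × Bool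
  | (0, i) => (if i then 1 else 0, false)
  | (1, i) => (if i then 2 else 0, !i)
  | (2, i) => (if i then 2 else 1, true)

/-- The strand on which a passage lies and whether it is the second one there; the inverse of
`trianglePassage`. -/
def triangleStrand : Fin 3 × Bool → Fin 3 × Bool
  | (0, p) => (if p then 1 else 0, false)
  | (1, p) => (if p then 2 else 0, !p)
  | (2, p) => (if p then 2 else 1, true)

/-- The edges of the triangle of a third Reidemeister move. The end `(j, i)` is the beginning or
the end of the strand `j`. If `f` is true, the passages of each strand are exchanged. -/
def triangleMate (f : Bool) : (Fin 3 × Bool) ⊕ Half (Fin 3) → (Fin 3 × Bool) ⊕ Half (Fin 3)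
  | .inl (j, i) =>
    .inr ((trianglePassage (j, xor i f)).1, (trianglePassage (j, xor i f)).2, i)
  | .inr (c, p, i) =>
    if xor (triangleStrand (c, p)).2 f = i then .inl ((triangleStrand (c, p)).1, i)
    else .inr ((trianglePassage ((triangleStrand (c, p)).1, !(triangleStrand (c, p)).2)).1,
      (trianglePassage ((triangleStrand (c, p)).1, !(triangleStrand (c, p)).2)).2, !i)

/-- The tangle of a triangle in the state `s`. -/
def triangle (f : Bool) (s : Fin 3 → CrossingState) : Tangle (Fin 3 × Bool) (Half (Fin 3)) :=
  crossingTangle (triangleMate f) (by revert f; decide) (by revert f; decide) s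

/-- The state of the triangle in which `Q` is chosen at the crossing of the top and the middle
strand, and `P` and `S` are chosen at the first and the second crossing on the bottom strand. -/
def triangleState (f : Bool) (P Q S : CrossingState) : Fin 3 → CrossingState :=
  if f then ![Q, S, P] else ![Q, P, S]

/-- A state of the triangle without two-valent nodes, and the number of its circles. -/
def triangleReduce (f : Bool) (P Q S : CrossingState) :
    ℕ × Tangle (Fin 3 × Bool) (Half (Fin 3)) :=
  Tangle.reduce ([0, 1, 2].flatMap (splitPoints (triangleState f P Q S)))
    (triangle f (triangleState f P Q S))

/-- The tangle after the removal of a bigon, or the tangle itself if the half-edges do not form a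
bigon. -/
def Tangle.bigonStep {P α : Type} [Finite P] [Finite α] [Fintype P] [Fintype α] [DecidableEq P]
    [DecidableEq α] (T : Tangle P α) (a b c d : α) : Tangle P α :=
  if h : T.IsBigon a b c d then T.removeBigon h else T

theorem Tangle.glue_bigonStep {P α : Type} [Fintype P] [Fintype α] [DecidableEq P]
    [DecidableEq α] {R : Type*} [CommRing R] (δ : R) (O : Outer P) (T : Tangle P α) (a b c d : α) :
    (T.glue O).toModule δ = ((T.bigonStep a b c d).glue O).toModule δ := by
  unfold bigonStep
  split_ifs with h
  · exact glue_removeBigon δ O T h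
  · rfl

/-- One state of the triangle has `n` circles, and without them it differs from another state
only by the relabelling `e`. -/
def TriangleEquiv (f : Bool) (P Q S : CrossingState) (n : ℕ) (f' : Bool)
    (P' Q' S' : CrossingState) (e : Half (Fin 3) → Half (Fin 3)) : Prop :=
  (triangleReduce f P Q S).1 = n ∧
    Tangle.IsRelabelling (triangleReduce f' P' Q' S').2 (triangleReduce f P Q S).2 e

/-- After the removal of a bigon, one state of the triangle agrees with another. -/
def TriangleBigon (f : Bool) (P Q S : CrossingState) (a b c d : Half (Fin 3)) (f' : Bool)
    (P' Q' S' : CrossingState) : Prop :=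
  (triangleReduce f P Q S).1 = 0 ∧
    Tangle.IsRelabelling (triangleReduce f' P' Q' S').2
      ((triangleReduce f P Q S).2.bigonStep a b c d) id

instance (f : Bool) (P Q S : CrossingState) (n : ℕ) (f' : Bool) (P' Q' S' : CrossingState)
    (e : Half (Fin 3) → Half (Fin 3)) : Decidable (TriangleEquiv f P Q S n f' P' Q' S' e) := by
  unfold TriangleEquiv
  infer_instance

instance (f : Bool) (P Q S : CrossingState) (a b c d : Half (Fin 3)) (f' : Bool)
    (P' Q' S' : CrossingState) : Decidable (TriangleBigon f P Q S a b c d f' P' Q' S') := by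
  unfold TriangleBigon
  infer_instance

/-- The half-edges of the crossings `c` and `c'` are exchanged. -/
def swapHalf (c c' : Fin 3) (a : Half (Fin 3)) : Half (Fin 3) := (Equiv.swap c c' a.1, a.2)

/-- The two strands are exchanged at the crossings where `g` is true; the directions of
the over-strand and of the under-strand are then reversed if `b₀` or `b₁` is true. -/
def turnHalf (g b₀ b₁ : Fin 3 → Bool) (a : Half (Fin 3)) : Half (Fin 3) :=
  (a.1, xor a.2.1 (g a.1), xor a.2.2 (if a.2.1 then b₁ a.1 else b₀ a.1))

/-- The states which represent the others have no circles. -/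
theorem triangleReduce_fst :
    (triangleReduce false .oriented .oriented .oriented).1 = 0 ∧
    (triangleReduce false .disoriented .disoriented .oriented).1 = 0 ∧
    (triangleReduce false .disoriented .oriented .disoriented).1 = 0 ∧
    (triangleReduce false .disoriented .oriented .oriented).1 = 0 ∧
    (triangleReduce true .oriented .oriented .disoriented).1 = 0 ∧
    (triangleReduce false .disoriented .oriented .vertex).1 = 0 ∧
    (triangleReduce true .oriented .oriented .vertex).1 = 0 ∧
    (triangleReduce true .vertex .oriented .disoriented).1 = 0 ∧
    (triangleReduce false .vertex .oriented .oriented).1 = 0 ∧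
    (triangleReduce true .oriented .vertex .disoriented).1 = 0 ∧
    (triangleReduce false .disoriented .vertex .oriented).1 = 0 ∧
    (triangleReduce false .disoriented .vertex .vertex).1 = 0 ∧
    (triangleReduce false .vertex .oriented .vertex).1 = 0 ∧
    (triangleReduce false .vertex .vertex .oriented).1 = 0 := by
  decide +kernel

/-- The states which agree, after the removal of a bigon if there is one, with a state of the second
triangle that has no vertices and an even number of disoriented smoothings. -/
theorem triangleEquiv_planar :
    TriangleEquiv true .oriented .oriented .oriented 0 false .oriented .oriented .oriented id ∧
    TriangleBigon true .vertex .vertex .oriented (2, false, false) (0, true, false) (2, true, false)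
        (0, false, false)
      false .oriented .oriented .oriented ∧
    TriangleBigon false .oriented .vertex .vertex (0, false, false) (2, true, false) (0, true,
        false) (2, false, false)
      false .oriented .oriented .oriented ∧
    TriangleEquiv true .oriented .disoriented .disoriented 0 false .disoriented .disoriented
        .oriented id ∧
    TriangleBigon true .vertex .disoriented .vertex (2, false, false) (1, false, true) (2, true,
        false) (1, true, false)
      false .disoriented .disoriented .oriented ∧
    TriangleBigon false .vertex .disoriented .vertex (1, false, true) (2, false, false) (1, true,
        false) (2, true, false)
      false .disoriented .disoriented .oriented ∧
    TriangleEquiv true .disoriented .oriented .disoriented 0 false .disoriented .oriented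
        .disoriented id ∧
    TriangleBigon true .disoriented .vertex .vertex (0, false, true) (1, false, true) (0, true,
        true) (1, true, false)
      false .disoriented .oriented .disoriented ∧
    TriangleBigon false .vertex .vertex .disoriented (1, false, true) (0, false, true) (1, true,
        false) (0, true, true)
      false .disoriented .oriented .disoriented := by
  decide +kernel

/-- The states which join the ends like the oriented smoothings at two crossings and the disoriented
one at a crossing of the bottom strand. -/
theorem triangleEquiv_turn :
    TriangleEquiv true .oriented .disoriented .oriented 0 false .disoriented .oriented .oriented id
        ∧
    TriangleEquiv true .disoriented .oriented .oriented 0 false .disoriented .oriented .oriented id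
        ∧
    TriangleEquiv true .disoriented .disoriented .disoriented 0 false .disoriented .oriented
        .oriented id ∧
    TriangleEquiv true .disoriented .disoriented .oriented 1 false .disoriented .oriented .oriented
        id ∧
    TriangleEquiv false .oriented .oriented .disoriented 0 true .oriented .oriented .disoriented id
        ∧
    TriangleEquiv false .oriented .disoriented .oriented 0 true .oriented .oriented .disoriented id
        ∧
    TriangleEquiv false .disoriented .disoriented .disoriented 0 true .oriented .oriented
        .disoriented id ∧
    TriangleEquiv false .oriented .disoriented .disoriented 1 true .oriented .oriented .disoriented
        id := by
  decide +kernel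

/-- The states with one or two vertices which are not removed with a bigon. -/
theorem triangleEquiv_vertex :
    TriangleEquiv true .disoriented .oriented .vertex 0 false .disoriented .oriented .vertex
      (swapHalf 1 2) ∧
    TriangleEquiv true .disoriented .vertex .disoriented 0 false .disoriented .oriented .vertex
      (swapHalf 0 2 ∘ turnHalf (fun _ => true) (fun _ => false) fun _ => true) ∧
    TriangleEquiv false .oriented .oriented .vertex 0 true .oriented .oriented .vertex
      (swapHalf 1 2) ∧
    TriangleEquiv false .oriented .vertex .oriented 0 true .oriented .oriented .vertex
      (swapHalf 0 1) ∧
    TriangleEquiv false .disoriented .vertex .disoriented 0 true .vertex .oriented .disoriented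
      (swapHalf 0 2 ∘ turnHalf (fun _ => true) (fun _ => false) fun _ => true) ∧
    TriangleEquiv false .vertex .oriented .disoriented 0 true .vertex .oriented .disoriented
      (swapHalf 1 2) ∧
    TriangleEquiv true .oriented .vertex .oriented 0 false .vertex .oriented .oriented
      (swapHalf 0 1) ∧
    TriangleEquiv true .vertex .oriented .oriented 0 false .vertex .oriented .oriented
      (swapHalf 1 2) ∧
    TriangleEquiv false .disoriented .disoriented .vertex 0 true .oriented .vertex .disoriented
      (swapHalf 0 2 ∘ turnHalf (fun _ => true) (fun _ => true) fun _ => false) ∧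
    TriangleEquiv false .vertex .disoriented .oriented 0 true .oriented .vertex .disoriented
      (swapHalf 0 1) ∧
    TriangleEquiv true .oriented .disoriented .vertex 0 false .disoriented .vertex .oriented
      (swapHalf 0 1) ∧
    TriangleEquiv true .vertex .disoriented .disoriented 0 false .disoriented .vertex .oriented
      (swapHalf 0 2 ∘ turnHalf (fun _ => true) (fun _ => true) fun _ => false) ∧
    TriangleEquiv true .vertex .vertex .disoriented 0 false .disoriented .vertex .vertex
      (swapHalf 0 2 ∘
        turnHalf ![true, false, true] ![true, false, false] ![false, false, true]) ∧
    TriangleEquiv true .vertex .oriented .vertex 0 false .vertex .oriented .vertex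
      (swapHalf 1 2) ∧
    TriangleEquiv true .oriented .vertex .vertex 0 false .vertex .vertex .oriented
      (swapHalf 0 1) := by
  decide +kernel

open CrossingState in
/-- A function of the state of the triangle is summed over the states of the single crossings. -/
theorem sum_triangleState {M : Type*} [AddCommMonoid M] (f : Bool)
    (F : (Fin 3 → CrossingState) → M) :
    ∑ s, F s = ∑ P, ∑ Q, ∑ S, F (triangleState f P Q S) := by
  let e : (CrossingState × CrossingState × CrossingState) ≃ (Fin 3 → CrossingState) :=
    { toFun := fun p => triangleState f p.1 p.2.1 p.2.2
      invFun := fun s => if f then (s 2, s 0, s 1) else (s 1, s 0, s 2)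
      left_inv := by
        rintro ⟨P, Q, S⟩
        cases f <;> rfl
      right_inv := by
        intro s
        funext i
        cases f <;> fin_cases i <;> rfl }
  rw [← Equiv.sum_comp e, Fintype.sum_prod_type]
  simp only [Fintype.sum_prod_type]
  rfl

section

variable {R : Type*} [CommRing R] (δ : R) (O : Outer (Fin 3 × Bool))

/-- The class of a state of the triangle. -/
noncomputable def triangleClass (f : Bool) (P Q S : CrossingState) : PictureModule δ :=
  ((triangle f (triangleState f P Q S)).glue O).toModule δ

theorem triangleClass_eq_pow (f : Bool) (P Q S : CrossingState) :
    triangleClass δ O f P Q S = δ ^ (triangleReduce f P Q S).1 •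
      ((triangleReduce f P Q S).2.glue O).toModule δ :=
  Tangle.glue_reduce δ O _ _ (isPoint_of_mem_splitPoints _ _ _ [0, 1, 2])

theorem TriangleEquiv.eq {f : Bool} {P Q S : CrossingState} {n : ℕ} {f' : Bool}
    {P' Q' S' : CrossingState} {e : Half (Fin 3) → Half (Fin 3)}
    (h : TriangleEquiv f P Q S n f' P' Q' S' e) (h' : (triangleReduce f' P' Q' S').1 = 0) :
    triangleClass δ O f P Q S = δ ^ n • triangleClass δ O f' P' Q' S' := by
  rw [triangleClass_eq_pow, triangleClass_eq_pow, h', h.1, Tangle.glue_relabel δ O h.2, pow_zero,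
    one_smul]

theorem TriangleBigon.eq {f : Bool} {P Q S : CrossingState} {a b c d : Half (Fin 3)} {f' : Bool}
    {P' Q' S' : CrossingState} (h : TriangleBigon f P Q S a b c d f' P' Q' S')
    (h' : (triangleReduce f' P' Q' S').1 = 0) :
    triangleClass δ O f P Q S = triangleClass δ O f' P' Q' S' := by
  rw [triangleClass_eq_pow, triangleClass_eq_pow, h', h.1, Tangle.glue_bigonStep δ O _ a b c d,
    Tangle.glue_relabel δ O h.2]

end

/-- The states of the two triangles of a third Reidemeister move, weighted with the skein
coefficients of positive crossings coloured with `x`, `y`, `z`, have the same sum: this is the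
content of the relations (iii). -/
theorem sum_triangle {X : Type*} {Q : Biquandle X} {R : Type*} [CommRing R]
    (β : ParityBiquandleBracket Q R) (O : Outer (Fin 3 × Bool)) (x y z : X)
    (k k' : Fin 3 → CrossingState → R)
    (h0 : k 0 = fun s => β.coeff 1 s y z)
    (h1 : k 1 = fun s => β.coeff 1 s (Q.circ x y) (Q.ast z y))
    (h2 : k 2 = fun s => β.coeff 1 s x y)
    (h0' : k' 0 = fun s => β.coeff 1 s (Q.ast y x) (Q.ast z x))
    (h1' : k' 1 = fun s => β.coeff 1 s x z)
    (h2' : k' 2 = fun s => β.coeff 1 s (Q.circ x z) (Q.circ y z)) :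
    ∑ s : Fin 3 → CrossingState, (∏ c, k c (s c)) • ((triangle true s).glue O).toModule β.δ =
      ∑ s : Fin 3 → CrossingState, (∏ c, k' c (s c)) •
        ((triangle false s).glue O).toModule β.δ := by
  rw [sum_triangleState true, sum_triangleState false]
  simp only [Fin.prod_univ_three, h0, h1, h2, h0', h1', h2', sum_crossingState]
  simp only [triangleState, if_true, Bool.false_eq_true, if_false, Matrix.cons_val_zero,
    Matrix.cons_val_one, Matrix.cons_val, ParityBiquandleBracket.coeff]
  -- Equal states are expressed by the same representative.
  have key : ∀ f P Q S, ((triangle f (triangleState f P Q S)).glue O).toModule β.δ =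
    triangleClass β.δ O f P Q S := fun _ _ _ _ => rfl
  simp only [triangleState] at key
  have keyT := key true
  have keyF := key false
  simp only [if_true, Bool.false_eq_true, if_false] at keyT keyF
  simp only [keyT, keyF]
  obtain ⟨r1, r2, r3, r4, r5, r6, r7, r8, r9, r10, r11, r12, r13, r14⟩ := triangleReduce_fst
  obtain ⟨e1, e2, e3, e4, e5, e6, e7, e8, e9⟩ := triangleEquiv_planar
  obtain ⟨e10, e11, e12, e13, e14, e15, e16, e17⟩ := triangleEquiv_turn
  obtain ⟨e18, e19, e20, e21, e22, e23, e24, e25, e26, e27, e28, e29, e30, e31, e32⟩ :=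
      triangleEquiv_vertex
  simp only [e1.eq β.δ O r1, e2.eq β.δ O r1, e3.eq β.δ O r1, e4.eq β.δ O r2, e5.eq β.δ O r2,
    e6.eq β.δ O r2, e7.eq β.δ O r3, e8.eq β.δ O r3, e9.eq β.δ O r3, e10.eq β.δ O r4,
    e11.eq β.δ O r4, e12.eq β.δ O r4, e13.eq β.δ O r4, e14.eq β.δ O r5, e15.eq β.δ O r5,
    e16.eq β.δ O r5, e17.eq β.δ O r5, e18.eq β.δ O r6, e19.eq β.δ O r6, e20.eq β.δ O r7,
    e21.eq β.δ O r7, e22.eq β.δ O r8, e23.eq β.δ O r8, e24.eq β.δ O r9, e25.eq β.δ O r9,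
    e26.eq β.δ O r10, e27.eq β.δ O r10, e28.eq β.δ O r11, e29.eq β.δ O r11, e30.eq β.δ O r12,
    e31.eq β.δ O r13, e32.eq β.δ O r14,
    pow_zero, pow_one, one_smul]
  -- Each relation compares the coefficients of one class.
  linear_combination (norm := module) β.iii_1 x y z • triangleClass β.δ O false .oriented .oriented
      .oriented
    + β.iii_2 x y z • triangleClass β.δ O false .disoriented .disoriented .oriented
    + β.iii_3 x y z • triangleClass β.δ O false .disoriented .oriented .disoriented
    + β.iii_4 x y z • triangleClass β.δ O false .vertex .oriented .oriented
    + β.iii_5 x y z • triangleClass β.δ O true .oriented .oriented .vertex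
    + β.iii_6 x y z • triangleClass β.δ O true .oriented .vertex .disoriented
    + β.iii_7 x y z • triangleClass β.δ O false .disoriented .oriented .vertex
    + β.iii_8 x y z • triangleClass β.δ O false .disoriented .vertex .oriented
    + β.iii_9 x y z • triangleClass β.δ O true .vertex .oriented .disoriented
    + β.iii_10 x y z • triangleClass β.δ O false .disoriented .vertex .vertex
    + β.iii_11 x y z • triangleClass β.δ O false .vertex .vertex .oriented
    + β.iii_12 x y z • triangleClass β.δ O false .vertex .oriented .vertex
    + β.iii_13 x y z • triangleClass β.δ O true .disoriented .vertex .oriented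
    + β.iii_14 x y z • triangleClass β.δ O true .vertex .disoriented .oriented
    + β.iii_15 x y z • triangleClass β.δ O true .disoriented .disoriented .vertex
    + β.iii_16 x y z • triangleClass β.δ O true .vertex .vertex .vertex
    - β.iii_17 x y z • triangleClass β.δ O false .oriented .disoriented .vertex
    - β.iii_18 x y z • triangleClass β.δ O false .oriented .vertex .disoriented
    - β.iii_19 x y z • triangleClass β.δ O false .vertex .disoriented .disoriented
    - β.iii_20 x y z • triangleClass β.δ O false .vertex .vertex .vertex
    + β.iii_21 x y z • triangleClass β.δ O true .oriented .oriented .disoriented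
    - β.iii_22 x y z • triangleClass β.δ O false .disoriented .oriented .oriented

end Triangle

/-! ### Cutting a framed graph along edges -/

namespace FramedGraph

attribute [instance] FramedGraph.finiteH

variable {P α : Type} [Finite P] [Finite α]

open Classical in
/-- The half-edges of a graph as the ends `bd` and the other half-edges. -/
noncomputable def cutEquiv (G : FramedGraph) (bd : P → G.H) (hbd : Function.Injective bd) :
    {h : G.H // h ∉ Set.range bd} ⊕ P ≃ G.H :=
  (Equiv.sumComm _ _).trans
    (((Equiv.ofInjective bd hbd).sumCongr (Equiv.refl _)).trans (Equiv.Set.sumCompl (Set.range bd)))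

/-- The outer part that remains of a graph when the edges with half-edges `bd` are cut. -/
noncomputable def cut (G : FramedGraph) (bd : P → G.H) (hbd : Function.Injective bd) (m : P → P)
    (hm : ∀ p, G.mate (bd p) = bd (m p)) : Outer P where
  K := {h : G.H // h ∉ Set.range bd}
  mate k := ⟨G.mate k, by
    rintro ⟨p, hp⟩
    exact k.2 ⟨m p, by rw [← hm, hp, G.mate_mate]⟩⟩
  mate_mate k := Subtype.ext (G.mate_mate _)
  mate_ne k h := G.mate_ne _ (congrArg Subtype.val h)
  opp q := (G.cutEquiv bd hbd).symm (G.opp (G.cutEquiv bd hbd q))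
  opp_opp q := by simp [G.opp_opp]
  opp_ne q h := G.opp_ne (G.cutEquiv bd hbd q) (by rw [Equiv.symm_apply_eq] at h; exact h)
  node := G.node.comap (G.cutEquiv bd hbd)
  node_opp q := by
    change G.node.r _ (G.cutEquiv bd hbd _)
    rw [Equiv.apply_symm_apply]
    exact G.node_opp _
  valence h k l hk hl := by
    simpa only [Equiv.eq_symm_apply, EmbeddingLike.apply_eq_iff_eq] using G.valence _ _ _ hk hl

/-- A criterion for a framed graph to be isomorphic to a glued graph. The map `Φ` identifies
the half-edges. -/
theorem toModule_eq_glue {R : Type*} [CommRing R] (δ : R) (G : FramedGraph) (O : Outer P)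
    (T : Tangle P α) (Φ : (O.K ⊕ P) ⊕ α → G.H)
    (hΦ : Function.Bijective fun g : T.GlueH O => Φ (Tangle.place g))
    (h_opp_old : ∀ q, G.opp (Φ (.inl q)) = Φ (.inl (O.opp q)))
    (h_opp_new : ∀ a, T.live a → G.opp (Φ (.inr a)) = Φ (.inr (T.opp a)))
    (h_node_old : ∀ q q', G.node.r (Φ (.inl q)) (Φ (.inl q')) ↔ O.node.r q q')
    (h_node_new : ∀ a b, T.live a → T.live b →
      (G.node.r (Φ (.inr a)) (Φ (.inr b)) ↔ T.node a = T.node b))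
    (h_node_old_new : ∀ q a, T.live a → ¬ G.node.r (Φ (.inl q)) (Φ (.inr a)))
    (h_mate_out : ∀ k, G.mate (Φ (.inl (.inl k))) = Φ (.inl (.inl (O.mate k))))
    (h_mate_in : ∀ z, liveEnd T.live z →
      G.mate (Φ (Sum.map .inr id z)) = Φ (Sum.map .inr id (T.mate z))) :
    G.toModule δ = (T.glue O).toModule δ := by
  have place_inr : ∀ z : T.End, Tangle.place (.inr z : T.GlueH O) = Sum.map .inr id z.1 := by
    rintro ⟨p | a, h⟩ <;> rfl
  refine toModule_eq δ (.iso ⟨Equiv.ofBijective _ hΦ, ?_, ?_, ?_⟩)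
  · rintro (k | z)
    · exact h_mate_out k
    · change G.mate (Φ (Tangle.place (.inr z))) = Φ (Tangle.place (.inr ⟨T.mate z.1, _⟩))
      rw [place_inr, place_inr]
      exact h_mate_in z.1 z.2
  · intro (g : T.GlueH O)
    change G.opp (Φ (Tangle.place g)) = Φ (Tangle.place (Tangle.glueOpp O T g))
    rw [Tangle.place_glueOpp O T g]
    rcases g with k | ⟨p | a, h⟩
    · exact h_opp_old _
    · exact h_opp_old _
    · exact h_opp_new a h
  · intro (g : T.GlueH O) (g' : T.GlueH O)
    change G.node.r (Φ (Tangle.place g)) (Φ (Tangle.place g')) ↔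
      Tangle.glueNode O T g = Tangle.glueNode O T g'
    simp only [Tangle.glueNode]
    rcases g with k | ⟨p | a, h⟩ <;> rcases g' with k' | ⟨p' | a', h'⟩ <;>
      simp only [Tangle.place, Sum.map_inl, Sum.map_inr, Sum.inl.injEq, Sum.inr.injEq,
        reduceCtorEq, iff_false, h_node_old, Quotient.eq]
    · exact h_node_old_new _ _ h'
    · exact h_node_old_new _ _ h'
    · exact fun hn => h_node_old_new _ _ h (G.node.symm hn)
    · exact fun hn => h_node_old_new _ _ h (G.node.symm hn)
    · exact h_node_new a a' h h'

variable {R : Type*} [CommRing R] (δ : R) {G : FramedGraph} {bd : P → G.H}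
  {hbd : Function.Injective bd} {m : P → P} {hm : ∀ p, G.mate (bd p) = bd (m p)}

/-- A graph is recovered from its outer part by joining the ends. -/
theorem toModule_eq_glue_arcs [DecidableEq P] [DecidableEq α] [Nonempty P] {T : Tangle P α}
    (hT : T.IsArcs m) : G.toModule δ = (T.glue (G.cut bd hbd m hm)).toModule δ := by
  -- There are no half-edges in the tangle, so their images do not matter.
  refine toModule_eq_glue δ G _ T (Sum.elim (G.cutEquiv bd hbd) fun _ => bd (Classical.arbitrary P))
    ?_ ?_ ?_ ?_ ?_ ?_ ?_ ?_
  · let e : T.GlueH (G.cut bd hbd m hm) ≃ {h : G.H // h ∉ Set.range bd} ⊕ P :=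
      { toFun := Sum.map id fun z => match z with
          | ⟨.inl p, _⟩ => p
          | ⟨.inr a, h⟩ => absurd h (by simp [liveEnd, hT.1])
        invFun := Sum.map id fun p => ⟨.inl p, rfl⟩
        left_inv := by
          rintro (k | ⟨p | a, h⟩)
          · rfl
          · rfl
          · simp [liveEnd, hT.1] at h
        right_inv := by rintro (k | p) <;> rfl }
    convert (e.trans (G.cutEquiv bd hbd)).bijective using 1
    funext g
    rcases g with k | ⟨p | a, h⟩
    · rfl
    · rfl
    · simp [liveEnd, hT.1] at h
  · intro q
    exact (Equiv.apply_symm_apply _ _).symm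
  · simp [hT.1]
  · exact fun _ _ => Iff.rfl
  · simp [hT.1]
  · simp [hT.1]
  · exact fun k => rfl
  · rintro (p | a) h
    · rw [hT.2]
      exact hm p
    · simp [liveEnd, hT.1] at h

/-- A graph `G'` with the nodes of `G` and those of a tangle, in which the edges of `G` that have
been cut run through the tangle. -/
theorem toModule_eq_glue_tangle {G' : FramedGraph} {T : Tangle P α} (hlive : ∀ a, T.live a)
    {J : G.H ⊕ α ≃ G'.H} (hJ : Extends G G' T.opp (fun a b => T.node a = T.node b) J)
    (h_out : ∀ h, h ∉ Set.range bd → G'.mate (J (.inl h)) = J (.inl (G.mate h)))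
    (h_in : ∀ z, G'.mate (J (Sum.map bd id z)) = J (Sum.map bd id (T.mate z))) :
    G'.toModule δ = (T.glue (G.cut bd hbd m hm)).toModule δ := by
  refine toModule_eq_glue δ G' _ T (J ∘ Sum.map (G.cutEquiv bd hbd) id) ?_ ?_ ?_ ?_ ?_ ?_ ?_ ?_
  · refine (J.bijective.comp ((Equiv.bijective ((G.cutEquiv bd hbd).sumCongr (Equiv.refl α))))).comp
      ⟨Tangle.place_injective, ?_⟩
    rintro ((k | p) | a)
    · exact ⟨.inl k, rfl⟩
    · exact ⟨.inr ⟨.inl p, rfl⟩, rfl⟩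
    · exact ⟨.inr ⟨.inr a, hlive a⟩, rfl⟩
  · intro q
    refine (hJ.opp_old _).trans (congrArg (J ∘ Sum.inl) ?_)
    exact (Equiv.apply_symm_apply _ _).symm
  · exact fun a _ => hJ.opp_new a
  · exact fun q q' => hJ.node_old _ _
  · exact fun a b _ _ => hJ.node_new a b
  · exact fun q a _ => hJ.node_old_new _ _
  · exact fun k => h_out _ k.2
  · intro z
    have : ∀ z : P ⊕ α, Sum.map (G.cutEquiv bd hbd) id (Sum.map Sum.inr id z) =
        Sum.map bd id z := by
      rintro (p | a) <;> rfl
    intro _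
    simp only [Function.comp_apply]
    erw [this, this]
    exact h_in z

end FramedGraph

/-! ### State graphs of extended diagrams -/

namespace VirtualDiagram

theorem stateOpp_map {D D' : VirtualDiagram} {fC : D.C → D'.C} (fV : D.V → D'.V) (fM : D.M → D'.M)
    {s : D.C → CrossingState} {s' : D'.C → CrossingState} (hs : ∀ c, s' (fC c) = s c)
    (h : D.Pass × Bool) :
    D'.stateOpp s' (h.1.map fC fV fM, h.2) =
      ((D.stateOpp s h).1.map fC fV fM, (D.stateOpp s h).2) := by
  rcases h with ⟨c | c | ⟨v, j⟩ | m, i⟩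
  · cases h : s c <;> simp [stateOpp, Passage.map, hs, h]
  · cases h : s c <;> simp [stateOpp, Passage.map, hs, h]
  · simp [stateOpp, Passage.map]
  · simp [stateOpp, Passage.map]

theorem stateNode_map {D D' : VirtualDiagram} {fC : D.C → D'.C} (fV : D.V → D'.V) (fM : D.M → D'.M)
    {s : D.C → CrossingState} {s' : D'.C → CrossingState} (hs : ∀ c, s' (fC c) = s c)
    (h : D.Pass × Bool) :
    D'.stateNode s' (h.1.map fC fV fM, h.2) = (D.stateNode s h).map fC fV fM := by
  rcases h with ⟨c | c | ⟨v, j⟩ | m, i⟩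
  · cases h : s c <;> cases i <;> simp [stateNode, Passage.map, hs, h]
  · cases h : s c <;> cases i <;> simp [stateNode, Passage.map, hs, h]
  · simp [stateNode, Passage.map]
  · simp [stateNode, Passage.map]

/-- A diagram with prescribed crossings and marked points; its edges and signs carry no
information. It serves to speak of the states of new crossings alone. -/
def scattered (C V M : Type) [Fintype C] [Finite V] [Finite M] : VirtualDiagram where
  C := C
  V := V
  M := M
  sign := 1
  next := Equiv.refl _

namespace Extension

variable {D D' : VirtualDiagram} {NC NV NM : Type}

theorem old_injective (E : Extension D D' NC NV NM) : Function.Injective E.old := by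
  rintro (c | c | ⟨v, i⟩ | m) (c' | c' | ⟨v', i'⟩ | m') h <;>
    simp_all [old, Passage.map]

theorem new_injective (E : Extension D D' NC NV NM) : Function.Injective E.new := by
  rintro (c | c | ⟨v, i⟩ | m) (c' | c' | ⟨v', i'⟩ | m') h <;>
    simp_all [new, Passage.map]

theorem old_ne_new (E : Extension D D' NC NV NM) (p : D.Pass) (n : Passage NC NV NM) :
    E.old p ≠ E.new n := by
  intro h
  rcases p with c | c | ⟨v, i⟩ | m <;> rcases n with c' | c' | ⟨v', i'⟩ | m' <;>
    simp_all [old, new, Passage.map]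

theorem old_or_new (E : Extension D D' NC NV NM) (q : D'.Pass) :
    (∃ p, E.old p = q) ∨ ∃ n, E.new n = q := by
  rcases q with c | c | ⟨v, i⟩ | m
  · obtain ⟨c | c, rfl⟩ := E.eC.surjective c
    exacts [.inl ⟨.over c, rfl⟩, .inr ⟨.over c, rfl⟩]
  · obtain ⟨c | c, rfl⟩ := E.eC.surjective c
    exacts [.inl ⟨.under c, rfl⟩, .inr ⟨.under c, rfl⟩]
  · obtain ⟨v | v, rfl⟩ := E.eV.surjective v
    exacts [.inl ⟨.virt v i, rfl⟩, .inr ⟨.virt v i, rfl⟩]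
  · obtain ⟨m | m, rfl⟩ := E.eM.surjective m
    exacts [.inl ⟨.mark m, rfl⟩, .inr ⟨.mark m, rfl⟩]

theorem inserts_nil {E : Extension D D' NC NV NM} {p : D.Pass} :
    E.Inserts p [] ↔ D'.next (E.old p) = E.old (D.next p) := by
  simp [Inserts]

theorem inserts_singleton {E : Extension D D' NC NV NM} {p : D.Pass} {a : Passage NC NV NM} :
    E.Inserts p [a] ↔ D'.next (E.old p) = E.new a ∧ D'.next (E.new a) = E.old (D.next p) := by
  simp [Inserts]

theorem inserts_pair {E : Extension D D' NC NV NM} {p : D.Pass} {a b : Passage NC NV NM} :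
    E.Inserts p [a, b] ↔ D'.next (E.old p) = E.new a ∧ D'.next (E.new a) = E.new b ∧
      D'.next (E.new b) = E.old (D.next p) := by
  simp [Inserts]

/-- The half-edges of an extended diagram. -/
noncomputable def halfEquiv (E : Extension D D' NC NV NM) {α : Type}
    (χ : α ≃ Passage NC NV NM × Bool) : (D.Pass × Bool) ⊕ α ≃ D'.Pass × Bool :=
  Equiv.ofBijective (Sum.elim (fun h => (E.old h.1, h.2)) fun a => (E.new (χ a).1, (χ a).2)) (by
    constructor
    · rintro (⟨p, i⟩ | a) (⟨q, j⟩ | b) h <;> simp only [Sum.elim_inl, Sum.elim_inr, Prod.mk.injEq]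
        at h
      · rw [E.old_injective h.1, h.2]
      · exact absurd h.1 (E.old_ne_new _ _)
      · exact absurd h.1.symm (E.old_ne_new _ _)
      · rw [χ.injective (Prod.ext (E.new_injective h.1) h.2)]
    · rintro ⟨q, i⟩
      rcases E.old_or_new q with ⟨p, rfl⟩ | ⟨n, rfl⟩
      · exact ⟨.inl (p, i), rfl⟩
      · exact ⟨.inr (χ.symm (n, i)), by simp⟩)

theorem halfEquiv_inl (E : Extension D D' NC NV NM) {α : Type} (χ : α ≃ Passage NC NV NM × Bool)
    (h : D.Pass × Bool) : E.halfEquiv χ (.inl h) = (E.old h.1, h.2) := rfl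

theorem halfEquiv_inr (E : Extension D D' NC NV NM) {α : Type} (χ : α ≃ Passage NC NV NM × Bool)
    (a : α) : E.halfEquiv χ (.inr a) = (E.new (χ a).1, (χ a).2) := rfl

variable [Fintype NC] [Finite NV] [Finite NM]

/-- The nodes of a state of an extended diagram are those of a state of the diagram together with
the
nodes formed by the new crossings and marked points. -/
theorem stateGraph_extends (E : Extension D D' NC NV NM) {α : Type}
    (χ : α ≃ Passage NC NV NM × Bool) (s : D.C → CrossingState) (t : NC → CrossingState)
    {oppN : α → α} {nodeN : α → α → Prop}
    (hopp : ∀ a, χ (oppN a) = (scattered NC NV NM).stateOpp t (χ a))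
    (hnode : ∀ a b, (scattered NC NV NM).stateNode t (χ a) =
      (scattered NC NV NM).stateNode t (χ b) ↔ nodeN a b) :
    FramedGraph.Extends (D.stateGraph s) (D'.stateGraph (Sum.elim s t ∘ E.eC.symm)) oppN nodeN
      (E.halfEquiv χ) := by
  have hs : ∀ c, (Sum.elim s t ∘ E.eC.symm) (E.eC (.inl c)) = s c := by simp
  have ht : ∀ c, (Sum.elim s t ∘ E.eC.symm) (E.eC (.inr c)) = t c := by simp
  have node_old : ∀ h, D'.stateNode (Sum.elim s t ∘ E.eC.symm) (E.halfEquiv χ (.inl h)) =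
      E.old (D.stateNode s h) := fun h => stateNode_map _ _ hs h
  have node_new : ∀ a, D'.stateNode (Sum.elim s t ∘ E.eC.symm) (E.halfEquiv χ (.inr a)) =
      E.new ((scattered NC NV NM).stateNode t (χ a)) := fun a =>
    stateNode_map (D := scattered NC NV NM) _ _ ht (χ a)
  constructor
  · exact fun h => stateOpp_map _ _ hs h
  · intro a
    exact (stateOpp_map (D := scattered NC NV NM) _ _ ht (χ a)).trans
      (congrArg (fun h : Passage NC NV NM × Bool => (E.new h.1, h.2)) (hopp a).symm)
  · intro h k
    change D'.stateNode _ _ = D'.stateNode _ _ ↔ D.stateNode s h = D.stateNode s k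
    exact (Eq.congr (node_old h) (node_old k)).trans E.old_injective.eq_iff
  · intro a b
    change D'.stateNode _ _ = D'.stateNode _ _ ↔ _
    exact ((Eq.congr (node_new a) (node_new b)).trans E.new_injective.eq_iff).trans (hnode a b)
  · intro h a
    change ¬ D'.stateNode _ _ = D'.stateNode _ _
    exact fun h' => E.old_ne_new _ _ ((node_old h).symm.trans (h'.trans (node_new a)))

end Extension

/-- The half-edges of the edges `p`: the end `(j, false)` is the half-edge leaving `p j`, and
`(j, true)` is the other half of this edge. -/
def strandEnds (D : VirtualDiagram) {ι : Type} (p : ι → D.Pass) (z : ι × Bool) : D.Pass × Bool :=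
  if z.2 then (D.next (p z.1), false) else (p z.1, true)

theorem strandEnds_injective (D : VirtualDiagram) {ι : Type} {p : ι → D.Pass}
    (hp : Function.Injective p) : Function.Injective (D.strandEnds p) := by
  rintro ⟨i, _ | _⟩ ⟨j, _ | _⟩ h <;> simp [strandEnds] at h
  · rw [hp h]
  · rw [hp h]

theorem edgeMate_strandEnds (D : VirtualDiagram) {ι : Type} (p : ι → D.Pass) (z : ι × Bool) :
    D.edgeMate (D.strandEnds p z) = D.strandEnds p (straight z) := by
  rcases z with ⟨i, _ | _⟩ <;> simp [strandEnds, edgeMate, straight]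

/-- The outer part of a state when the edges `p` are cut. -/
noncomputable def stateCut (D : VirtualDiagram) (s : D.C → CrossingState) {ι : Type} [Finite ι]
    {p : ι → D.Pass} (hp : Function.Injective p) : Outer (ι × Bool) :=
  (D.stateGraph s).cut (D.strandEnds p) (D.strandEnds_injective hp) straight
    (D.edgeMate_strandEnds p)

section

variable {R : Type*} [CommRing R] (δ : R) {ι : Type} [Finite ι] {α : Type} [Finite α]

theorem stateGraph_eq_arcs [Nonempty ι] [DecidableEq ι] [DecidableEq α] (D : VirtualDiagram)
    (s : D.C → CrossingState) {p : ι → D.Pass} (hp : Function.Injective p) {T : Tangle (ι × Bool) α}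
    (hT : T.IsArcs straight) :
    (D.stateGraph s).toModule δ = (T.glue (D.stateCut s hp)).toModule δ :=
  FramedGraph.toModule_eq_glue_arcs δ hT

/-- If the edges `p` of a diagram run through a tangle of new crossings and marked points in an
extended diagram, then a state of the extended diagram is obtained by gluing the corresponding state
of this tangle into a state of the diagram. -/
theorem stateGraph_eq_glue {D D' : VirtualDiagram} {NC NV NM : Type} [Fintype NC] [Finite NV]
    [Finite NM] (E : Extension D D' NC NV NM) {p : ι → D.Pass} (hp : Function.Injective p)
    (h_rest : ∀ r, (∀ j, r ≠ p j) → E.Inserts r [])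
    (s : D.C → CrossingState) (t : NC → CrossingState) (T : Tangle (ι × Bool) α)
    (hlive : ∀ a, T.live a) (χ : α ≃ Passage NC NV NM × Bool)
    (hopp : ∀ a, χ (T.opp a) = (scattered NC NV NM).stateOpp t (χ a))
    (hnode : ∀ a b, (scattered NC NV NM).stateNode t (χ a) =
      (scattered NC NV NM).stateNode t (χ b) ↔ T.node a = T.node b)
    (h_alt : ∀ z, (E.halfEquiv χ (Sum.map (D.strandEnds p) id z)).2 = false →
      (E.halfEquiv χ (Sum.map (D.strandEnds p) id (T.mate z))).2 = true)
    (h_next : ∀ z, (E.halfEquiv χ (Sum.map (D.strandEnds p) id z)).2 = true →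
      E.halfEquiv χ (Sum.map (D.strandEnds p) id (T.mate z)) =
        (D'.next (E.halfEquiv χ (Sum.map (D.strandEnds p) id z)).1, false)) :
    (D'.stateGraph (Sum.elim s t ∘ E.eC.symm)).toModule δ =
      (T.glue (D.stateCut s hp)).toModule δ := by
  have key : ∀ z, (E.halfEquiv χ (Sum.map (D.strandEnds p) id z)).2 = true →
      D'.edgeMate (E.halfEquiv χ (Sum.map (D.strandEnds p) id z)) =
        E.halfEquiv χ (Sum.map (D.strandEnds p) id (T.mate z)) := by
    intro z hz
    rw [h_next z hz, edgeMate, if_pos hz]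
  have mm : ∀ z, T.mate (T.mate z) = z := fun z =>
    T.mate_mate z (by rcases z with p | a; exacts [rfl, hlive a])
  refine FramedGraph.toModule_eq_glue_tangle δ hlive (E.stateGraph_extends χ s t hopp hnode) ?_ ?_
  · rintro ⟨r, i⟩ hr
    change D'.edgeMate (E.old r, i) = (E.old (D.edgeMate (r, i)).1, (D.edgeMate (r, i)).2)
    cases i
    · have h1 := Extension.inserts_nil.1 (h_rest (D.next.symm r) fun j hj => hr ⟨(j, true), by
        simp only [strandEnds, ← hj, Equiv.apply_symm_apply]; rfl⟩)
      rw [Equiv.apply_symm_apply] at h1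
      simp [edgeMate, ← h1]
    · have h1 := Extension.inserts_nil.1 (h_rest r fun j hj => hr ⟨(j, false), by
        simp only [strandEnds, ← hj]; rfl⟩)
      simp [edgeMate, ← h1]
  · intro z
    by_cases hz : (E.halfEquiv χ (Sum.map (D.strandEnds p) id z)).2 = true
    · exact key z hz
    · have h1 := key (T.mate z) (h_alt z (by simpa using hz))
      rw [mm] at h1
      change D'.edgeMate (E.halfEquiv χ (Sum.map (D.strandEnds p) id z)) = _
      rw [← h1]
      exact (D'.stateGraph (Sum.elim s t ∘ E.eC.symm)).mate_mate _

end

end VirtualDiagram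

/-! ### States of diagrams with new crossings -/

/-- The half-edges of new crossings as half-edges of passages. -/
def halfPassage (N : Type) : Half N ≃ Passage N Empty Empty × Bool where
  toFun a := (if a.2.1 then .under a.1 else .over a.1, a.2.2)
  invFun h :=
    match h with
    | (.over c, i) => (c, false, i)
    | (.under c, i) => (c, true, i)
  left_inv := by rintro ⟨c, _ | _, i⟩ <;> rfl
  right_inv := by rintro ⟨c | c | ⟨⟨⟩, _⟩ | ⟨⟨⟩⟩, i⟩ <;> rfl

namespace VirtualDiagram

theorem stateOpp_halfPassage {N : Type} [Fintype N] (t : N → CrossingState) (a : Half N) :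
    halfPassage N (smoothOpp t a) = (scattered N Empty Empty).stateOpp t (halfPassage N a) := by
  rcases a with ⟨c, _ | _, i⟩ <;> cases h : t c <;>
    simp [halfPassage, smoothOpp, stateOpp, h] <;> rfl

theorem stateNode_halfPassage {N : Type} [Fintype N] (t : N → CrossingState) (a b : Half N) :
    (scattered N Empty Empty).stateNode t (halfPassage N a) =
      (scattered N Empty Empty).stateNode t (halfPassage N b) ↔
    smoothNode t a = smoothNode t b := by
  have key : ∀ a, (scattered N Empty Empty).stateNode t (halfPassage N a) =
      (halfPassage N (smoothNode t a)).1 := by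
    rintro ⟨c, _ | _, _ | _⟩ <;> cases h : t c <;>
      simp [halfPassage, smoothNode, stateNode, h] <;> rfl
  have snd : ∀ a, (smoothNode t a).2.2 = false := by
    intro a
    cases h : t a.1 <;> simp [smoothNode, h]
  have e : (halfPassage N (smoothNode t a)).1 = (halfPassage N (smoothNode t b)).1 ↔
      smoothNode t a = smoothNode t b := by
    constructor
    · intro h
      exact (halfPassage N).injective (Prod.ext h ((snd a).trans (snd b).symm))
    · intro h
      rw [h]
  exact (Eq.congr (key a) (key b)).trans e

section

variable {R : Type*} [CommRing R] (δ : R) {ι : Type} [Finite ι]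

/-- The case of `stateGraph_eq_glue` in which only crossings are inserted. -/
theorem stateGraph_eq_crossingTangle {D D' : VirtualDiagram} {N : Type} [Fintype N]
    (E : Extension D D' N Empty Empty) {p : ι → D.Pass} (hp : Function.Injective p)
    (h_rest : ∀ r, (∀ j, r ≠ p j) → E.Inserts r [])
    {mate : (ι × Bool) ⊕ Half N → (ι × Bool) ⊕ Half N} (h : ∀ z, mate (mate z) = z)
    (hne : ∀ z, mate z ≠ z)
    (h_alt : ∀ z, (E.halfEquiv (halfPassage N) (Sum.map (D.strandEnds p) id z)).2 = false →
      (E.halfEquiv (halfPassage N) (Sum.map (D.strandEnds p) id (mate z))).2 = true)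
    (h_next : ∀ z, (E.halfEquiv (halfPassage N) (Sum.map (D.strandEnds p) id z)).2 = true →
      E.halfEquiv (halfPassage N) (Sum.map (D.strandEnds p) id (mate z)) =
        (D'.next (E.halfEquiv (halfPassage N) (Sum.map (D.strandEnds p) id z)).1, false))
    (s : D.C → CrossingState) (t : N → CrossingState) :
    (D'.stateGraph (Sum.elim s t ∘ E.eC.symm)).toModule δ =
      ((crossingTangle mate h hne t).glue (D.stateCut s hp)).toModule δ :=
  stateGraph_eq_glue δ E hp h_rest s t (crossingTangle mate h hne t) (fun _ => rfl) (halfPassage N)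
    (stateOpp_halfPassage t) (stateNode_halfPassage t) h_alt h_next

/-- Each strand passes one two-valent point. -/
def pointTangle (ι : Type) [Finite ι] : Tangle (ι × Bool) (ι × Bool) where
  live _ := true
  mate := Sum.swap
  opp := straight
  node z := (z.1, false)
  live_opp _ := rfl
  opp_opp := by simp [straight]
  opp_ne := by rintro ⟨j, _ | _⟩ <;> simp [straight]
  node_opp := by simp [straight]
  valence := by
    rintro ⟨j, a⟩ ⟨k, b⟩ ⟨l, c⟩ h1 h2
    simp only [Prod.mk.injEq, and_true] at h1 h2
    subst h1 h2
    cases a <;> cases b <;> cases c <;> simp [straight]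
  matching := ⟨fun z _ => by rcases z with p | a <;> rfl, fun z _ => Sum.swap_swap z, fun z _ => by
    rcases z with p | a <;> simp⟩

theorem pointTangle_glue_unit (O : Outer (Unit × Bool)) {T : Tangle (Unit × Bool) (Unit × Bool)}
    (hT : T.IsArcs straight) :
    ((pointTangle Unit).glue O).toModule δ = (T.glue O).toModule δ := by
  have e : (Tangle.reduce [((), false)] (pointTangle Unit)).1 = 0 ∧
      (Tangle.reduce [((), false)] (pointTangle Unit)).2.IsArcs straight := by
    decide +kernel
  rw [Tangle.glue_reduce δ O [((), false)] (pointTangle Unit), e.1, pow_zero, one_smul,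
    e.2.glue_eq δ O hT]
  unfold Tangle.IsPoint
  decide

theorem pointTangle_glue_bool (O : Outer (Bool × Bool)) {T : Tangle (Bool × Bool) (Bool × Bool)}
    (hT : T.IsArcs straight) :
    ((pointTangle Bool).glue O).toModule δ = (T.glue O).toModule δ := by
  have e : (Tangle.reduce [(false, false), (true, false)] (pointTangle Bool)).1 = 0 ∧
      (Tangle.reduce [(false, false), (true, false)] (pointTangle Bool)).2.IsArcs straight := by
    decide +kernel
  rw [Tangle.glue_reduce δ O [(false, false), (true, false)] (pointTangle Bool), e.1, pow_zero,
    one_smul, e.2.glue_eq δ O hT]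
  unfold Tangle.IsPoint
  decide

end

/-- The tangle of strands which pass no nodes, all half-edges of `T` being discarded. -/
def _root_.Tangle.discard {ι α : Type} (T : Tangle (ι × Bool) α) : Tangle (ι × Bool) α where
  live _ := false
  mate := Sum.map straight id
  opp := T.opp
  node := T.node
  live_opp _ := rfl
  opp_opp := T.opp_opp
  opp_ne := T.opp_ne
  node_opp := T.node_opp
  valence := T.valence
  matching := ⟨fun z h => by rcases z with p | a; exacts [rfl, h], by simp [straight],
    fun z h => by rcases z with p | a <;> simp_all [straight, liveEnd, Prod.ext_iff]⟩

theorem _root_.Tangle.discard_isArcs {ι α : Type} (T : Tangle (ι × Bool) α) :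
    T.discard.IsArcs straight := ⟨fun _ => rfl, fun _ => rfl⟩

end VirtualDiagram

namespace ParityBiquandleBracket

open VirtualDiagram

variable {X : Type*} {Q : Biquandle X} {R : Type*} [CommRing R] (β : ParityBiquandleBracket Q R)

theorem writhe_extension {D D' : VirtualDiagram} {NC NV NM : Type} [Fintype NC]
    (E : Extension D D' NC NV NM) :
    D'.writhe = D.writhe + ∑ c, (D'.sign (E.eC (.inr c)) : ℤ) := by
  rw [writhe, ← Equiv.sum_comp E.eC, Fintype.sum_sum_type]
  simp only [E.sign_old]
  rfl

open Classical in
/-- The value of an extended diagram, with the states of the new crossings summed first. -/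
theorem value_eq_sum_glue {D D' : VirtualDiagram} {NC NV NM : Type} [Fintype NC] [DecidableEq NC]
    (E : Extension D D' NC NV NM) {ι α : Type} [Finite ι] [Finite α] {p : ι → D.Pass}
    (hp : Function.Injective p) (T : (NC → CrossingState) → Tangle (ι × Bool) α)
    (hT : ∀ s t, (D'.stateGraph (Sum.elim s t ∘ E.eC.symm)).toModule β.δ =
      ((T t).glue (D.stateCut s hp)).toModule β.δ) (f : D'.Coloring Q) :
    β.value D' f = ((β.w ^ (-D'.writhe) : Rˣ) : R) • ∑ s : D.C → CrossingState,
      (∏ c, β.coeff (D.sign c) (s c) (D'.leftPair f.1 (E.eC (.inl c))).1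
        (D'.leftPair f.1 (E.eC (.inl c))).2) •
      ∑ t : NC → CrossingState, (∏ c, β.coeff (D'.sign (E.eC (.inr c))) (t c)
          (D'.leftPair f.1 (E.eC (.inr c))).1 (D'.leftPair f.1 (E.eC (.inr c))).2) •
        ((T t).glue (D.stateCut s hp)).toModule β.δ := by
  unfold value
  congr 1
  let e : (D.C → CrossingState) × (NC → CrossingState) ≃ (D'.C → CrossingState) :=
    (Equiv.sumArrowEquivProdArrow _ _ _).symm.trans (E.eC.arrowCongr (Equiv.refl _))
  have he : ∀ z, e z = Sum.elim z.1 z.2 ∘ E.eC.symm := fun z => rfl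
  rw [← Equiv.sum_comp e, Fintype.sum_prod_type]
  refine Finset.sum_congr rfl fun s _ => ?_
  rw [Finset.smul_sum]
  refine Finset.sum_congr (by congr!) fun t _ => ?_
  rw [he, hT, smul_smul, ← Equiv.prod_comp E.eC, Fintype.prod_sum_type]
  simp [E.sign_old]

/-- A change of a diagram inside a tangle does not change the value of a colouring if the sum over
the states of the tangle is a multiple of the tangle of straight strands, the factor being
compensated by the change of the writhe number. -/
theorem value_eq_of_extension {D D' : VirtualDiagram} {NC NV NM : Type} [Fintype NC]
    [DecidableEq NC] (E : Extension D D' NC NV NM) {ι α : Type} [Finite ι] [Nonempty ι]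
    [DecidableEq ι] [Finite α] [DecidableEq α] {p : ι → D.Pass}
    (hp : Function.Injective p) (T : (NC → CrossingState) → Tangle (ι × Bool) α)
    (hT : ∀ s t, (D'.stateGraph (Sum.elim s t ∘ E.eC.symm)).toModule β.δ =
      ((T t).glue (D.stateCut s hp)).toModule β.δ) (f : D.Coloring Q) (f' : D'.Coloring Q)
    (hf : ∀ c, D'.leftPair f'.1 (E.eC (.inl c)) = D.leftPair f.1 c)
    (h_sum : ∀ (O : Outer (ι × Bool)) (T₀ : Tangle (ι × Bool) α), T₀.IsArcs straight →
      ∑ t : NC → CrossingState, (∏ c, β.coeff (D'.sign (E.eC (.inr c))) (t c)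
          (D'.leftPair f'.1 (E.eC (.inr c))).1 (D'.leftPair f'.1 (E.eC (.inr c))).2) •
        ((T t).glue O).toModule β.δ =
      ((β.w ^ (∑ c, (D'.sign (E.eC (.inr c)) : ℤ)) : Rˣ) : R) • (T₀.glue O).toModule β.δ) :
    β.value D' f' = β.value D f := by
  rw [β.value_eq_sum_glue E hp T hT, value, writhe_extension E]
  have hT₀ := (T fun _ => .vertex).discard_isArcs
  simp only [h_sum _ _ hT₀, hf, stateGraph_eq_arcs β.δ D _ hp hT₀, Finset.smul_sum, smul_smul]
  refine Finset.sum_congr rfl fun s _ => ?_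
  congr 1
  rw [neg_add, zpow_add, zpow_neg β.w (∑ c, _), Units.val_mul]
  rw [mul_assoc, mul_left_comm _ _ (Units.val _), ← mul_assoc (Units.val _), Units.inv_mul, mul_one]

end ParityBiquandleBracket

/-! ### Colourings of diagrams with new crossings -/

/-- The colour of the edge that leaves a kink determines the colour of its inner edge, as `x * x = x
∘ x`
takes each value once. -/
theorem Biquandle.circ_self_bijective {X : Type*} [Finite X] (Q : Biquandle X) :
    Function.Bijective fun x => Q.circ x x := by
  refine Finite.injective_iff_bijective.1 fun x y h => ?_
  have h' : (fun p : X × X => (Q.ast p.2 p.1, Q.circ p.1 p.2)) (x, x) =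
      (fun p : X × X => (Q.ast p.2 p.1, Q.circ p.1 p.2)) (y, y) := by
    simpa [← Q.circ_self] using h
  exact congrArg Prod.fst (Q.sideways_bijective.1 h')

namespace VirtualDiagram

namespace Extension

variable {D D' : VirtualDiagram} {NC NV NM : Type} {X : Type*}

/-- The passages of an extended diagram. -/
noncomputable def passEquiv (E : Extension D D' NC NV NM) :
    D.Pass ⊕ Passage NC NV NM ≃ D'.Pass :=
  Equiv.ofBijective (Sum.elim E.old E.new) ⟨E.old_injective.sumElim E.new_injective E.old_ne_new,
    fun q => by
      rcases E.old_or_new q with ⟨p, rfl⟩ | ⟨n, rfl⟩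
      exacts [⟨.inl p, rfl⟩, ⟨.inr n, rfl⟩]⟩

/-- The colours `f` on the old and `n` on the new passages. -/
noncomputable def join (E : Extension D D' NC NV NM) (f : D.Pass → X)
    (n : Passage NC NV NM → X) : D'.Pass → X :=
  Sum.elim f n ∘ E.passEquiv.symm

@[simp]
theorem join_old (E : Extension D D' NC NV NM) (f : D.Pass → X) (n : Passage NC NV NM → X)
    (p : D.Pass) : E.join f n (E.old p) = f p := by
  have : E.passEquiv.symm (E.old p) = .inl p := E.passEquiv.symm_apply_apply (.inl p)
  simp [join, this]

@[simp]
theorem join_new (E : Extension D D' NC NV NM) (f : D.Pass → X) (n : Passage NC NV NM → X)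
    (a : Passage NC NV NM) : E.join f n (E.new a) = n a := by
  have : E.passEquiv.symm (E.new a) = .inr a := E.passEquiv.symm_apply_apply (.inr a)
  simp [join, this]

theorem join_restrict (E : Extension D D' NC NV NM) (f : D'.Pass → X) :
    E.join (f ∘ E.old) (f ∘ E.new) = f := by
  funext q
  rcases E.old_or_new q with ⟨p, rfl⟩ | ⟨n, rfl⟩ <;> simp

/-- The first and the last piece of each old edge have the same colour. -/
def Compatible (E : Extension D D' NC NV NM) (f : D'.Pass → X) : Prop :=
  ∀ p, f (D'.next.symm (E.old (D.next p))) = f (E.old p)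

/-- The conditions on a colouring at the new crossings and marked points. -/
def NewColoring (E : Extension D D' NC NV NM) (Q : Biquandle X) (f : D'.Pass → X) : Prop :=
  (∀ c, D'.rightPair f (E.eC (.inr c)) =
    (Q.circ (D'.leftPair f (E.eC (.inr c))).1 (D'.leftPair f (E.eC (.inr c))).2,
      Q.ast (D'.leftPair f (E.eC (.inr c))).2 (D'.leftPair f (E.eC (.inr c))).1)) ∧
  (∀ v i, f (E.new (.virt v i)) = f (D'.next.symm (E.new (.virt v i)))) ∧
  (∀ m, f (E.new (.mark m)) = f (D'.next.symm (E.new (.mark m))))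

theorem Compatible.symm_old {E : Extension D D' NC NV NM} {f : D'.Pass → X} (h : E.Compatible f)
    (p : D.Pass) : f (D'.next.symm (E.old p)) = f (E.old (D.next.symm p)) := by
  have := h (D.next.symm p)
  rwa [Equiv.apply_symm_apply] at this

theorem Compatible.leftPair_old {E : Extension D D' NC NV NM} {f : D'.Pass → X}
    (h : E.Compatible f) (c : D.C) :
    D'.leftPair f (E.eC (.inl c)) = D.leftPair (f ∘ E.old) c := by
  have h1 := h.symm_old (.over c)
  have h2 := h.symm_old (.under c)
  simp only [old, Passage.map] at h1 h2
  simp [leftPair, E.sign_old, h1, h2, old, Passage.map]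

theorem Compatible.rightPair_old {E : Extension D D' NC NV NM} {f : D'.Pass → X}
    (h : E.Compatible f) (c : D.C) :
    D'.rightPair f (E.eC (.inl c)) = D.rightPair (f ∘ E.old) c := by
  have h1 := h.symm_old (.over c)
  have h2 := h.symm_old (.under c)
  simp only [old, Passage.map] at h1 h2
  simp [rightPair, E.sign_old, h1, h2, old, Passage.map]

/-- Under the compatibility condition, the colouring conditions at the old and at the new crossings
are independent of each other. -/
theorem Compatible.isColoring_iff {E : Extension D D' NC NV NM} {f : D'.Pass → X}
    (h : E.Compatible f) {Q : Biquandle X} :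
    D'.IsColoring Q f ↔ D.IsColoring Q (f ∘ E.old) ∧ E.NewColoring Q f := by
  have hv : ∀ v i, D'.next.symm (.virt (E.eV (.inl v)) i) = D'.next.symm (E.old (.virt v i)) :=
    fun _ _ => rfl
  have hm : ∀ m, D'.next.symm (.mark (E.eM (.inl m))) = D'.next.symm (E.old (.mark m)) :=
    fun _ => rfl
  unfold IsColoring NewColoring
  rw [← E.eC.forall_congr_right, ← E.eV.forall_congr_right, ← E.eM.forall_congr_right]
  simp only [Sum.forall, h.leftPair_old, h.rightPair_old, hv, hm, h.symm_old]
  simp only [old, new, Passage.map, Function.comp_apply]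
  tauto

end Extension

end VirtualDiagram

namespace ParityBiquandleBracket

open VirtualDiagram

variable {X : Type*} [Finite X] {Q : Biquandle X} {R : Type*} [CommRing R]
  (β : ParityBiquandleBracket Q R)

theorem multiset_eq_of_equiv {D D' : VirtualDiagram} (e : D.Coloring Q ≃ D'.Coloring Q)
    (h : ∀ f, β.value D' (e f) = β.value D f) : β.multiset D = β.multiset D' := by
  let _ : Fintype (D.Coloring Q) := Fintype.ofFinite _
  let _ : Fintype (D'.Coloring Q) := Fintype.ofFinite _
  have h1 : (Finset.univ : Finset (D'.Coloring Q)).val =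
      (Finset.univ : Finset (D.Coloring Q)).val.map e := by
    rw [← Finset.map_univ_equiv e]
    rfl
  unfold multiset
  rw [h1, Multiset.map_map]
  exact Multiset.map_congr rfl fun f _ => (h f).symm

/-- If each colouring of a diagram extends uniquely over the new crossings and marked points, with
the same value, then the multisets agree. -/
theorem multiset_eq_of_extension {D D' : VirtualDiagram} {NC NV NM : Type}
    (E : Extension D D' NC NV NM)
    (h_compat : ∀ f, E.NewColoring Q f → E.Compatible f)
    (h_unique : ∀ f : D.Pass → X, ∃! n, E.NewColoring Q (E.join f n))
    (h_value : ∀ (f : D.Coloring Q) (f' : D'.Coloring Q), E.NewColoring Q f'.1 →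
      E.Compatible f'.1 → f'.1 ∘ E.old = f.1 → β.value D' f' = β.value D f) :
    β.multiset D = β.multiset D' := by
  have key : ∀ f : D'.Coloring Q, E.NewColoring Q f.1 ∧ E.Compatible f.1 := by
    rintro ⟨f, hf⟩
    have : E.NewColoring Q f := ⟨fun c => hf.1 _, fun v i => hf.2.1 _ _, fun m => hf.2.2 _⟩
    exact ⟨this, h_compat f this⟩
  let e : D'.Coloring Q ≃ D.Coloring Q := Equiv.ofBijective
    (fun f => ⟨f.1 ∘ E.old, ((key f).2.isColoring_iff.1 f.2).1⟩) (by
      constructor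
      · intro f g h
        have h' : f.1 ∘ E.old = g.1 ∘ E.old := congrArg Subtype.val h
        have := (h_unique (f.1 ∘ E.old)).unique (y₁ := f.1 ∘ E.new) (y₂ := g.1 ∘ E.new)
          (by rw [E.join_restrict]; exact (key f).1)
          (by rw [h', E.join_restrict]; exact (key g).1)
        apply Subtype.ext
        rw [← E.join_restrict f.1, ← E.join_restrict g.1, this, h']
      · rintro ⟨f, hf⟩
        obtain ⟨n, hn, -⟩ := h_unique f
        have e1 : E.join f n ∘ E.old = f := funext fun p => E.join_old f n p
        refine ⟨⟨E.join f n, (h_compat _ hn).isColoring_iff.2 ⟨by rwa [e1], hn⟩⟩, ?_⟩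
        exact Subtype.ext e1)
  exact (β.multiset_eq_of_equiv e fun f =>
    (h_value (e f) f (key f).1 (key f).2 rfl).symm).symm

end ParityBiquandleBracket

namespace VirtualDiagram.Extension

variable {D D' : VirtualDiagram} {NC NV NM : Type} {X : Type*}

/-- Only the edges on which something is inserted need to be checked for compatibility. -/
theorem compatible_of_inserts {E : Extension D D' NC NV NM} {f : D'.Pass → X} {ι : Type}
    {p : ι → D.Pass} (h_rest : ∀ r, (∀ j, r ≠ p j) → E.Inserts r [])
    (h : ∀ j, f (D'.next.symm (E.old (D.next (p j)))) = f (E.old (p j))) : E.Compatible f := by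
  intro r
  by_cases hr : ∃ j, r = p j
  · obtain ⟨j, rfl⟩ := hr
    exact h j
  · rw [← inserts_nil.1 (h_rest r (by simpa using hr)), Equiv.symm_apply_apply]

end VirtualDiagram.Extension

namespace ParityBiquandleBracket

open VirtualDiagram Extension

variable {X : Type*} [Finite X] {Q : Biquandle X} {R : Type*} [CommRing R]
  (β : ParityBiquandleBracket Q R)

/-! ### Isomorphisms, subdivisions and virtual crossings -/

theorem multiset_iso {D D' : VirtualDiagram} (e : D.Pass ≃ D'.Pass)
    (eC : D.C ≃ D'.C) (eV : D.V ≃ D'.V) (eM : D.M ≃ D'.M)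
    (h_over : ∀ c, e (.over c) = .over (eC c)) (h_under : ∀ c, e (.under c) = .under (eC c))
    (h_virt : ∀ v i, ∃ j, e (.virt v i) = .virt (eV v) j)
    (h_mark : ∀ m, e (.mark m) = .mark (eM m))
    (h_sign : ∀ c, D'.sign (eC c) = D.sign c)
    (h_next : ∀ p, D'.next (e p) = e (D.next p)) : β.multiset D = β.multiset D' := by
  have h_symm : ∀ p, D'.next.symm (e p) = e (D.next.symm p) := by
    intro p
    rw [Equiv.symm_apply_eq, h_next, Equiv.apply_symm_apply]
  have left : ∀ (f : D'.Pass → X) c, D'.leftPair f (eC c) = D.leftPair (f ∘ e) c := by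
    intro f c
    simp [leftPair, h_sign, ← h_over, ← h_under, h_symm]
  have right : ∀ (f : D'.Pass → X) c, D'.rightPair f (eC c) = D.rightPair (f ∘ e) c := by
    intro f c
    simp [rightPair, h_sign, ← h_over, ← h_under, h_symm]
  have col : ∀ f : D'.Pass → X, D'.IsColoring Q f ↔ D.IsColoring Q (f ∘ e) := by
    intro f
    unfold IsColoring
    rw [← eC.forall_congr_right, ← eM.forall_congr_right]
    simp only [left, right, ← h_mark, h_symm, Function.comp_apply]
    refine and_congr_right fun _ => and_congr_left fun _ => ⟨fun h v i => ?_, fun h v' j' => ?_⟩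
    · obtain ⟨j, hj⟩ := h_virt v i
      have := h (eV v) j
      rwa [← hj, h_symm] at this
    -- A passage of a virtual crossing comes from one of a virtual crossing.
    · obtain ⟨q, hq⟩ := e.surjective (.virt v' j')
      rcases q with c | c | ⟨v, i⟩ | m
      · rw [h_over] at hq; cases hq
      · rw [h_under] at hq; cases hq
      · rw [← hq, h_symm]
        exact h v i
      · rw [h_mark] at hq; cases hq
  -- A colouring is transported along `e`, and so is each state.
  let φ : D'.Coloring Q ≃ D.Coloring Q :=
    (Equiv.arrowCongr e (Equiv.refl X)).symm.subtypeEquiv fun f => col f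
  refine (β.multiset_eq_of_equiv φ fun f => ?_).symm
  have hφ : (φ f).1 = f.1 ∘ e := rfl
  have graph : ∀ s : D.C → CrossingState, (D'.stateGraph (s ∘ eC.symm)).toModule β.δ =
      (D.stateGraph s).toModule β.δ := by
    intro s
    have hopp : ∀ h : D.Pass × Bool, D'.stateOpp (s ∘ eC.symm) (e h.1, h.2) =
        (e (D.stateOpp s h).1, (D.stateOpp s h).2) := by
      rintro ⟨c | c | ⟨v, i⟩ | m, i'⟩
      · cases h : s c <;> simp [h_over, h_under, stateOpp, h]
      · cases h : s c <;> simp [h_over, h_under, stateOpp, h]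
      · obtain ⟨j, hj⟩ := h_virt v i
        simp [stateOpp, hj]
      · simp [stateOpp, h_mark]
    have hnode : ∀ h : D.Pass × Bool, D'.stateNode (s ∘ eC.symm) (e h.1, h.2) =
        e (D.stateNode s h) := by
      rintro ⟨c | c | ⟨v, i⟩ | m, i'⟩
      · cases h : s c <;> cases i' <;> simp [h_over, h_under, stateNode, h]
      · cases h : s c <;> cases i' <;> simp [h_over, h_under, stateNode, h]
      · obtain ⟨j, hj⟩ := h_virt v i
        simp [stateNode, hj]
      · simp [stateNode, h_mark]
    refine FramedGraph.toModule_eq β.δ (.iso ⟨e.prodCongr (Equiv.refl Bool), ?_, hopp, ?_⟩)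
    · rintro ⟨p, _ | _⟩
      · exact congrArg (fun q => (q, true)) (h_symm p)
      · exact congrArg (fun q => (q, false)) (h_next p)
    · intro h k
      exact (Eq.congr (hnode h) (hnode k)).trans e.injective.eq_iff
  have hw : D'.writhe = D.writhe := by
    rw [writhe, ← Equiv.sum_comp eC]
    simp only [h_sign]
    rfl
  unfold value
  rw [hw]
  congr 1
  classical
  rw [← Equiv.sum_comp (eC.arrowCongr (Equiv.refl CrossingState))]
  refine Finset.sum_congr (by congr!) fun s _ => ?_
  have hs : (eC.arrowCongr (Equiv.refl CrossingState)) s = s ∘ eC.symm := rfl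
  rw [hs, graph, ← Equiv.prod_comp eC]
  simp [left, hφ, h_sign]

/-- A marked point carries its edge's colour on, and its two-valent node may be removed from every
state. -/
theorem multiset_subdivide {D D' : VirtualDiagram} (E : Extension D D' Empty Empty Unit)
    (p : D.Pass) (hp : E.Inserts p [.mark ()]) (h_rest : ∀ r, r ≠ p → E.Inserts r []) :
    β.multiset D = β.multiset D' := by
  obtain ⟨h1, h2⟩ := inserts_singleton.1 hp
  have h1' := (Equiv.symm_apply_eq _).2 h1.symm
  have h2' := (Equiv.symm_apply_eq _).2 h2.symm
  have h_rest' : ∀ r, (∀ _ : Unit, r ≠ p) → E.Inserts r [] := fun r hr => h_rest r (hr ())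
  have hN : ∀ f, E.NewColoring Q f ↔ f (E.new (.mark ())) = f (E.old p) := by
    intro f
    simp only [NewColoring, IsEmpty.forall_iff, true_and, h1']
    exact ⟨fun h => h (), fun h _ => h⟩
  refine β.multiset_eq_of_extension E (fun f hf => ?_) (fun f => ?_) fun f f' _ hc hff => ?_
  · refine compatible_of_inserts h_rest' fun _ => ?_
    rw [h2']
    exact (hN f).1 hf
  · simp only [hN, join_new, join_old]
    refine ⟨fun _ => f p, rfl, fun n hn => funext ?_⟩
    rintro (⟨⟨⟩⟩ | ⟨⟨⟩⟩ | ⟨⟨⟩, i⟩ | m)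
    exact hn
  · let χ : Unit × Bool ≃ Passage Empty Empty Unit × Bool :=
      { toFun := fun a => (.mark a.1, a.2)
        invFun := fun h => ((), h.2)
        left_inv := fun _ => rfl
        right_inv := by rintro ⟨⟨⟨⟩⟩ | ⟨⟨⟩⟩ | ⟨⟨⟩, i⟩ | m, i⟩; rfl }
    refine β.value_eq_of_extension E (p := fun _ : Unit => p) (fun _ _ _ => rfl)
      (fun _ => pointTangle Unit) (fun s t => ?_) f f' (fun c => ?_) fun O T₀ hT₀ => ?_
    · refine stateGraph_eq_glue β.δ E _ h_rest' s t (pointTangle Unit) (fun _ => rfl) χ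
        (fun _ => rfl) ?_ ?_ ?_
      · rintro ⟨_, i⟩ ⟨_, j⟩
        exact ⟨fun _ => rfl, fun _ => rfl⟩
      · rintro (⟨_, _ | _⟩ | ⟨_, _ | _⟩) <;>
          simp [pointTangle, strandEnds, halfEquiv_inl, halfEquiv_inr, χ]
      · rintro (⟨_, _ | _⟩ | ⟨_, _ | _⟩) <;>
          simp [pointTangle, strandEnds, halfEquiv_inl, halfEquiv_inr, χ, h1, h2]
    · rw [hc.leftPair_old, hff]
    · simp [pointTangle_glue_unit β.δ O hT₀]

/-- A virtual crossing does not change the colours of the strands, and in every state it consists of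
two
two-valent nodes. -/
theorem multiset_detour {D D' : VirtualDiagram} (E : Extension D D' Empty Unit Empty)
    (p q : D.Pass) (hpq : p ≠ q) (hp : E.Inserts p [.virt () false])
    (hq : E.Inserts q [.virt () true]) (h_rest : ∀ r, r ≠ p → r ≠ q → E.Inserts r []) :
    β.multiset D = β.multiset D' := by
  obtain ⟨h1, h2⟩ := inserts_singleton.1 hp
  obtain ⟨h3, h4⟩ := inserts_singleton.1 hq
  have h1' := (Equiv.symm_apply_eq _).2 h1.symm
  have h2' := (Equiv.symm_apply_eq _).2 h2.symm
  have h3' := (Equiv.symm_apply_eq _).2 h3.symm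
  have h4' := (Equiv.symm_apply_eq _).2 h4.symm
  let P : Bool → D.Pass := fun i => if i then q else p
  have hP : Function.Injective P := by
    rintro (_ | _) (_ | _) h <;> simp_all [P]
  have h_rest' : ∀ r, (∀ i, r ≠ P i) → E.Inserts r [] :=
    fun r hr => h_rest r (hr false) (hr true)
  have hN : ∀ f, E.NewColoring Q f ↔ f (E.new (.virt () false)) = f (E.old p) ∧
      f (E.new (.virt () true)) = f (E.old q) := by
    intro f
    simp only [NewColoring, IsEmpty.forall_iff, true_and, and_true, Bool.forall_bool, h1', h3']
    exact ⟨fun h => h (), fun h _ => h⟩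
  refine β.multiset_eq_of_extension E (fun f hf => ?_) (fun f => ?_) fun f f' _ hc hff => ?_
  · refine compatible_of_inserts h_rest' ?_
    rw [hN] at hf
    rintro (_ | _)
    · simp [P, h2', hf.1]
    · simp [P, h4', hf.2]
  · simp only [hN, join_new, join_old]
    refine ⟨fun | .virt _ false => f p | _ => f q, ⟨rfl, rfl⟩, fun n hn => funext ?_⟩
    rintro (⟨⟨⟩⟩ | ⟨⟨⟩⟩ | ⟨_, _ | _⟩ | ⟨⟨⟩⟩)
    exacts [hn.1, hn.2]
  · let χ : Bool × Bool ≃ Passage Empty Unit Empty × Bool :=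
      { toFun := fun a => (.virt () a.1, a.2)
        invFun := fun | (.virt _ i, j) => (i, j)
        left_inv := fun _ => rfl
        right_inv := by rintro ⟨⟨⟨⟩⟩ | ⟨⟨⟩⟩ | ⟨_, i⟩ | ⟨⟨⟩⟩, j⟩; rfl }
    refine β.value_eq_of_extension E hP
      (fun _ => pointTangle Bool) (fun s t => ?_) f f' (fun c => ?_) fun O T₀ hT₀ => ?_
    · refine stateGraph_eq_glue β.δ E _ h_rest' s t (pointTangle Bool) (fun _ => rfl) χ
        (fun _ => rfl) ?_ ?_ ?_
      · rintro ⟨a, i⟩ ⟨b, j⟩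
        simp only [χ, stateNode, pointTangle, Equiv.coe_fn_mk, Prod.mk.injEq, and_true]
        exact ⟨fun h => by cases h; rfl, fun h => h ▸ rfl⟩
      · rintro (⟨_ | _, _ | _⟩ | ⟨_ | _, _ | _⟩) <;>
          simp [pointTangle, strandEnds, halfEquiv_inl, halfEquiv_inr, χ]
      · rintro (⟨_ | _, _ | _⟩ | ⟨_ | _, _ | _⟩) <;>
          simp [pointTangle, strandEnds, halfEquiv_inl, halfEquiv_inr, χ, P, h1, h2, h3, h4]
    · rw [hc.leftPair_old, hff]
    · simp [pointTangle_glue_bool β.δ O hT₀]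

end ParityBiquandleBracket

namespace Biquandle

variable {X : Type*} (Q : Biquandle X)

/-- The two colours on the left of a crossing agree if those on the right do: this determines the
colours at a kink. -/
theorem eq_of_ast_eq_circ [Finite X] {a b : X} (h : Q.ast a b = Q.circ b a) : a = b := by
  obtain ⟨c, hc⟩ := Q.circ_self_bijective.2 (Q.circ b a)
  have := @Q.sideways_bijective.1 (b, a) (c, c)
    (Prod.ext (h.trans (hc.symm.trans (Q.circ_self c))) hc.symm)
  obtain ⟨rfl, rfl⟩ := Prod.mk.inj this
  rfl

/-- The colours of the two inner edges of a second Reidemeister move are determined by the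
colours of the incoming edges, and the colours do not change beyond the two crossings. Here the
two strands have the same direction, and the first crossing is positive. -/
theorem colours_parallel_pos : ∃ g : X → X → X × X, ∀ p₀ p₁ p₂ q₀ q₁ q₂,
    (q₁ = Q.circ q₀ p₁ ∧ p₀ = Q.ast p₁ q₀) ∧ (q₁ = Q.circ q₂ p₁ ∧ p₂ = Q.ast p₁ q₂) ↔
      p₂ = p₀ ∧ q₂ = q₀ ∧ (p₁, q₁) = g p₀ q₀ := by
  obtain ⟨a, ha, ha'⟩ : ∃ a : X → X → X, (∀ y x, Q.ast (a y x) y = x) ∧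
      ∀ y x, a y (Q.ast x y) = x :=
    ⟨fun y => (Equiv.ofBijective _ (Q.ast_bijective y)).symm,
      fun y => (Equiv.ofBijective _ (Q.ast_bijective y)).apply_symm_apply,
      fun y => (Equiv.ofBijective _ (Q.ast_bijective y)).symm_apply_apply⟩
  refine ⟨fun p₀ q₀ => (a q₀ p₀, Q.circ q₀ (a q₀ p₀)), fun p₀ p₁ p₂ q₀ q₁ q₂ => ⟨?_, ?_⟩⟩
  · rintro ⟨⟨rfl, rfl⟩, h, rfl⟩
    obtain rfl := (Q.circ_bijective p₁).1 h
    simp [ha']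
  · rintro ⟨rfl, rfl, h⟩
    obtain ⟨rfl, rfl⟩ := Prod.mk.inj h
    simp [ha]

/-- The case of strands of the same direction whose first crossing is negative. -/
theorem colours_parallel_neg : ∃ g : X → X → X × X, ∀ p₀ p₁ p₂ q₀ q₁ q₂,
    (q₀ = Q.circ q₁ p₀ ∧ p₁ = Q.ast p₀ q₁) ∧ (q₂ = Q.circ q₁ p₂ ∧ p₁ = Q.ast p₂ q₁) ↔
      p₂ = p₀ ∧ q₂ = q₀ ∧ (p₁, q₁) = g p₀ q₀ := by
  obtain ⟨a, ha, ha'⟩ : ∃ a : X → X → X, (∀ y x, Q.circ (a y x) y = x) ∧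
      ∀ y x, a y (Q.circ x y) = x :=
    ⟨fun y => (Equiv.ofBijective _ (Q.circ_bijective y)).symm,
      fun y => (Equiv.ofBijective _ (Q.circ_bijective y)).apply_symm_apply,
      fun y => (Equiv.ofBijective _ (Q.circ_bijective y)).symm_apply_apply⟩
  refine ⟨fun p₀ q₀ => (Q.ast p₀ (a p₀ q₀), a p₀ q₀), fun p₀ p₁ p₂ q₀ q₁ q₂ => ⟨?_, ?_⟩⟩
  · rintro ⟨⟨rfl, rfl⟩, rfl, h⟩
    obtain rfl := (Q.ast_bijective q₁).1 h
    simp [ha']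
  · rintro ⟨rfl, rfl, h⟩
    obtain ⟨rfl, rfl⟩ := Prod.mk.inj h
    simp [ha]

/-- The case of strands of opposite directions where the over-strand first passes a positive
crossing. -/
theorem colours_antiparallel_pos : ∃ g : X → X → X × X, ∀ p₀ p₁ p₂ q₀ q₁ q₂,
    (q₂ = Q.circ q₁ p₁ ∧ p₀ = Q.ast p₁ q₁) ∧ (q₀ = Q.circ q₁ p₁ ∧ p₂ = Q.ast p₁ q₁) ↔
      p₂ = p₀ ∧ q₂ = q₀ ∧ (p₁, q₁) = g p₀ q₀ := by
  let e := Equiv.ofBijective _ Q.sideways_bijective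
  refine ⟨fun p₀ q₀ => ((e.symm (p₀, q₀)).2, (e.symm (p₀, q₀)).1),
    fun p₀ p₁ p₂ q₀ q₁ q₂ => ⟨?_, ?_⟩⟩
  · rintro ⟨⟨rfl, rfl⟩, rfl, rfl⟩
    have h : e.symm (Q.ast p₁ q₁, Q.circ q₁ p₁) = (q₁, p₁) := e.symm_apply_apply (q₁, p₁)
    simp [h]
  · rintro ⟨rfl, rfl, h⟩
    have h' := Prod.mk.inj (e.apply_symm_apply (p₂, q₂))
    obtain ⟨rfl, rfl⟩ := Prod.mk.inj h
    exact ⟨⟨h'.2.symm, h'.1.symm⟩, h'.2.symm, h'.1.symm⟩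

/-- The case of strands of opposite directions where the over-strand first passes a negative
crossing. -/
theorem colours_antiparallel_neg : ∃ g : X → X → X × X, ∀ p₀ p₁ p₂ q₀ q₁ q₂,
    (q₁ = Q.circ q₂ p₀ ∧ p₁ = Q.ast p₀ q₂) ∧ (q₁ = Q.circ q₀ p₂ ∧ p₁ = Q.ast p₂ q₀) ↔
      p₂ = p₀ ∧ q₂ = q₀ ∧ (p₁, q₁) = g p₀ q₀ := by
  refine ⟨fun p₀ q₀ => (Q.ast p₀ q₀, Q.circ q₀ p₀), fun p₀ p₁ p₂ q₀ q₁ q₂ => ⟨?_, ?_⟩⟩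
  · rintro ⟨⟨rfl, rfl⟩, h, h'⟩
    have h2 := @Q.sideways_bijective.1 (q₂, p₀) (q₀, p₂) (Prod.ext h' h)
    obtain ⟨rfl, rfl⟩ := Prod.mk.inj h2
    simp
  · rintro ⟨rfl, rfl, h⟩
    obtain ⟨rfl, rfl⟩ := Prod.mk.inj h
    simp

end Biquandle

namespace ParityBiquandleBracket

open VirtualDiagram Extension

variable {X : Type*} [Finite X] {Q : Biquandle X} {R : Type*} [CommRing R]
  (β : ParityBiquandleBracket Q R)

/-! ### The first and the second Reidemeister move -/

/-- The value is unchanged because a kink is coloured by a pair `(x, x)`: by (i) the sum over its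
states is
the factor which the writhe number compensates. -/
theorem multiset_reidemeister1 {D D' : VirtualDiagram} (E : Extension D D' Unit Empty Empty)
    (p : D.Pass) (hp : E.Inserts p [.over (), .under ()] ∨ E.Inserts p [.under (), .over ()])
    (h_rest : ∀ r, r ≠ p → E.Inserts r []) : β.multiset D = β.multiset D' := by
  let P : Bool → Passage Unit Empty Empty := fun u => if u then .under () else .over ()
  obtain ⟨u, hu⟩ : ∃ u : Bool, E.Inserts p [P u, P !u] := by
    rcases hp with hp | hp
    exacts [⟨false, hp⟩, ⟨true, hp⟩]
  obtain ⟨h1, h2, h3⟩ := inserts_pair.1 hu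
  have h1' := (Equiv.symm_apply_eq _).2 h1.symm
  have h2' := (Equiv.symm_apply_eq _).2 h2.symm
  have h3' := (Equiv.symm_apply_eq _).2 h3.symm
  have h_rest' : ∀ r, (∀ _ : Unit, r ≠ p) → E.Inserts r [] := fun r hr => h_rest r (hr ())
  -- The colours of the inner edge and of the outgoing edge are determined by that of the incoming
  -- edge, and the crossing is coloured by a pair `(x, x)`.
  obtain ⟨g, hN⟩ : ∃ g : X → X, ∀ f, (E.NewColoring Q f ↔
      f (E.new (P !u)) = f (E.old p) ∧ f (E.new (P u)) = g (f (E.old p))) ∧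
      (f (E.new (P !u)) = f (E.old p) → (D'.leftPair f (E.eC (.inr ()))).1 =
        (D'.leftPair f (E.eC (.inr ()))).2) := by
    let e := Equiv.ofBijective _ Q.circ_self_bijective
    have he : ∀ a b, b = Q.circ a a ↔ a = e.symm b := fun a b => by
      rw [Equiv.eq_symm_apply, eq_comm]
      rfl
    have hN : ∀ f, E.NewColoring Q f ↔ D'.rightPair f (E.eC (.inr ())) =
        (Q.circ (D'.leftPair f (E.eC (.inr ()))).1 (D'.leftPair f (E.eC (.inr ()))).2,
          Q.ast (D'.leftPair f (E.eC (.inr ()))).2 (D'.leftPair f (E.eC (.inr ()))).1) := by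
      intro f
      simp only [NewColoring, IsEmpty.forall_iff, and_true]
      exact ⟨fun h => h (), fun h _ => h⟩
    have diag : ∀ a b, Q.ast a b = Q.circ b a → a = b := fun a b => Q.eq_of_ast_eq_circ
    have self := Q.circ_self
    have ho : ∀ c, Passage.over (E.eC (.inr c)) = E.new (.over c) := fun _ => rfl
    have hd : ∀ c, Passage.under (E.eC (.inr c)) = E.new (.under c) := fun _ => rfl
    have one : (-1 : ℤˣ) ≠ 1 := by decide
    rcases Int.units_eq_one_or (D'.sign (E.eC (.inr ()))) with hs | hs <;> cases u <;>
      simp only [P, Bool.not_true, Bool.not_false, if_true, Bool.false_eq_true, if_false]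
        at h1' h2' ⊢
    -- If the kink is positive with the over-passage first, or negative with the under-passage
    -- first, then its inner edge is in the left pair twice, otherwise it is in the right pair.
    · refine ⟨e.symm, fun f => ?_⟩
      have e1 : D'.leftPair f (E.eC (.inr ())) = (f (E.new (.over ())), f (E.new (.over ()))) := by
        simp [leftPair, hs, ho, hd, h1', h2', one]
      have e2 : D'.rightPair f (E.eC (.inr ())) = (f (E.new (.under ())), f (E.old p)) := by
        simp [rightPair, hs, ho, hd, h1', h2', one]
      rw [hN, e1, e2, Prod.mk.injEq]
      grind
    · refine ⟨fun a => Q.circ a a, fun f => ?_⟩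
      have e1 : D'.leftPair f (E.eC (.inr ())) = (f (E.old p), f (E.new (.over ()))) := by
        simp [leftPair, hs, ho, hd, h1', h2', one]
      have e2 : D'.rightPair f (E.eC (.inr ())) =
          (f (E.new (.under ())), f (E.new (.under ()))) := by
        simp [rightPair, hs, ho, hd, h1', h2', one]
      rw [hN, e1, e2, Prod.mk.injEq]
      grind
    · refine ⟨fun a => Q.circ a a, fun f => ?_⟩
      have e1 : D'.leftPair f (E.eC (.inr ())) = (f (E.new (.under ())), f (E.old p)) := by
        simp [leftPair, hs, ho, hd, h1', h2', one]
      have e2 : D'.rightPair f (E.eC (.inr ())) = (f (E.new (.over ())), f (E.new (.over ()))) := by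
        simp [rightPair, hs, ho, hd, h1', h2', one]
      rw [hN, e1, e2, Prod.mk.injEq]
      grind
    · refine ⟨e.symm, fun f => ?_⟩
      have e1 : D'.leftPair f (E.eC (.inr ())) =
          (f (E.new (.under ())), f (E.new (.under ()))) := by
        simp [leftPair, hs, ho, hd, h1', h2', one]
      have e2 : D'.rightPair f (E.eC (.inr ())) = (f (E.old p), f (E.new (.over ()))) := by
        simp [rightPair, hs, ho, hd, h1', h2', one]
      rw [hN, e1, e2, Prod.mk.injEq]
      grind
  refine β.multiset_eq_of_extension E (fun f hf => ?_) (fun f => ?_) fun f f' hn hc hff => ?_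
  · refine compatible_of_inserts h_rest' fun _ => ?_
    rw [h3']
    exact ((hN f).1.1 hf).1
  · simp only [(hN _).1, join_new, join_old]
    refine ⟨fun a =>
      match a with
      | .over _ => if u then f p else g (f p)
      | .under _ => if u then g (f p) else f p, ?_, fun n hn => funext ?_⟩
    · cases u <;> simp [P]
    · rintro (⟨⟩ | ⟨⟩ | ⟨⟨⟩, i⟩ | ⟨⟨⟩⟩) <;> cases u <;> simpa [P] using by first | exact hn.1 |
        exact hn.2
  · have hxy := (hN f'.1).2 ((hN f'.1).1.1 hn).1
    refine β.value_eq_of_extension E (p := fun _ : Unit => p) (fun _ _ _ => rfl)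
      (kink u) (fun s t => ?_) f f' (fun c => ?_) fun O T₀ hT₀ => ?_
    · refine stateGraph_eq_crossingTangle β.δ E _ h_rest' _ _ ?_ ?_ s t
      · rintro (⟨_, _ | _⟩ | ⟨_, _ | _, _ | _⟩) <;> cases u <;>
          simp [kinkMate, strandEnds, halfEquiv_inl, halfEquiv_inr, halfPassage]
      · rintro (⟨_, _ | _⟩ | ⟨_, _ | _, _ | _⟩) <;> cases u <;> simp [P] at h1 h2 h3 <;>
          simp [kinkMate, strandEnds, halfEquiv_inl, halfEquiv_inr, halfPassage, h1, h2, h3]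
    · rw [hc.leftPair_old, hff]
    · have hw : ∑ c : Unit, (D'.sign (E.eC (.inr c)) : ℤ) = D'.sign (E.eC (.inr ())) :=
        Fintype.sum_unique _
      rw [hw]
      change (D'.leftPair f'.1 (E.eC (.inr ()))).1 = _ at hxy
      refine sum_kink β.δ O u
        (fun s => β.coeff (D'.sign (E.eC (.inr ()))) s (D'.leftPair f'.1 (E.eC (.inr ()))).1
          (D'.leftPair f'.1 (E.eC (.inr ()))).2) _ ?_ ?_ hT₀
      all_goals
        rw [← hxy]
        rcases Int.units_eq_one_or (D'.sign (E.eC (.inr ()))) with hs | hs <;>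
          simp [coeff, hs, β.i_1, β.i_2, β.i_3, β.i_4]

/-- Both crossings are coloured by the same pair, so that the relations (ii) apply to the sum over
their
states. -/
theorem multiset_reidemeister2 {D D' : VirtualDiagram} (E : Extension D D' Bool Empty Empty)
    (p q : D.Pass) (hpq : p ≠ q)
    (h_sign : D'.sign (E.eC (Sum.inr true)) = -D'.sign (E.eC (Sum.inr false)))
    (hp : E.Inserts p [.over false, .over true])
    (hq : E.Inserts q [.under false, .under true] ∨ E.Inserts q [.under true, .under false])
    (h_rest : ∀ r, r ≠ p → r ≠ q → E.Inserts r []) : β.multiset D = β.multiset D' := by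
  obtain ⟨u, hu⟩ : ∃ u : Bool, E.Inserts q [.under u, .under !u] := by
    rcases hq with hq | hq
    exacts [⟨false, hq⟩, ⟨true, hq⟩]
  obtain ⟨h1, h2, h3⟩ := inserts_pair.1 hp
  obtain ⟨h4, h5, h6⟩ := inserts_pair.1 hu
  have h1' := (Equiv.symm_apply_eq _).2 h1.symm
  have h2' := (Equiv.symm_apply_eq _).2 h2.symm
  have h3' := (Equiv.symm_apply_eq _).2 h3.symm
  have h4' := (Equiv.symm_apply_eq _).2 h4.symm
  have h5' := (Equiv.symm_apply_eq _).2 h5.symm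
  have h6' := (Equiv.symm_apply_eq _).2 h6.symm
  let P : Bool → D.Pass := fun i => if i then q else p
  have hP : Function.Injective P := by
    rintro (_ | _) (_ | _) h <;> simp_all [P]
  have h_rest' : ∀ r, (∀ i, r ≠ P i) → E.Inserts r [] :=
    fun r hr => h_rest r (hr false) (hr true)
  -- The colours of the inner and of the outgoing edges are determined by those of the incoming
  -- edges, and the two crossings are coloured by the same pair.
  obtain ⟨g, hN⟩ : ∃ g : X → X → X × X, ∀ f, (E.NewColoring Q f ↔
      f (E.new (.over true)) = f (E.old p) ∧ f (E.new (.under !u)) = f (E.old q) ∧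
        (f (E.new (.over false)), f (E.new (.under u))) = g (f (E.old p)) (f (E.old q))) ∧
      (f (E.new (.over true)) = f (E.old p) → f (E.new (.under !u)) = f (E.old q) →
        D'.leftPair f (E.eC (.inr true)) = D'.leftPair f (E.eC (.inr false))) := by
    have ho : ∀ c, Passage.over (E.eC (.inr c)) = E.new (.over c) := fun _ => rfl
    have hd : ∀ c, Passage.under (E.eC (.inr c)) = E.new (.under c) := fun _ => rfl
    have one : (-1 : ℤˣ) ≠ 1 := by decide
    rcases Int.units_eq_one_or (D'.sign (E.eC (.inr false))) with hs | hs <;> cases u <;>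
      simp only [Bool.not_true, Bool.not_false, hs, neg_neg] at h4' h5' h_sign ⊢
    · obtain ⟨g, hg⟩ := Q.colours_parallel_pos
      refine ⟨g, fun f => ⟨?_, ?_⟩⟩
      · rw [← hg]
        simp [NewColoring, leftPair, rightPair, hs, h_sign, ho, hd, h1', h2', h4', h5', one]
      · simp +contextual [leftPair, hs, h_sign, ho, hd, h1', h2', h4', h5', one]
    · obtain ⟨g, hg⟩ := Q.colours_antiparallel_pos
      refine ⟨g, fun f => ⟨?_, ?_⟩⟩
      · rw [← hg]
        simp [NewColoring, leftPair, rightPair, hs, h_sign, ho, hd, h1', h2', h4', h5', one]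
      · simp +contextual [leftPair, hs, h_sign, ho, hd, h1', h2', h4', h5', one]
    · obtain ⟨g, hg⟩ := Q.colours_parallel_neg
      refine ⟨g, fun f => ⟨?_, ?_⟩⟩
      · rw [← hg]
        simp [NewColoring, leftPair, rightPair, hs, h_sign, ho, hd, h1', h2', h4', h5', one]
      · simp +contextual [leftPair, hs, h_sign, ho, hd, h1', h2', h4', h5', one]
    · obtain ⟨g, hg⟩ := Q.colours_antiparallel_neg
      refine ⟨g, fun f => ⟨?_, ?_⟩⟩
      · rw [← hg]
        simp [NewColoring, leftPair, rightPair, hs, h_sign, ho, hd, h1', h2', h4', h5', one]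
      · simp +contextual [leftPair, hs, h_sign, ho, hd, h1', h2', h4', h5', one]
  refine β.multiset_eq_of_extension E (fun f hf => ?_) (fun f => ?_) fun f f' hn hc hff => ?_
  · rw [(hN f).1] at hf
    refine compatible_of_inserts h_rest' ?_
    rintro (_ | _)
    · simp [P, h3', hf.1]
    · simp [P, h6', hf.2.1]
  · simp only [(hN _).1, join_new, join_old]
    refine ⟨fun a =>
      match a with
      | .over i => if i then f p else (g (f p) (f q)).1
      | .under i => if i = u then (g (f p) (f q)).2 else f q, by simp, fun n hn => funext ?_⟩
    have hn' := Prod.ext_iff.1 hn.2.2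
    rintro (i | i | ⟨⟨⟩, i⟩ | ⟨⟨⟩⟩)
    · cases i
      exacts [hn'.1, hn.1]
    · by_cases hi : i = u
      · subst hi
        simpa using hn'.2
      · obtain rfl : i = !u := by cases i <;> cases u <;> simp_all
        simpa using hn.2.1
  · have hxy := (hN f'.1).2 ((hN f'.1).1.1 hn).1 ((hN f'.1).1.1 hn).2.1
    refine β.value_eq_of_extension E hP
      (clasp u) (fun s t => ?_) f f' (fun c => ?_) fun O T₀ hT₀ => ?_
    · refine stateGraph_eq_crossingTangle β.δ E _ h_rest' _ _ ?_ ?_ s t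
      · rintro (⟨_ | _, _ | _⟩ | ⟨_ | _, _ | _, _ | _⟩) <;> cases u <;>
          simp [claspMate, strandEnds, halfEquiv_inl, halfEquiv_inr, halfPassage]
      · rintro (⟨_ | _, _ | _⟩ | ⟨_ | _, _ | _, _ | _⟩) <;> cases u <;>
          simp only [Bool.not_true, Bool.not_false] at h4 h5 h6 <;>
          simp [claspMate, strandEnds, halfEquiv_inl, halfEquiv_inr, halfPassage, P, h1, h2, h3, h4,
            h5, h6]
    · rw [hc.leftPair_old, hff]
    · rw [Fintype.sum_bool, h_sign]
      refine (sum_clasp β.δ O u (fun c s => β.coeff (D'.sign (E.eC (.inr c))) s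
          (D'.leftPair f'.1 (E.eC (.inr c))).1 (D'.leftPair f'.1 (E.eC (.inr c))).2)
          ?_ ?_ ?_ ?_ ?_ ?_ ?_ hT₀).trans (by simp)
      all_goals
        rw [h_sign, hxy]
        generalize (D'.leftPair f'.1 (E.eC (.inr false))).1 = x
        generalize (D'.leftPair f'.1 (E.eC (.inr false))).2 = y
        have r1 := β.ii_1 x y
        have r2 := β.ii_2 x y
        have r3 := β.ii_3 x y
        have r4 := β.ii_4 x y
        have r5 := β.ii_5 x y
        have r6 := β.ii_6 x y
        have r7 := β.ii_7 x y
        rcases Int.units_eq_one_or (D'.sign (E.eC (.inr false))) with hs | hs <;>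
          simp only [coeff, hs, neg_neg, if_true, if_neg (show (-1 : ℤˣ) ≠ 1 by decide)]
      -- The relations are symmetric up to the order of the two crossings.
      all_goals first
        | assumption
        | linear_combination r1
        | linear_combination r2
        | linear_combination r3
        | linear_combination r4
        | linear_combination r5
        | linear_combination r6
        | linear_combination r7

end ParityBiquandleBracket

/-! ### Triangles in a diagram -/

/-- The passages of the three strands of a triangle whose crossings are given by `ec`. -/
def trianglePass {C V M : Type} (ec : Fin 3 → C) (z : Fin 3 × Bool) : Passage C V M :=
  if (trianglePassage z).2 then .under (ec (trianglePassage z).1)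
  else .over (ec (trianglePassage z).1)

theorem trianglePass_injective {C V M : Type} {ec : Fin 3 → C} (h : Function.Injective ec) :
    Function.Injective (trianglePass ec : Fin 3 × Bool → Passage C V M) := by
  have inj : Function.Injective trianglePassage := by decide
  intro z z' hz
  unfold trianglePass at hz
  split_ifs at hz with h1 h2 h2
  · exact inj (Prod.ext (h (by simpa using hz)) (by simp_all))
  · exact inj (Prod.ext (h (by simpa using hz)) (by simp_all))

theorem exists_trianglePass_over {C V M : Type} (ec : Fin 3 → C) (k : Fin 3) :
    ∃ z, (trianglePass ec z : Passage C V M) = .over (ec k) := by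
  fin_cases k
  exacts [⟨(0, false), rfl⟩, ⟨(0, true), rfl⟩, ⟨(1, true), rfl⟩]

theorem exists_trianglePass_under {C V M : Type} (ec : Fin 3 → C) (k : Fin 3) :
    ∃ z, (trianglePass ec z : Passage C V M) = .under (ec k) := by
  fin_cases k
  exacts [⟨(1, false), rfl⟩, ⟨(2, false), rfl⟩, ⟨(2, true), rfl⟩]

theorem trianglePass_over_mem {C V M : Type} {ec : Fin 3 → C} {c : C} {z : Fin 3 × Bool}
    (h : (trianglePass ec z : Passage C V M) = .over c) : c ∈ Set.range ec := by
  unfold trianglePass at h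
  split_ifs at h
  exact ⟨_, by simpa using h⟩

theorem trianglePass_under_mem {C V M : Type} {ec : Fin 3 → C} {c : C} {z : Fin 3 × Bool}
    (h : (trianglePass ec z : Passage C V M) = .under c) : c ∈ Set.range ec := by
  unfold trianglePass at h
  split_ifs at h
  exact ⟨_, by simpa using h⟩

theorem trianglePass_ne_mark {C V M : Type} (ec : Fin 3 → C) (z : Fin 3 × Bool) (m : M) :
    (trianglePass ec z : Passage C V M) ≠ .mark m := by
  unfold trianglePass
  split_ifs <;> simp

theorem trianglePass_ne_virt {C V M : Type} (ec : Fin 3 → C) (z : Fin 3 × Bool) (v : V) (i : Bool) :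
    (trianglePass ec z : Passage C V M) ≠ .virt v i := by
  unfold trianglePass
  split_ifs <;> simp

namespace VirtualDiagram

section

variable (D : VirtualDiagram) (ec : Fin 3 → D.C)

theorem exchange_trianglePass (h : Function.Injective ec) (z : Fin 3 × Bool) :
    D.exchange (ec 0) (ec 1) (ec 2) (trianglePass ec z) = trianglePass ec (straight z) := by
  have h1 : ec 0 ≠ ec 1 := h.ne (by decide)
  have h2 : ec 0 ≠ ec 2 := h.ne (by decide)
  have h3 : ec 1 ≠ ec 2 := h.ne (by decide)
  obtain ⟨j, i⟩ := z
  fin_cases j <;> cases i <;>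
    simp [exchange, trianglePass, trianglePassage, straight, Equiv.swap_apply_def, h1, h2, h3,
      h1.symm, h2.symm, h3.symm]

theorem exchange_of_notMem {q : D.Pass} (hq : q ∉ Set.range (trianglePass ec)) :
    D.exchange (ec 0) (ec 1) (ec 2) q = q := by
  have h1 : q ≠ .over (ec 0) := fun h => hq ⟨(0, false), h.symm⟩
  have h2 : q ≠ .over (ec 1) := fun h => hq ⟨(0, true), h.symm⟩
  have h3 : q ≠ .under (ec 0) := fun h => hq ⟨(1, false), h.symm⟩
  have h4 : q ≠ .over (ec 2) := fun h => hq ⟨(1, true), h.symm⟩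
  have h5 : q ≠ .under (ec 1) := fun h => hq ⟨(2, false), h.symm⟩
  have h6 : q ≠ .under (ec 2) := fun h => hq ⟨(2, true), h.symm⟩
  simp [exchange, Equiv.swap_apply_of_ne_of_ne, h1, h2, h3, h4, h5, h6]

theorem exchange_exchange (h : Function.Injective ec) (q : D.Pass) :
    D.exchange (ec 0) (ec 1) (ec 2) (D.exchange (ec 0) (ec 1) (ec 2) q) = q := by
  by_cases hq : q ∈ Set.range (trianglePass ec)
  · obtain ⟨z, rfl⟩ := hq
    simp [D.exchange_trianglePass ec h, straight]
  · simp [D.exchange_of_notMem ec hq]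

/-- The diagram in which the two passages are exchanged on each strand of a triangle. -/
noncomputable abbrev exchanged (tm tb mb : D.C) : VirtualDiagram :=
  { D with next := D.exchange tm tb mb * D.next * (D.exchange tm tb mb)⁻¹ }

theorem exchanged_next (q : D.Pass) :
    (D.exchanged (ec 0) (ec 1) (ec 2)).next (D.exchange (ec 0) (ec 1) (ec 2) q) =
      D.exchange (ec 0) (ec 1) (ec 2) (D.next q) := by
  simp [exchanged]

theorem exchanged_next_symm (q : D.Pass) :
    (D.exchanged (ec 0) (ec 1) (ec 2)).next.symm (D.exchange (ec 0) (ec 1) (ec 2) q) =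
      D.exchange (ec 0) (ec 1) (ec 2) (D.next.symm q) := by
  rw [Equiv.symm_apply_eq, D.exchanged_next ec, Equiv.apply_symm_apply]

end

/-- The strands of the triangle with crossings `ec` begin at the marked points `μ`, and all three
strands are directed as in a braid. -/
structure MarkedTriangle (D : VirtualDiagram) (ec : Fin 3 → D.C) (μ : Fin 3 → D.M) : Prop where
  injective : Function.Injective ec
  next_mark : ∀ j, D.next (.mark (μ j)) = trianglePass ec (j, false)
  next_first : ∀ j, D.next (trianglePass ec (j, false)) = trianglePass ec (j, true)

namespace MarkedTriangle

variable {D : VirtualDiagram} {ec : Fin 3 → D.C} {μ : Fin 3 → D.M} (h : MarkedTriangle D ec μ)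

include h

theorem mark_injective : Function.Injective μ := by
  intro j k hjk
  have := h.next_mark j
  rw [hjk, h.next_mark k] at this
  simpa using (trianglePass_injective h.injective this).symm

theorem next_last_notMem (j : Fin 3) :
    D.next (trianglePass ec (j, true)) ∉ Set.range (trianglePass ec) := by
  rintro ⟨⟨k, _ | _⟩, hk⟩
  · rw [← h.next_mark k] at hk
    exact trianglePass_ne_mark _ _ _ (D.next.injective hk).symm
  · rw [← h.next_first k] at hk
    simpa using trianglePass_injective h.injective (D.next.injective hk)

theorem next_notMem {q : D.Pass} (hq : q ∉ Set.range (trianglePass ec))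
    (hμ : ∀ j, q ≠ .mark (μ j)) : D.next q ∉ Set.range (trianglePass ec) := by
  rintro ⟨⟨k, _ | _⟩, hk⟩
  · rw [← h.next_mark k] at hk
    exact hμ k (D.next.injective hk).symm
  · rw [← h.next_first k] at hk
    exact hq ⟨_, D.next.injective hk⟩

omit h in
/-- The crossings of a diagram, those of a triangle separated. -/
noncomputable def crossingEquiv (h : Function.Injective ec) :
    {c : D.C // c ∉ Set.range ec} ⊕ Fin 3 ≃ D.C :=
  Equiv.ofBijective (Sum.elim Subtype.val ec)
    ⟨Subtype.val_injective.sumElim h fun c j hc => c.2 ⟨j, hc.symm⟩, fun c => by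
      by_cases hc : c ∈ Set.range ec
      · obtain ⟨j, rfl⟩ := hc
        exact ⟨.inr j, rfl⟩
      · exact ⟨.inl ⟨c, hc⟩, rfl⟩⟩

/-- The passages which do not belong to the triangle. -/
def oldPass (p : Passage {c : D.C // c ∉ Set.range ec} D.V D.M) : D.Pass :=
  p.map Subtype.val id id

omit h in
theorem oldPass_injective : Function.Injective (oldPass : _ → D.Pass) (α := Passage {c : D.C // c ∉
    Set.range ec} D.V D.M) := by
  rintro (⟨c, hc⟩ | ⟨c, hc⟩ | ⟨v, i⟩ | m) (⟨c', hc'⟩ | ⟨c', hc'⟩ | ⟨v', i'⟩ | m') h <;>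
    simp_all [oldPass, Passage.map]

omit h in
theorem oldPass_notMem (p : Passage {c : D.C // c ∉ Set.range ec} D.V D.M) :
    oldPass p ∉ Set.range (trianglePass ec) := by
  rintro ⟨z, hz⟩
  rcases p with ⟨c, hc⟩ | ⟨c, hc⟩ | ⟨v, i⟩ | m
  · exact hc (trianglePass_over_mem hz)
  · exact hc (trianglePass_under_mem hz)
  · exact trianglePass_ne_virt _ _ _ _ hz
  · exact trianglePass_ne_mark _ _ _ hz

omit h in
theorem exists_oldPass {q : D.Pass} (hq : q ∉ Set.range (trianglePass ec)) :
    ∃ p : Passage {c : D.C // c ∉ Set.range ec} D.V D.M, oldPass p = q := by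
  rcases q with c | c | ⟨v, i⟩ | m
  · exact ⟨.over ⟨c, fun ⟨k, hk⟩ => hq (hk ▸ exists_trianglePass_over ec k)⟩, rfl⟩
  · exact ⟨.under ⟨c, fun ⟨k, hk⟩ => hq (hk ▸ exists_trianglePass_under ec k)⟩, rfl⟩
  · exact ⟨.virt v i, rfl⟩
  · exact ⟨.mark m, rfl⟩

open Classical in
/-- The passage that follows `p` when the passages of the triangle are skipped. -/
theorem exists_next (p : Passage {c : D.C // c ∉ Set.range ec} D.V D.M) :
    ∃ q : Passage {c : D.C // c ∉ Set.range ec} D.V D.M,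
      (∀ j, p = .mark (μ j) → oldPass q = D.next (trianglePass ec (j, true))) ∧
      ((∀ j, p ≠ .mark (μ j)) → oldPass q = D.next (oldPass p)) := by
  by_cases hp : ∃ j, p = .mark (μ j)
  · obtain ⟨j, rfl⟩ := hp
    obtain ⟨q, hq⟩ := exists_oldPass (h.next_last_notMem j)
    refine ⟨q, fun k hk => ?_, fun hk => absurd rfl (hk j)⟩
    obtain rfl := h.mark_injective (Passage.mark.inj hk)
    exact hq
  · rw [not_exists] at hp
    obtain ⟨q, hq⟩ := exists_oldPass (h.next_notMem (oldPass_notMem p) fun j hj =>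
      hp j (oldPass_injective (hj.trans rfl)))
    exact ⟨q, fun k hk => absurd hk (hp k), fun _ => hq⟩

/-- The diagram without the crossings of the triangle: each strand of the triangle becomes an edge
which begins at its marked point. -/
noncomputable def base : VirtualDiagram where
  C := {c : D.C // c ∉ Set.range ec}
  V := D.V
  M := D.M
  fintypeC := Fintype.ofFinite _
  sign c := D.sign c
  next := Equiv.ofBijective (fun p => (h.exists_next p).choose) (by
    refine Finite.injective_iff_bijective.1 fun p p' hpp => ?_
    have h1 := (h.exists_next p).choose_spec
    have h2 := (h.exists_next p').choose_spec
    rw [← (hpp : (h.exists_next p).choose = (h.exists_next p').choose)] at h2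
    by_cases hp : ∃ j, p = .mark (μ j) <;> by_cases hp' : ∃ j, p' = .mark (μ j)
    · obtain ⟨j, hj⟩ := hp
      obtain ⟨k, hk⟩ := hp'
      have := trianglePass_injective h.injective
        (D.next.injective ((h1.1 j hj).symm.trans (h2.1 k hk)))
      obtain rfl : j = k := by simpa using this
      rw [hj, hk]
    · obtain ⟨j, hj⟩ := hp
      have := D.next.injective ((h1.1 j hj).symm.trans (h2.2 (not_exists.1 hp')))
      exact absurd ⟨_, this⟩ (oldPass_notMem p')
    · obtain ⟨j, hj⟩ := hp'
      have := D.next.injective ((h2.1 j hj).symm.trans (h1.2 (not_exists.1 hp)))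
      exact absurd ⟨_, this⟩ (oldPass_notMem p)
    · exact oldPass_injective (D.next.injective
        ((h1.2 (not_exists.1 hp)).symm.trans (h2.2 (not_exists.1 hp')))))

theorem base_next_mark (j : Fin 3) :
    oldPass (h.base.next (.mark (μ j))) = D.next (trianglePass ec (j, true)) :=
  (h.exists_next _).choose_spec.1 j rfl

theorem base_next {p : h.base.Pass} (hp : ∀ j, p ≠ .mark (μ j)) :
    oldPass (h.base.next p) = D.next (oldPass p) :=
  (h.exists_next p).choose_spec.2 hp

/-- The diagram as an extension of the diagram without the triangle. -/
noncomputable def extension : Extension h.base D (Fin 3) Empty Empty where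
  eC := crossingEquiv h.injective
  eV := Equiv.sumEmpty D.V Empty
  eM := Equiv.sumEmpty D.M Empty
  sign_old _ := rfl

/-- The diagram with the passages exchanged as an extension of the diagram without the triangle. -/
noncomputable def extension' :
    Extension h.base (D.exchanged (ec 0) (ec 1) (ec 2)) (Fin 3) Empty Empty where
  eC := crossingEquiv h.injective
  eV := Equiv.sumEmpty D.V Empty
  eM := Equiv.sumEmpty D.M Empty
  sign_old _ := rfl

theorem extension_new (z : Fin 3 × Bool) :
    h.extension.new (trianglePass id z) = trianglePass ec z := by
  rcases z with ⟨j, i⟩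
  fin_cases j <;> cases i <;> rfl

theorem extension_inserts (j : Fin 3) : h.extension.Inserts (.mark (μ j))
    [trianglePass id (j, false), trianglePass id (j, true)] := by
  rw [Extension.inserts_pair, h.extension_new, h.extension_new]
  exact ⟨h.next_mark j, h.next_first j, (h.base_next_mark j).symm⟩

theorem extension_inserts_nil (r : h.base.Pass) (hr : ∀ j, r ≠ .mark (μ j)) :
    h.extension.Inserts r [] :=
  Extension.inserts_nil.2 (h.base_next hr).symm

theorem exchanged_next_eq {p q : D.Pass}
    (hpq : D.next (D.exchange (ec 0) (ec 1) (ec 2) p) = D.exchange (ec 0) (ec 1) (ec 2) q) :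
    (D.exchanged (ec 0) (ec 1) (ec 2)).next p = q := by
  have := D.exchanged_next ec (D.exchange (ec 0) (ec 1) (ec 2) p)
  rwa [hpq, D.exchange_exchange ec h.injective, D.exchange_exchange ec h.injective] at this

theorem extension'_inserts (j : Fin 3) : h.extension'.Inserts (.mark (μ j))
    [trianglePass id (j, true), trianglePass id (j, false)] := by
  have hnew : ∀ z, h.extension'.new (trianglePass id z) = trianglePass ec z := h.extension_new
  rw [Extension.inserts_pair, hnew, hnew]
  have ex := D.exchange_trianglePass ec h.injective
  refine ⟨h.exchanged_next_eq ?_, h.exchanged_next_eq ?_, h.exchanged_next_eq ?_⟩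
  · exact (congrArg D.next (D.exchange_of_notMem ec (oldPass_notMem (.mark (μ j))))).trans
      ((h.next_mark j).trans (ex (j, true)).symm)
  · rw [ex, ex]
    exact h.next_first j
  · rw [ex]
    exact (h.base_next_mark j).symm.trans (D.exchange_of_notMem ec (oldPass_notMem _)).symm

theorem extension'_inserts_nil (r : h.base.Pass) (hr : ∀ j, r ≠ .mark (μ j)) :
    h.extension'.Inserts r [] := by
  refine Extension.inserts_nil.2 (h.exchanged_next_eq ?_)
  exact ((congrArg D.next (D.exchange_of_notMem ec (oldPass_notMem r))).trans
    (h.base_next hr).symm).trans (D.exchange_of_notMem ec (oldPass_notMem _)).symm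

end MarkedTriangle

/-- A state of a diagram with a triangle, the passages on each strand being exchanged if `f` is
true. -/
theorem stateGraph_eq_triangle {R : Type*} [CommRing R] (δ : R) {B D : VirtualDiagram}
    (E : Extension B D (Fin 3) Empty Empty) (f : Bool) {p : Fin 3 → B.Pass}
    (hp : Function.Injective p)
    (h_ins : ∀ j, E.Inserts (p j) [trianglePass id (j, f), trianglePass id (j, !f)])
    (h_rest : ∀ r, (∀ j, r ≠ p j) → E.Inserts r []) (s : B.C → CrossingState)
    (t : Fin 3 → CrossingState) :
    (D.stateGraph (Sum.elim s t ∘ E.eC.symm)).toModule δ =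
      ((triangle f t).glue (B.stateCut s hp)).toModule δ := by
  have h_ins' := fun j => Extension.inserts_pair.1 (h_ins j)
  simp only [Fin.forall_fin_succ, trianglePass, trianglePassage] at h_ins'
  refine stateGraph_eq_crossingTangle δ E hp h_rest _ _ ?_ ?_ s t
  · rintro (⟨j, i⟩ | ⟨c, u, i⟩)
    · fin_cases j <;> cases i <;> cases f <;>
        simp [triangleMate, strandEnds, Extension.halfEquiv_inl, Extension.halfEquiv_inr,
            halfPassage]
    · fin_cases c <;> cases u <;> cases i <;> cases f <;>
        simp [triangleMate, triangleStrand, strandEnds, Extension.halfEquiv_inl,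
          Extension.halfEquiv_inr, halfPassage]
  · rintro (⟨j, i⟩ | ⟨c, u, i⟩)
    · fin_cases j <;> cases i <;> cases f <;> simp at h_ins' <;>
        simp [triangleMate, trianglePassage, strandEnds, Extension.halfEquiv_inl,
          Extension.halfEquiv_inr, halfPassage, h_ins']
    · fin_cases c <;> cases u <;> cases i <;> cases f <;> simp at h_ins' <;>
        simp [triangleMate, triangleStrand, trianglePassage, strandEnds, Extension.halfEquiv_inl,
          Extension.halfEquiv_inr, halfPassage, h_ins']

end VirtualDiagram

/-! ### Colourings of triangles -/

namespace VirtualDiagram.MarkedTriangle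

variable {D : VirtualDiagram} {ec : Fin 3 → D.C} {μ : Fin 3 → D.M} (h : MarkedTriangle D ec μ)
  {X : Type*} {Q : Biquandle X}

/-- Colourings before and after the exchange agree outside the triangle. -/
structure Related (ec : Fin 3 → D.C) (f g : D.Pass → X) : Prop where
  eq_of_notMem : ∀ q, q ∉ Set.range (trianglePass ec) → g q = f q
  eq_exit : ∀ j, g (trianglePass ec (j, false)) = f (trianglePass ec (j, true))

/-- The condition on a colouring at the crossing `c`. -/
def ColoringAt (Q : Biquandle X) (D : VirtualDiagram) (f : D.Pass → X) (c : D.C) : Prop :=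
  D.rightPair f c =
    (Q.circ (D.leftPair f c).1 (D.leftPair f c).2, Q.ast (D.leftPair f c).2 (D.leftPair f c).1)

include h

theorem related_symm {f g : D.Pass → X} (r : Related ec f g) {q : D.Pass}
    (hq : q ∉ Set.range (trianglePass ec)) :
    g ((D.exchanged (ec 0) (ec 1) (ec 2)).next.symm q) = f (D.next.symm q) := by
  have e := D.exchanged_next_symm ec q
  rw [D.exchange_of_notMem ec hq] at e
  rw [e]
  by_cases hr : D.next.symm q ∈ Set.range (trianglePass ec)
  · obtain ⟨⟨j, _ | _⟩, hj⟩ := hr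
    · rw [eq_comm, Equiv.symm_apply_eq, h.next_first] at hj
      exact absurd ⟨_, hj.symm⟩ hq
    · rw [← hj, D.exchange_trianglePass ec h.injective]
      exact r.eq_exit j
  · rw [D.exchange_of_notMem ec hr]
    exact r.eq_of_notMem _ hr

omit h in
theorem over_notMem {c : D.C} (hc : c ∉ Set.range ec) :
    (.over c : D.Pass) ∉ Set.range (trianglePass ec) := fun ⟨_, hz⟩ => hc (trianglePass_over_mem hz)

omit h in
theorem under_notMem {c : D.C} (hc : c ∉ Set.range ec) :
    (.under c : D.Pass) ∉ Set.range (trianglePass ec) := fun ⟨_, hz⟩ => hc (trianglePass_under_mem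
        hz)

theorem leftPair_of_related {f g : D.Pass → X} (r : Related ec f g) {c : D.C}
    (hc : c ∉ Set.range ec) :
    (D.exchanged (ec 0) (ec 1) (ec 2)).leftPair g c = D.leftPair f c := by
  unfold leftPair
  rw [h.related_symm r (over_notMem hc), h.related_symm r (under_notMem hc),
    r.eq_of_notMem _ (over_notMem hc), r.eq_of_notMem _ (under_notMem hc)]

theorem rightPair_of_related {f g : D.Pass → X} (r : Related ec f g) {c : D.C}
    (hc : c ∉ Set.range ec) :
    (D.exchanged (ec 0) (ec 1) (ec 2)).rightPair g c = D.rightPair f c := by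
  unfold rightPair
  rw [h.related_symm r (over_notMem hc), h.related_symm r (under_notMem hc),
    r.eq_of_notMem _ (over_notMem hc), r.eq_of_notMem _ (under_notMem hc)]

/-- A colouring remains a colouring after the exchange if this is true at the crossings of the
triangle. -/
theorem isColoring_iff_of_related {f g : D.Pass → X} (r : Related ec f g)
    (ht : (∀ k, ColoringAt Q (D.exchanged (ec 0) (ec 1) (ec 2)) g (ec k)) ↔
      ∀ k, ColoringAt Q D f (ec k)) :
    (D.exchanged (ec 0) (ec 1) (ec 2)).IsColoring Q g ↔ D.IsColoring Q f := by
  have split : ∀ P : D.C → Prop, (∀ c, P c) ↔ (∀ k, P (ec k)) ∧ ∀ c ∉ Set.range ec, P c :=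
    fun P => ⟨fun h => ⟨fun k => h _, fun c _ => h c⟩, fun ⟨h1, h2⟩ c => by
      by_cases hc : c ∈ Set.range ec
      · obtain ⟨k, rfl⟩ := hc
        exact h1 k
      · exact h2 c hc⟩
  have old : ∀ c ∉ Set.range ec, (ColoringAt Q (D.exchanged (ec 0) (ec 1) (ec 2)) g c ↔
      ColoringAt Q D f c) := by
    intro c hc
    unfold ColoringAt
    rw [h.leftPair_of_related r hc, h.rightPair_of_related r hc]
  have hv : ∀ v i, (.virt v i : D.Pass) ∉ Set.range (trianglePass ec) :=
    fun _ _ ⟨_, hz⟩ => trianglePass_ne_virt _ _ _ _ hz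
  have hm : ∀ m, (.mark m : D.Pass) ∉ Set.range (trianglePass ec) :=
    fun _ ⟨_, hz⟩ => trianglePass_ne_mark _ _ _ hz
  refine and_congr ?_ (and_congr (forall₂_congr fun v i => ?_) (forall_congr' fun m => ?_))
  · change (∀ c, ColoringAt Q (D.exchanged (ec 0) (ec 1) (ec 2)) g c) ↔ ∀ c, ColoringAt Q D f c
    rw [split, split (ColoringAt Q D f), ht]
    exact and_congr_right fun _ => forall₂_congr old
  · rw [h.related_symm r (hv v i), r.eq_of_notMem _ (hv v i)]
  · rw [h.related_symm r (hm m), r.eq_of_notMem _ (hm m)]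

/-- The colours on the left of the crossings before the exchange; the mark before a strand stands
for its
incoming edge, a passage for the edge leaving it. -/
theorem leftPair_triangle (hs : ∀ k, D.sign (ec k) = 1) (f : D.Pass → X) :
    D.leftPair f (ec 0) = (f (.mark (μ 1)), f (trianglePass ec (0, false))) ∧
    D.leftPair f (ec 1) = (f (.mark (μ 2)), f (trianglePass ec (0, true))) ∧
    D.leftPair f (ec 2) = (f (trianglePass ec (2, false)), f (trianglePass ec (1, true))) := by
  have h1 := fun j => (Equiv.symm_apply_eq _).2 (h.next_mark j).symm
  have h2 := fun j => (Equiv.symm_apply_eq _).2 (h.next_first j).symm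
  have a0 : D.next.symm (.under (ec 0)) = .mark (μ 1) := h1 1
  have a1 : D.next.symm (.under (ec 1)) = .mark (μ 2) := h1 2
  have a2 : D.next.symm (.under (ec 2)) = trianglePass ec (2, false) := h2 2
  simp only [leftPair, hs, if_true, a0, a1, a2]
  exact ⟨rfl, rfl, rfl⟩

theorem rightPair_triangle (hs : ∀ k, D.sign (ec k) = 1) (f : D.Pass → X) :
    D.rightPair f (ec 0) = (f (trianglePass ec (1, false)), f (.mark (μ 0))) ∧
    D.rightPair f (ec 1) = (f (trianglePass ec (2, false)), f (trianglePass ec (0, false))) ∧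
    D.rightPair f (ec 2) = (f (trianglePass ec (2, true)), f (trianglePass ec (1, false))) := by
  have h1 := fun j => (Equiv.symm_apply_eq _).2 (h.next_mark j).symm
  have h2 := fun j => (Equiv.symm_apply_eq _).2 (h.next_first j).symm
  have a0 : D.next.symm (.over (ec 0)) = .mark (μ 0) := h1 0
  have a1 : D.next.symm (.over (ec 1)) = trianglePass ec (0, false) := h2 0
  have a2 : D.next.symm (.over (ec 2)) = trianglePass ec (1, false) := h2 1
  simp only [rightPair, hs, if_true, a0, a1, a2]
  exact ⟨rfl, rfl, rfl⟩

theorem exchanged_symm_last (j : Fin 3) : (D.exchanged (ec 0) (ec 1) (ec 2)).next.symm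
    (trianglePass ec (j, true)) = .mark (μ j) := by
  have := D.exchanged_next_symm ec (trianglePass ec (j, false))
  rw [D.exchange_trianglePass ec h.injective, ← h.next_mark, Equiv.symm_apply_apply,
    D.exchange_of_notMem ec (fun ⟨_, hz⟩ => trianglePass_ne_mark _ _ _ hz)] at this
  exact this

theorem exchanged_symm_first (j : Fin 3) : (D.exchanged (ec 0) (ec 1) (ec 2)).next.symm
    (trianglePass ec (j, false)) = trianglePass ec (j, true) := by
  have := D.exchanged_next_symm ec (trianglePass ec (j, true))
  rw [D.exchange_trianglePass ec h.injective, ← h.next_first, Equiv.symm_apply_apply,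
    D.exchange_trianglePass ec h.injective] at this
  exact this

theorem leftPair_exchanged (hs : ∀ k, D.sign (ec k) = 1) (g : D.Pass → X) :
    (D.exchanged (ec 0) (ec 1) (ec 2)).leftPair g (ec 0) =
      (g (trianglePass ec (1, true)), g (trianglePass ec (0, false))) ∧
    (D.exchanged (ec 0) (ec 1) (ec 2)).leftPair g (ec 1) =
      (g (trianglePass ec (2, true)), g (trianglePass ec (0, true))) ∧
    (D.exchanged (ec 0) (ec 1) (ec 2)).leftPair g (ec 2) =
      (g (.mark (μ 2)), g (trianglePass ec (1, true))) := by
  have a0 : (D.exchanged (ec 0) (ec 1) (ec 2)).next.symm (.under (ec 0)) =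
    trianglePass ec (1, true) := h.exchanged_symm_first 1
  have a1 : (D.exchanged (ec 0) (ec 1) (ec 2)).next.symm (.under (ec 1)) =
    trianglePass ec (2, true) := h.exchanged_symm_first 2
  have a2 : (D.exchanged (ec 0) (ec 1) (ec 2)).next.symm (.under (ec 2)) = .mark (μ 2) :=
    h.exchanged_symm_last 2
  simp only [leftPair, hs, if_true, a0, a1, a2]
  exact ⟨rfl, rfl, rfl⟩

theorem rightPair_exchanged (hs : ∀ k, D.sign (ec k) = 1) (g : D.Pass → X) :
    (D.exchanged (ec 0) (ec 1) (ec 2)).rightPair g (ec 0) =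
      (g (trianglePass ec (1, false)), g (trianglePass ec (0, true))) ∧
    (D.exchanged (ec 0) (ec 1) (ec 2)).rightPair g (ec 1) =
      (g (trianglePass ec (2, false)), g (.mark (μ 0))) ∧
    (D.exchanged (ec 0) (ec 1) (ec 2)).rightPair g (ec 2) =
      (g (trianglePass ec (2, true)), g (.mark (μ 1))) := by
  have a0 : (D.exchanged (ec 0) (ec 1) (ec 2)).next.symm (.over (ec 0)) =
    trianglePass ec (0, true) := h.exchanged_symm_first 0
  have a1 : (D.exchanged (ec 0) (ec 1) (ec 2)).next.symm (.over (ec 1)) = .mark (μ 0) :=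
    h.exchanged_symm_last 0
  have a2 : (D.exchanged (ec 0) (ec 1) (ec 2)).next.symm (.over (ec 2)) = .mark (μ 1) :=
    h.exchanged_symm_last 1
  simp only [rightPair, hs, if_true, a0, a1, a2]
  exact ⟨rfl, rfl, rfl⟩

theorem coloringAt_triangle (hs : ∀ k, D.sign (ec k) = 1) (f : D.Pass → X) :
    (∀ k, ColoringAt Q D f (ec k)) ↔
      (f (trianglePass ec (1, false)) = Q.circ (f (.mark (μ 1))) (f (trianglePass ec (0, false))) ∧
        f (.mark (μ 0)) = Q.ast (f (trianglePass ec (0, false))) (f (.mark (μ 1)))) ∧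
      (f (trianglePass ec (2, false)) = Q.circ (f (.mark (μ 2))) (f (trianglePass ec (0, true))) ∧
        f (trianglePass ec (0, false)) = Q.ast (f (trianglePass ec (0, true))) (f (.mark (μ 2)))) ∧
      (f (trianglePass ec (2, true)) =
          Q.circ (f (trianglePass ec (2, false))) (f (trianglePass ec (1, true))) ∧
        f (trianglePass ec (1, false)) =
          Q.ast (f (trianglePass ec (1, true))) (f (trianglePass ec (2, false)))) := by
  obtain ⟨a0, a1, a2⟩ := h.leftPair_triangle hs f
  obtain ⟨b0, b1, b2⟩ := h.rightPair_triangle hs f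
  rw [Fin.forall_fin_succ, Fin.forall_fin_two]
  unfold ColoringAt
  simp only [Fin.succ_zero_eq_one, Fin.succ_one_eq_two, a0, a1, a2, b0, b1, b2, Prod.mk.injEq]

theorem coloringAt_exchanged (hs : ∀ k, D.sign (ec k) = 1) (g : D.Pass → X) :
    (∀ k, ColoringAt Q (D.exchanged (ec 0) (ec 1) (ec 2)) g (ec k)) ↔
      (g (trianglePass ec (1, false)) =
          Q.circ (g (trianglePass ec (1, true))) (g (trianglePass ec (0, false))) ∧
        g (trianglePass ec (0, true)) =
          Q.ast (g (trianglePass ec (0, false))) (g (trianglePass ec (1, true)))) ∧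
      (g (trianglePass ec (2, false)) =
          Q.circ (g (trianglePass ec (2, true))) (g (trianglePass ec (0, true))) ∧
        g (.mark (μ 0)) = Q.ast (g (trianglePass ec (0, true))) (g (trianglePass ec (2, true)))) ∧
      (g (trianglePass ec (2, true)) = Q.circ (g (.mark (μ 2))) (g (trianglePass ec (1, true))) ∧
        g (.mark (μ 1)) = Q.ast (g (trianglePass ec (1, true))) (g (.mark (μ 2)))) := by
  obtain ⟨a0, a1, a2⟩ := h.leftPair_exchanged hs g
  obtain ⟨b0, b1, b2⟩ := h.rightPair_exchanged hs g
  rw [Fin.forall_fin_succ, Fin.forall_fin_two]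
  unfold ColoringAt
  simp only [Fin.succ_zero_eq_one, Fin.succ_one_eq_two, a0, a1, a2, b0, b1, b2, Prod.mk.injEq]

/-- Related colourings of the two triangles exist and determine each other: if the bottom strand
begins with `x`, the top strand ends with `z` and the middle strand begins with `y * x`, then the
exchange axioms of a biquandle give the colours of the other edges. -/
theorem existsUnique_related (hs : ∀ k, D.sign (ec k) = 1) (f : D.Pass → X)
    (hf : D.IsColoring Q f) :
    ∃! g, Related ec f g ∧ (D.exchanged (ec 0) (ec 1) (ec 2)).IsColoring Q g := by
  have inj := trianglePass_injective (V := D.V) (M := D.M) h.injective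
  have hm : ∀ m, (.mark m : D.Pass) ∉ Set.range (trianglePass ec) :=
    fun _ ⟨_, hz⟩ => trianglePass_ne_mark _ _ _ hz
  -- The edge of the middle strand between its two crossings of the new triangle.
  obtain ⟨y, hy⟩ := (Q.ast_bijective (f (.mark (μ 2)))).2 (f (.mark (μ 1)))
  simp only at hy
  let n : Fin 3 → X := ![Q.ast (f (trianglePass ec (0, true))) y, y, Q.circ (f (.mark (μ 2))) y]
  let g : D.Pass → X := Function.extend (fun j => trianglePass ec (j, true)) n
    (f ∘ D.exchange (ec 0) (ec 1) (ec 2))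
  have inj' : Function.Injective fun j => (trianglePass ec (j, true) : D.Pass) := by
    intro j k hjk
    simpa using inj hjk
  have hg : ∀ j, g (trianglePass ec (j, true)) = n j := inj'.extend_apply n _
  have r : Related ec f g := by
    constructor
    · intro q hq
      refine (Function.extend_apply' n _ q fun ⟨j, hj⟩ => hq ⟨_, hj⟩).trans ?_
      rw [Function.comp_apply, D.exchange_of_notMem ec hq]
    · intro j
      refine (Function.extend_apply' n _ (trianglePass ec (j, false)) fun ⟨k, hk⟩ => by
        simpa using inj hk).trans ?_
      rw [Function.comp_apply, D.exchange_trianglePass ec h.injective]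
      rfl
  have hg0 : g (trianglePass ec (0, true)) = Q.ast (f (trianglePass ec (0, true))) y := hg 0
  have hg1 : g (trianglePass ec (1, true)) = y := hg 1
  have hg2 : g (trianglePass ec (2, true)) = Q.circ (f (.mark (μ 2))) y := hg 2
  have hft := (h.coloringAt_triangle hs f).1 fun k => hf.1 (ec k)
  -- Only the outgoing edges of the old triangle restrict `g`; they are matched by the three
  -- exchange laws.
  have hgt : ∀ k, ColoringAt Q (D.exchanged (ec 0) (ec 1) (ec 2)) g (ec k) := by
    rw [h.coloringAt_exchanged hs, hg0, hg1, hg2, r.eq_exit, r.eq_exit, r.eq_exit,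
      r.eq_of_notMem _ (hm _), r.eq_of_notMem _ (hm _), r.eq_of_notMem _ (hm _)]
    obtain ⟨⟨e1, e2⟩, ⟨e3, e4⟩, e5, e6⟩ := hft
    have key : f (trianglePass ec (1, true)) = Q.circ y (f (trianglePass ec (0, true))) := by
      refine (Q.ast_bijective (f (trianglePass ec (2, false)))).1 ?_
      simp only
      rw [← e6, e1, ← hy, e4, e3, Q.exchange_circ_ast]
    refine ⟨⟨key, rfl⟩, ⟨?_, ?_⟩, rfl, hy.symm⟩
    · rw [e5, e3, key, Q.exchange_circ_circ]
    · rw [e2, e4, ← hy, Q.exchange_ast_ast]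
  refine ⟨g, ⟨r, (h.isColoring_iff_of_related r ⟨fun _ k => hf.1 (ec k), fun _ => hgt⟩).2 hf⟩, ?_⟩
  rintro g' ⟨r', hg'⟩
  have ht' := (h.coloringAt_exchanged hs g').1 fun k => hg'.1 (ec k)
  rw [r'.eq_exit, r'.eq_exit, r'.eq_exit,
      r'.eq_of_notMem _ (hm _), r'.eq_of_notMem _ (hm _), r'.eq_of_notMem _ (hm _)] at ht'
  obtain ⟨⟨e1, e2⟩, ⟨e3, e4⟩, e5, e6⟩ := ht'
  have key : g' (trianglePass ec (1, true)) = y :=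
    (Q.ast_bijective (f (.mark (μ 2)))).1 (e6.symm.trans hy.symm)
  funext q
  by_cases hq : q ∈ Set.range (trianglePass ec)
  · obtain ⟨⟨j, _ | _⟩, rfl⟩ := hq
    · rw [r.eq_exit, r'.eq_exit]
    · rw [hg]
      fin_cases j
      · exact e2.trans (by rw [key]; rfl)
      · exact key
      · exact e5.trans (by rw [key]; rfl)
  · rw [r.eq_of_notMem _ hq, r'.eq_of_notMem _ hq]

/-- The converse: the colours of the incoming edges determine those of the inner edges before the
exchange. -/
theorem existsUnique_related' (hs : ∀ k, D.sign (ec k) = 1) (g : D.Pass → X)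
    (hg : (D.exchanged (ec 0) (ec 1) (ec 2)).IsColoring Q g) :
    ∃! f, Related ec f g ∧ D.IsColoring Q f := by
  have inj := trianglePass_injective (V := D.V) (M := D.M) h.injective
  have hm : ∀ m, (.mark m : D.Pass) ∉ Set.range (trianglePass ec) :=
    fun _ ⟨_, hz⟩ => trianglePass_ne_mark _ _ _ hz
  let T := g (trianglePass ec (0, false))
  let n : Fin 3 → X := ![Q.ast T (g (.mark (μ 2))),
    Q.circ (g (.mark (μ 1))) (Q.ast T (g (.mark (μ 2)))), Q.circ (g (.mark (μ 2))) T]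
  let f : D.Pass → X := Function.extend (fun j => trianglePass ec (j, false)) n
    (g ∘ D.exchange (ec 0) (ec 1) (ec 2))
  have inj' : Function.Injective fun j => (trianglePass ec (j, false) : D.Pass) := by
    intro j k hjk
    simpa using inj hjk
  have hf : ∀ j, f (trianglePass ec (j, false)) = n j := inj'.extend_apply n _
  have r : Related ec f g := by
    constructor
    · intro q hq
      refine ((Function.extend_apply' n _ q fun ⟨j, hj⟩ => hq ⟨_, hj⟩).trans ?_).symm
      rw [Function.comp_apply, D.exchange_of_notMem ec hq]
    · intro j
      refine ((Function.extend_apply' n _ (trianglePass ec (j, true)) fun ⟨k, hk⟩ => by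
        simpa using inj hk).trans ?_).symm
      rw [Function.comp_apply, D.exchange_trianglePass ec h.injective]
      rfl
  have hf0 : f (trianglePass ec (0, false)) = Q.ast T (g (.mark (μ 2))) := hf 0
  have hf1 : f (trianglePass ec (1, false)) =
    Q.circ (g (.mark (μ 1))) (Q.ast T (g (.mark (μ 2)))) := hf 1
  have hf2 : f (trianglePass ec (2, false)) = Q.circ (g (.mark (μ 2))) T := hf 2
  have hgt := (h.coloringAt_exchanged hs g).1 fun k => hg.1 (ec k)
  have hft : ∀ k, ColoringAt Q D f (ec k) := by
    rw [h.coloringAt_triangle hs, hf0, hf1, hf2, ← r.eq_exit, ← r.eq_exit, ← r.eq_exit,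
      ← r.eq_of_notMem _ (hm _), ← r.eq_of_notMem _ (hm _), ← r.eq_of_notMem _ (hm _)]
    obtain ⟨⟨e1, e2⟩, ⟨e3, e4⟩, e5, e6⟩ := hgt
    refine ⟨⟨rfl, ?_⟩, ⟨rfl, rfl⟩, ?_, ?_⟩
    · rw [e4, e2, e5, e6, Q.exchange_ast_ast]
    · rw [e3, e2, e5, e1, Q.exchange_circ_circ]
    · rw [e6, e1, Q.exchange_circ_ast]
  refine ⟨f, ⟨r, (h.isColoring_iff_of_related r ⟨fun _ => hft, fun _ k => hg.1 (ec k)⟩).1 hg⟩, ?_⟩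
  rintro f' ⟨r', hf'⟩
  have ht' := (h.coloringAt_triangle hs f').1 fun k => hf'.1 (ec k)
  rw [← r'.eq_exit, ← r'.eq_exit, ← r'.eq_exit,
      ← r'.eq_of_notMem _ (hm _), ← r'.eq_of_notMem _ (hm _), ← r'.eq_of_notMem _ (hm _)] at ht'
  obtain ⟨⟨e1, e2⟩, ⟨e3, e4⟩, e5, e6⟩ := ht'
  funext q
  by_cases hq : q ∈ Set.range (trianglePass ec)
  · obtain ⟨⟨j, _ | _⟩, rfl⟩ := hq
    · rw [hf]
      fin_cases j
      · exact e4
      · exact e1.trans (by rw [e4]; rfl)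
      · exact e3
    · rw [← r.eq_exit, ← r'.eq_exit]
  · rw [← r.eq_of_notMem _ hq, ← r'.eq_of_notMem _ hq]

end VirtualDiagram.MarkedTriangle

namespace ParityBiquandleBracket

open VirtualDiagram

variable {X : Type*} [Finite X] {Q : Biquandle X} {R : Type*} [CommRing R]
  (β : ParityBiquandleBracket Q R)

/-- Both diagrams arise from the same diagram without the triangle, so that their values differ only
by
the sums over the states of the triangle, which agree by `sum_triangle`. -/
theorem value_eq_of_related {D : VirtualDiagram} {ec : Fin 3 → D.C} {μ : Fin 3 → D.M}
    (h : MarkedTriangle D ec μ) (hs : ∀ k, D.sign (ec k) = 1) (f : D.Coloring Q)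
    (g : (D.exchanged (ec 0) (ec 1) (ec 2)).Coloring Q) (r : MarkedTriangle.Related ec f.1 g.1) :
    β.value (D.exchanged (ec 0) (ec 1) (ec 2)) g = β.value D f := by
  have hm : ∀ m, (.mark m : D.Pass) ∉ Set.range (trianglePass ec) :=
    fun _ ⟨_, hz⟩ => trianglePass_ne_mark _ _ _ hz
  have hp : Function.Injective fun j => (.mark (μ j) : h.base.Pass) := fun j k hjk =>
    h.mark_injective (Passage.mark.inj hjk)
  rw [β.value_eq_sum_glue h.extension hp (triangle false)
      (stateGraph_eq_triangle β.δ h.extension false hp h.extension_inserts h.extension_inserts_nil),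
    β.value_eq_sum_glue h.extension' hp (triangle true)
      (stateGraph_eq_triangle β.δ h.extension' true hp h.extension'_inserts
        h.extension'_inserts_nil)]
  refine congrArg₂ _ rfl (Finset.sum_congr rfl fun s _ => congrArg₂ _ ?_ ?_)
  · refine Finset.prod_congr rfl fun c _ => ?_
    have e := h.leftPair_of_related r c.2
    exact congrArg (fun z : X × X => β.coeff _ (s c) z.1 z.2) e
  · have hg := (h.coloringAt_exchanged hs g.1).1 fun k => g.2.1 (ec k)
    have hf := (h.coloringAt_triangle hs f.1).1 fun k => f.2.1 (ec k)
    obtain ⟨a0, a1, a2⟩ := h.leftPair_triangle hs f.1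
    obtain ⟨b0, b1, b2⟩ := h.leftPair_exchanged hs g.1
    rw [r.eq_exit, r.eq_exit, r.eq_exit,
      r.eq_of_notMem _ (hm _), r.eq_of_notMem _ (hm _), r.eq_of_notMem _ (hm _)] at hg
    rw [r.eq_exit] at b0
    rw [r.eq_of_notMem _ (hm _)] at b2
    obtain ⟨⟨e1, e2⟩, ⟨e3, e4⟩, e5, e6⟩ := hg
    obtain ⟨⟨c1, c2⟩, ⟨c3, c4⟩, c5, c6⟩ := hf
    refine sum_triangle β _ (f.1 (.mark (μ 2))) (g.1 (trianglePass ec (1, true)))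
      (f.1 (trianglePass ec (0, true)))
      (fun c s => β.coeff (D.sign (ec c)) s
        ((D.exchanged (ec 0) (ec 1) (ec 2)).leftPair g.1 (ec c)).1
        ((D.exchanged (ec 0) (ec 1) (ec 2)).leftPair g.1 (ec c)).2)
      (fun c s => β.coeff (D.sign (ec c)) s (D.leftPair f.1 (ec c)).1 (D.leftPair f.1 (ec c)).2)
      ?_ ?_ ?_ ?_ ?_ ?_ <;> funext s <;> simp only [hs]
    · rw [b0]
    · rw [b1, e5, e2]
    · rw [b2]
    · rw [a0, e6, c4]
    · rw [a1]
    · rw [a2, c3, e1]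

/-- Invariance under the third Reidemeister move in which all strands are directed as in a braid,
the crossings are positive, and each strand is preceded by a marked point. -/
theorem multiset_markedTriangle {D : VirtualDiagram} {ec : Fin 3 → D.C} {μ : Fin 3 → D.M}
    (h : MarkedTriangle D ec μ) (hs : ∀ k, D.sign (ec k) = 1) :
    β.multiset D = β.multiset (D.exchanged (ec 0) (ec 1) (ec 2)) := by
  choose φ hφ hφ' using fun f : D.Coloring Q => h.existsUnique_related hs f.1 f.2
  let e : D.Coloring Q ≃ (D.exchanged (ec 0) (ec 1) (ec 2)).Coloring Q :=
    Equiv.ofBijective (fun f => ⟨φ f, (hφ f).2⟩) (by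
      constructor
      · intro f f' hff
        have hff' : φ f = φ f' := congrArg Subtype.val hff
        obtain ⟨u, -, hu⟩ := h.existsUnique_related' hs (φ f) (hφ f).2
        have := hφ f'
        rw [← hff'] at this
        exact Subtype.ext ((hu _ ⟨(hφ f).1, f.2⟩).trans (hu _ ⟨this.1, f'.2⟩).symm)
      · intro g
        obtain ⟨u, hu, -⟩ := h.existsUnique_related' hs g.1 g.2
        exact ⟨⟨u, hu.2⟩, Subtype.ext (hφ' ⟨u, hu.2⟩ _ ⟨hu.1, g.2⟩).symm⟩)
  exact β.multiset_eq_of_equiv e fun f => β.value_eq_of_related h hs f (e f) (hφ f).1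

end ParityBiquandleBracket

namespace VirtualDiagram

/-! ### Insertion of crossings and marked points -/

/-- Passages with prescribed edges can be inserted in a diagram. -/
theorem exists_extension (D : VirtualDiagram) {NC NV NM : Type} [Fintype NC] [Finite NV] [Finite NM]
    (sgn : NC → ℤˣ) (N : Equiv.Perm (D.Pass ⊕ Passage NC NV NM)) :
    ∃ (D' : VirtualDiagram) (E : Extension D D' NC NV NM),
      (∀ c, D'.sign (E.eC (.inr c)) = sgn c) ∧
      ∀ z, D'.next (Sum.elim E.old E.new z) = Sum.elim E.old E.new (N z) := by
  let D₀ : VirtualDiagram :=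
    { C := D.C ⊕ NC, V := D.V ⊕ NV, M := D.M ⊕ NM, sign := Sum.elim D.sign sgn, next := 1 }
  let E₀ : Extension D D₀ NC NV NM :=
    { eC := Equiv.refl _, eV := Equiv.refl _, eM := Equiv.refl _, sign_old := fun _ => rfl }
  refine ⟨{ D₀ with next := E₀.passEquiv.permCongr N }, ⟨Equiv.refl _, Equiv.refl _, Equiv.refl _,
    fun _ => rfl⟩, fun _ => rfl, fun z => ?_⟩
  change E₀.passEquiv (N (E₀.passEquiv.symm (E₀.passEquiv z))) = E₀.passEquiv (N z)
  rw [Equiv.symm_apply_apply]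

theorem exists_subdivision (D : VirtualDiagram) (p : D.Pass) :
    ∃ (D' : VirtualDiagram) (E : Extension D D' Empty Empty Unit),
      E.Inserts p [.mark ()] ∧ ∀ r, r ≠ p → E.Inserts r [] := by
  classical
  obtain ⟨D', E, -, h⟩ := D.exists_extension (NC := Empty) (NV := Empty) (NM := Unit) (fun _ => 1)
    (Equiv.sumCongr D.next (Equiv.refl _) * Equiv.swap (.inl p) (.inr (.mark ())))
  refine ⟨D', E, Extension.inserts_singleton.2 ⟨?_, ?_⟩, fun r hr => Extension.inserts_nil.2 ?_⟩
  · simpa using h (.inl p)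
  · simpa using h (.inr (.mark ()))
  · simpa [Equiv.swap_apply_def, hr] using h (.inl r)

/-- A second Reidemeister move can be applied to any two different edges, with strands of the same
direction if `u` is false and of opposite directions otherwise. -/
theorem exists_clasp (D : VirtualDiagram) {p q : D.Pass} (hpq : p ≠ q) (u : Bool) (sgn : ℤˣ) :
    ∃ (D' : VirtualDiagram) (E : Extension D D' Bool Empty Empty),
      D'.sign (E.eC (.inr false)) = sgn ∧ D'.sign (E.eC (.inr true)) = -sgn ∧
      E.Inserts p [.over false, .over true] ∧ E.Inserts q [.under u, .under !u] ∧
      ∀ r, r ≠ p → r ≠ q → E.Inserts r [] := by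
  classical
  obtain ⟨D', E, hs, h⟩ := D.exists_extension (NC := Bool) (NV := Empty) (NM := Empty)
    (fun i => if i then -sgn else sgn)
    (Equiv.sumCongr D.next (Equiv.refl _) * Equiv.swap (.inl p) (.inr (.over false)) *
      Equiv.swap (.inr (.over false)) (.inr (.over true)) *
      Equiv.swap (.inl q) (.inr (.under u)) *
      Equiv.swap (.inr (.under u)) (.inr (.under !u)))
  refine ⟨D', E, hs false, hs true, Extension.inserts_pair.2 ⟨?_, ?_, ?_⟩,
    Extension.inserts_pair.2 ⟨?_, ?_, ?_⟩, fun r hr hr' => Extension.inserts_nil.2 ?_⟩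
  · simpa [Equiv.swap_apply_def, hpq] using h (.inl p)
  · simpa [Equiv.swap_apply_def] using h (.inr (.over false))
  · simpa [Equiv.swap_apply_def, hpq] using h (.inr (.over true))
  · simpa [Equiv.swap_apply_def, hpq.symm] using h (.inl q)
  · simpa [Equiv.swap_apply_def] using h (.inr (.under u))
  · simpa [Equiv.swap_apply_def, hpq.symm] using h (.inr (.under !u))
  · simpa [Equiv.swap_apply_def, hr, hr'] using h (.inl r)

/-! ### The third Reidemeister moves -/

/-- The sign of the direction of a strand. -/
def directionSign (r : Bool) : ℤˣ := if r then -1 else 1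

/-- The crossings `ec` form a triangle to which a third Reidemeister move applies. The passages
of the strand `j` are consecutive, in the reverse order if `r j` is true. The signs of the crossings
are determined by the directions of their strands and by the sign `ε` which they have if all
strands are directed as in a braid. -/
structure Triangle (D : VirtualDiagram) (ec : Fin 3 → D.C) (ε : ℤˣ) (r : Fin 3 → Bool) :
    Prop where
  injective : Function.Injective ec
  next_first : ∀ j, D.next (trianglePass ec (j, r j)) = trianglePass ec (j, !r j)
  sign_eq : ∀ k, D.sign (ec k) = ε * (directionSign (r (triangleStrand (k, false)).1) *
    directionSign (r (triangleStrand (k, true)).1))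

namespace Triangle

variable {D : VirtualDiagram} {ec : Fin 3 → D.C} {ε : ℤˣ} {r : Fin 3 → Bool}

/-- The inverse of a third Reidemeister move is one in which all strands have the opposite
directions. -/
theorem exchanged (T : Triangle D ec ε r) :
    Triangle (D.exchanged (ec 0) (ec 1) (ec 2)) ec ε (fun j => !r j) where
  injective := T.injective
  next_first j := by
    have h := D.exchanged_next ec (trianglePass ec (j, r j))
    rw [T.next_first, D.exchange_trianglePass ec T.injective,
      D.exchange_trianglePass ec T.injective] at h
    exact h
  sign_eq k := by
    refine (T.sign_eq k).trans ?_
    have : ∀ b, directionSign (!b) = -directionSign b := by decide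
    rw [this, this, neg_mul_neg]

theorem exchanged_exchanged (T : Triangle D ec ε r) :
    (D.exchanged (ec 0) (ec 1) (ec 2)).exchanged (ec 0) (ec 1) (ec 2) = D := by
  have h : (D.exchanged (ec 0) (ec 1) (ec 2)).exchange (ec 0) (ec 1) (ec 2) *
      (D.exchanged (ec 0) (ec 1) (ec 2)).next *
      ((D.exchanged (ec 0) (ec 1) (ec 2)).exchange (ec 0) (ec 1) (ec 2))⁻¹ = D.next := by
    have hσ : D.exchange (ec 0) (ec 1) (ec 2) * D.exchange (ec 0) (ec 1) (ec 2) = 1 :=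
      Equiv.ext (D.exchange_exchange ec T.injective)
    have hσ' : (D.exchange (ec 0) (ec 1) (ec 2))⁻¹ = D.exchange (ec 0) (ec 1) (ec 2) :=
      inv_eq_of_mul_eq_one_left hσ
    change D.exchange (ec 0) (ec 1) (ec 2) * (D.exchange (ec 0) (ec 1) (ec 2) * D.next *
      (D.exchange (ec 0) (ec 1) (ec 2))⁻¹) * (D.exchange (ec 0) (ec 1) (ec 2))⁻¹ = D.next
    rw [hσ', ← mul_assoc, ← mul_assoc, hσ, one_mul, mul_assoc, hσ, mul_one]
  change ({ D with next := _ } : VirtualDiagram) = { D with next := D.next }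
  congr 1

end Triangle

/-- A passage of the triangle in an extended diagram. -/
theorem Extension.trianglePass_old {D D' : VirtualDiagram} {NC NV NM : Type}
    (E : Extension D D' NC NV NM) (ec : Fin 3 → D.C) (z : Fin 3 × Bool) :
    (trianglePass (fun k => E.eC (.inl (ec k))) z : D'.Pass) = E.old (trianglePass ec z) := by
  unfold trianglePass
  split_ifs <;> rfl

theorem Triangle.extension {D D' : VirtualDiagram} {ec : Fin 3 → D.C} {ε : ℤˣ} {r : Fin 3 → Bool}
    (T : Triangle D ec ε r) {NC NV NM : Type} (E : Extension D D' NC NV NM)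
    (h : ∀ j, E.Inserts (trianglePass ec (j, r j)) []) :
    Triangle D' (fun k => E.eC (.inl (ec k))) ε r where
  injective k l hkl := T.injective (by simpa using hkl)
  next_first j := by
    rw [E.trianglePass_old, E.trianglePass_old, Extension.inserts_nil.1 (h j), T.next_first]
  sign_eq k := by rw [E.sign_old, T.sign_eq]

theorem Extension.exchange_old {D D' : VirtualDiagram} {NC NV NM : Type}
    (E : Extension D D' NC NV NM) {ec : Fin 3 → D.C} (hec : Function.Injective ec) (q : D.Pass) :
    D'.exchange (E.eC (.inl (ec 0))) (E.eC (.inl (ec 1))) (E.eC (.inl (ec 2))) (E.old q) =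
      E.old (D.exchange (ec 0) (ec 1) (ec 2) q) := by
  have hec' : Function.Injective fun k => E.eC (.inl (ec k)) :=
    fun k l hkl => hec (by simpa using hkl)
  by_cases hq : q ∈ Set.range (trianglePass ec)
  · obtain ⟨z, rfl⟩ := hq
    rw [D.exchange_trianglePass ec hec, ← E.trianglePass_old, ← E.trianglePass_old]
    exact D'.exchange_trianglePass _ hec' z
  · rw [D.exchange_of_notMem ec hq]
    refine D'.exchange_of_notMem (fun k => E.eC (.inl (ec k))) ?_
    rintro ⟨z, hz⟩
    rw [E.trianglePass_old] at hz
    exact hq ⟨z, E.old_injective hz⟩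

theorem Extension.exchange_new {D D' : VirtualDiagram} {NC NV NM : Type}
    (E : Extension D D' NC NV NM) (ec : Fin 3 → D.C) (a : Passage NC NV NM) :
    D'.exchange (E.eC (.inl (ec 0))) (E.eC (.inl (ec 1))) (E.eC (.inl (ec 2))) (E.new a) =
      E.new a := by
  refine D'.exchange_of_notMem (fun k => E.eC (.inl (ec k))) ?_
  rintro ⟨z, hz⟩
  rw [E.trianglePass_old] at hz
  exact E.old_ne_new _ _ hz

end VirtualDiagram

namespace ParityBiquandleBracket

open VirtualDiagram

variable {X : Type*} [Finite X] {Q : Biquandle X} {R : Type*} [CommRing R]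
  (β : ParityBiquandleBracket Q R)

/-- A third Reidemeister move may be studied after the subdivision of an edge. -/
theorem multiset_exchanged_of_subdivision {D D' : VirtualDiagram} {ec : Fin 3 → D.C}
    (hec : Function.Injective ec) (E : Extension D D' Empty Empty Unit) {p : D.Pass}
    (hp : E.Inserts p [.mark ()]) (h_rest : ∀ r, r ≠ p → E.Inserts r [])
    (h : β.multiset D' = β.multiset
      (D'.exchanged (E.eC (.inl (ec 0))) (E.eC (.inl (ec 1))) (E.eC (.inl (ec 2))))) :
    β.multiset D = β.multiset (D.exchanged (ec 0) (ec 1) (ec 2)) := by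
  let σ := D.exchange (ec 0) (ec 1) (ec 2)
  have hσ : ∀ q, σ (σ q) = q := D.exchange_exchange ec hec
  let E' : Extension (D.exchanged (ec 0) (ec 1) (ec 2))
      (D'.exchanged (E.eC (.inl (ec 0))) (E.eC (.inl (ec 1))) (E.eC (.inl (ec 2))))
      Empty Empty Unit := ⟨E.eC, E.eV, E.eM, E.sign_old⟩
  have next' : ∀ q a, D.next (σ q) = a → (D.exchanged (ec 0) (ec 1) (ec 2)).next q = σ a := by
    intro q a ha
    have := D.exchanged_next ec (σ q)
    rwa [hσ, ha] at this
  have old : ∀ q, E'.old q = E.old q := fun _ => rfl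
  have new : ∀ q, E'.new q = E.new q := fun _ => rfl
  -- The exchange does not affect the new marked point, so it commutes with the subdivision.
  have next_old : ∀ q, (D'.exchanged (E.eC (.inl (ec 0))) (E.eC (.inl (ec 1)))
      (E.eC (.inl (ec 2)))).next (E'.old (σ q)) =
      D'.exchange (E.eC (.inl (ec 0))) (E.eC (.inl (ec 1))) (E.eC (.inl (ec 2)))
        (D'.next (E.old q)) := by
    intro q
    rw [old, ← E.exchange_old hec]
    exact D'.exchanged_next (fun k => E.eC (.inl (ec k))) (E.old q)
  have next_new : ∀ a, (D'.exchanged (E.eC (.inl (ec 0))) (E.eC (.inl (ec 1)))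
      (E.eC (.inl (ec 2)))).next (E'.new a) =
      D'.exchange (E.eC (.inl (ec 0))) (E.eC (.inl (ec 1))) (E.eC (.inl (ec 2)))
        (D'.next (E.new a)) := by
    intro a
    have := D'.exchanged_next (fun k => E.eC (.inl (ec k))) (E.new a)
    rwa [E.exchange_new ec] at this
  rw [β.multiset_subdivide E p hp h_rest, h]
  refine (β.multiset_subdivide E' (σ p) ?_ fun r hr => ?_).symm
  · obtain ⟨h1, h2⟩ := Extension.inserts_singleton.1 hp
    refine Extension.inserts_singleton.2 ⟨?_, ?_⟩
    · rw [next_old, h1, E.exchange_new]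
      rfl
    · rw [next_new, h2, E.exchange_old hec, next' (σ p) (D.next p) (by rw [hσ])]
      rfl
  · obtain ⟨r, rfl⟩ : ∃ r', σ r' = r := ⟨σ r, hσ r⟩
    have h1 := Extension.inserts_nil.1 (h_rest r fun e => hr (by rw [e]))
    refine Extension.inserts_nil.2 ?_
    rw [next_old, h1, E.exchange_old hec, next' (σ r) (D.next r) (by rw [hσ])]
    rfl

end ParityBiquandleBracket

/-! ### Third Reidemeister moves and clasps -/

namespace VirtualDiagram

theorem trianglePassage_triangleStrand : ∀ z, trianglePassage (triangleStrand z) = z := by decide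

theorem triangleStrand_trianglePassage : ∀ z, triangleStrand (trianglePassage z) = z := by decide

theorem trianglePass_triangleStrand_over {C V M : Type} (ec : Fin 3 → C) (k : Fin 3) :
    (trianglePass ec (triangleStrand (k, false)) : Passage C V M) = .over (ec k) := by
  simp [trianglePass, trianglePassage_triangleStrand]

theorem trianglePass_triangleStrand_under {C V M : Type} (ec : Fin 3 → C) (k : Fin 3) :
    (trianglePass ec (triangleStrand (k, true)) : Passage C V M) = .under (ec k) := by
  simp [trianglePass, trianglePassage_triangleStrand]

/-- The passages of a triangle after the replacement of the crossing `k`. -/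
theorem trianglePass_update {C V M : Type} (ec : Fin 3 → C) (k : Fin 3) (c : C) (z : Fin 3 × Bool) :
    (trianglePass (Function.update ec k c) z : Passage C V M) =
      if z = triangleStrand (k, false) then .over c
      else if z = triangleStrand (k, true) then .under c else trianglePass ec z := by
  split_ifs with h1 h2
  · rw [h1, trianglePass_triangleStrand_over, Function.update_self]
  · rw [h2, trianglePass_triangleStrand_under, Function.update_self]
  · have hz : (trianglePassage z).1 ≠ k := by
      intro hz
      have := triangleStrand_trianglePassage z
      rcases hp : trianglePassage z with ⟨l, _ | _⟩ <;> rw [hp] at hz this <;> subst hz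
      exacts [h1 this.symm, h2 this.symm]
    unfold trianglePass
    rw [Function.update_of_ne hz]

/-- The directions of the strands when the two strands of the crossing `k` are reversed. -/
def reversed (r : Fin 3 → Bool) (k j : Fin 3) : Bool :=
  if j = (triangleStrand (k, false)).1 ∨ j = (triangleStrand (k, true)).1 then !r j else r j

/-- Reversing the two strands of the crossing `k` changes the signs of the other two crossings. -/
theorem directionSign_reversed : ∀ (k l : Fin 3) (r : Fin 3 → Bool),
    directionSign (reversed r k (triangleStrand (l, false)).1) *
      directionSign (reversed r k (triangleStrand (l, true)).1) =
    (if l = k then 1 else -1) * (directionSign (r (triangleStrand (l, false)).1) *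
      directionSign (r (triangleStrand (l, true)).1)) := by
  decide

end VirtualDiagram

namespace ParityBiquandleBracket

open VirtualDiagram

variable {X : Type*} [Finite X] {Q : Biquandle X} {R : Type*} [CommRing R]
  (β : ParityBiquandleBracket Q R)

/-- All third Reidemeister moves with the sign `ε` and the directions `r` preserve the multiset. -/
def Invariant (ε : ℤˣ) (r : Fin 3 → Bool) : Prop :=
  ∀ (D : VirtualDiagram) (ec : Fin 3 → D.C), Triangle D ec ε r →
    β.multiset D = β.multiset (D.exchanged (ec 0) (ec 1) (ec 2))

theorem Invariant.inverse {ε : ℤˣ} {r : Fin 3 → Bool} (h : β.Invariant ε r) :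
    β.Invariant ε fun j => !r j := by
  intro D ec T
  have T' := T.exchanged
  simp only [Bool.not_not] at T'
  have := h (D.exchanged (ec 0) (ec 1) (ec 2)) ec T'
  rw [T.exchanged_exchanged] at this
  exact this.symm

end ParityBiquandleBracket

namespace VirtualDiagram

theorem straight_triangleStrand_ne : ∀ k, straight (triangleStrand (k, false)) ≠ triangleStrand (k,
    false) ∧
    straight (triangleStrand (k, false)) ≠ triangleStrand (k, true) ∧
    straight (triangleStrand (k, true)) ≠ triangleStrand (k, false) ∧
    straight (triangleStrand (k, true)) ≠ triangleStrand (k, true) ∧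
    (triangleStrand (k, false)).1 ≠ (triangleStrand (k, true)).1 := by decide

/-- The two strands of the crossing `k` of a triangle, the upper of which passes this crossing
first, run through a second Reidemeister move beyond the triangle. The under-strand passes the
crossing `k` first if `u` is false. Each of the two strands leaves the triangle for a marked
point. -/
structure Clasped {D D' : VirtualDiagram} (ec : Fin 3 → D.C) (r : Fin 3 → Bool) (k : Fin 3)
    (E : Extension D D' Bool Empty Empty) (u : Bool) (q : D.Pass) : Prop where
  over_first : r (triangleStrand (k, false)).1 = (triangleStrand (k, false)).2
  under_first : r (triangleStrand (k, true)).1 = xor u (triangleStrand (k, true)).2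
  next_over : ∃ m, D.next (trianglePass ec (straight (triangleStrand (k, false)))) = .mark m
  next_under : ∃ m, D.next (trianglePass ec ((triangleStrand (k, true)).1,
    !r (triangleStrand (k, true)).1)) = .mark m
  sign_false : D'.sign (E.eC (.inr false)) = -D.sign (ec k)
  sign_true : D'.sign (E.eC (.inr true)) = D.sign (ec k)
  insert_over : E.Inserts (trianglePass ec (straight (triangleStrand (k, false))))
    [.over false, .over true]
  insert_under : E.Inserts q [.under u, .under !u]
  edge : if u then D.next q = trianglePass ec (straight (triangleStrand (k, true)))
    else q = trianglePass ec (straight (triangleStrand (k, true)))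
  rest : ∀ p, p ≠ trianglePass ec (straight (triangleStrand (k, false))) → p ≠ q → E.Inserts p []

namespace Clasped

variable {D D' : VirtualDiagram} {ec : Fin 3 → D.C} {ε : ℤˣ} {r : Fin 3 → Bool} {k : Fin 3}
  {E : Extension D D' Bool Empty Empty} {u : Bool} {q : D.Pass}

/-- The crossings of the new triangle. -/
def crossings (E : Extension D D' Bool Empty Empty) (ec : Fin 3 → D.C) (k : Fin 3) : Fin 3 → D'.C :=
  Function.update (fun l => E.eC (.inl (ec l))) k (E.eC (.inr false))

theorem trianglePass_crossings (z : Fin 3 × Bool) :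
    (trianglePass (crossings E ec k) z : D'.Pass) =
      if z = triangleStrand (k, false) then E.new (.over false)
      else if z = triangleStrand (k, true) then E.new (.under false)
      else E.old (trianglePass ec z) := by
  rw [crossings, trianglePass_update, E.trianglePass_old]
  rfl

/-- The first new crossing of the second Reidemeister move forms a triangle with the two crossings
other
than `k`, on the other side of `k`. Its strands through the new crossing have the opposite
directions. -/
theorem triangle (T : Triangle D ec ε r) (h : Clasped ec r k E u q) :
    Triangle D' (crossings E ec k) (-ε) (reversed r k) where
  injective := by
    have : Function.Injective fun l => E.eC (.inl (ec l)) :=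
      fun l l' hl => T.injective (by simpa using hl)
    intro l l' hl
    unfold crossings at hl
    by_cases h1 : l = k <;> by_cases h2 : l' = k
    · rw [h1, h2]
    · subst h1
      rw [Function.update_self, Function.update_of_ne h2] at hl
      simp at hl
    · subst h2
      rw [Function.update_self, Function.update_of_ne h1] at hl
      simp at hl
    · rw [Function.update_of_ne h1, Function.update_of_ne h2] at hl
      exact this hl
  next_first j := by
    have inj := trianglePass_injective (V := D.V) (M := D.M) T.injective
    obtain ⟨o1, o2, o3⟩ := Extension.inserts_pair.1 h.insert_over
    obtain ⟨u1, u2, u3⟩ := Extension.inserts_pair.1 h.insert_under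
    obtain ⟨n1, n2, n3, n4, n5⟩ := straight_triangleStrand_ne k
    rw [trianglePass_crossings, trianglePass_crossings]
    have over_first := h.over_first
    have under_first := h.under_first
    have edge := h.edge
    have rest := h.rest (trianglePass ec (j, r j))
    have first := T.next_first j
    unfold reversed
    generalize triangleStrand (k, false) = z₁ at *
    generalize triangleStrand (k, true) = z₂ at *
    obtain ⟨j₁, i₁⟩ := z₁
    obtain ⟨j₂, i₂⟩ := z₂
    simp only [straight] at *
    by_cases hj₁ : j = j₁
    · subst hj₁
      simp only [true_or, if_true, over_first, Bool.not_not]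
      rw [if_neg n1, if_neg n2]
      exact o1
    · by_cases hj₂ : j = j₂
      · subst hj₂
        simp only [or_true, if_true, under_first, Bool.not_not]
        cases u
        · simp only [Bool.false_xor, Bool.false_eq_true, if_false] at edge ⊢
          rw [if_neg n3, if_neg n4, if_neg (by simp [hj₁]), if_pos trivial, ← edge]
          exact u1
        · simp only [Bool.true_xor, if_true, Bool.not_not, Bool.not_true] at edge u3 ⊢
          rw [if_neg n3, if_neg n4, if_neg (by simp [hj₁]), ← edge]
          exact u3
      · simp only [Prod.mk.injEq, hj₁, hj₂, false_and, if_false, or_self]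
        rw [← first]
        refine Extension.inserts_nil.1 (rest (fun e => hj₁ ?_) fun e => hj₂ ?_)
        · simpa using congrArg Prod.fst (inj e)
        · cases u
          · simp only [Bool.false_eq_true, if_false] at edge
            simpa using congrArg Prod.fst (inj (e.trans edge))
          · simp only [if_true] at edge
            rw [← e, first] at edge
            simpa using congrArg Prod.fst (inj edge)
  sign_eq l := by
    rw [directionSign_reversed, crossings]
    by_cases hl : l = k
    · subst hl
      rw [Function.update_self, h.sign_false, T.sign_eq, if_pos rfl, one_mul, neg_mul]
    · rw [Function.update_of_ne hl, E.sign_old, T.sign_eq, if_neg hl, neg_one_mul, neg_mul_neg]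

open Classical in
/-- After the third Reidemeister move, the crossing `k` and the first new crossing can be removed
by a second Reidemeister move, and the second new crossing takes the place of `k`. -/
noncomputable def removal (E : Extension D D' Bool Empty Empty) (ec : Fin 3 → D.C) (k : Fin 3)
    (h : D'.sign (E.eC (.inr true)) = D.sign (ec k)) :
    Extension (D.exchanged (ec 0) (ec 1) (ec 2))
      (D'.exchanged (crossings E ec k 0) (crossings E ec k 1) (crossings E ec k 2))
      Bool Empty Empty where
  eC := (Equiv.swap (.inl (ec k)) (.inr false) * Equiv.swap (.inl (ec k)) (.inr true) :
    Equiv.Perm (D.C ⊕ Bool)).trans E.eC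
  eV := E.eV
  eM := E.eM
  sign_old c := by
    by_cases hc : c = ec k
    · subst hc
      simpa [Equiv.swap_apply_def] using h
    · simpa [Equiv.swap_apply_def, hc] using E.sign_old c

variable (hs : D'.sign (E.eC (.inr true)) = D.sign (ec k))

theorem removal_old_over : (removal E ec k hs).old (.over (ec k)) = E.new (.over true) := by
  simp [removal, Extension.old, Extension.new, Passage.map, Equiv.swap_apply_def]

theorem removal_old_under : (removal E ec k hs).old (.under (ec k)) = E.new (.under true) := by
  simp [removal, Extension.old, Extension.new, Passage.map, Equiv.swap_apply_def]

theorem removal_old {p : D.Pass} (h1 : p ≠ .over (ec k)) (h2 : p ≠ .under (ec k)) :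
    (removal E ec k hs).old p = E.old p := by
  rcases p with c | c | ⟨v, i⟩ | m
  · have hc : c ≠ ec k := fun e => h1 (by rw [e])
    simp [removal, Extension.old, Passage.map, Equiv.swap_apply_def, hc]
  · have hc : c ≠ ec k := fun e => h2 (by rw [e])
    simp [removal, Extension.old, Passage.map, Equiv.swap_apply_def, hc]
  · rfl
  · rfl

theorem removal_new :
    (removal E ec k hs).new (.over false) = E.old (.over (ec k)) ∧
    (removal E ec k hs).new (.under false) = E.old (.under (ec k)) ∧
    (removal E ec k hs).new (.over true) = E.new (.over false) ∧
    (removal E ec k hs).new (.under true) = E.new (.under false) := by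
  simp [removal, Extension.old, Extension.new, Passage.map, Equiv.swap_apply_def]

end Clasped

end VirtualDiagram

namespace ParityBiquandleBracket

open VirtualDiagram

variable {X : Type*} [Finite X] {Q : Biquandle X} {R : Type*} [CommRing R]
  (β : ParityBiquandleBracket Q R)

/-- If the two strands of a crossing of a triangle run through a second Reidemeister move beyond the
triangle, then the third Reidemeister move at the triangle is replaced by one at the triangle which
contains the first crossing of this second Reidemeister move. -/
theorem multiset_exchanged_of_clasped {D D' : VirtualDiagram} {ec : Fin 3 → D.C} {ε : ℤˣ}
    {r : Fin 3 → Bool} {k : Fin 3} {E : Extension D D' Bool Empty Empty} {u : Bool} {q : D.Pass}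
    (T : Triangle D ec ε r) (h : Clasped ec r k E u q) :
    β.multiset (D.exchanged (ec 0) (ec 1) (ec 2)) =
      β.multiset (D'.exchanged (Clasped.crossings E ec k 0) (Clasped.crossings E ec k 1)
        (Clasped.crossings E ec k 2)) := by
  classical
  have inj := trianglePass_injective (V := D.V) (M := D.M) T.injective
  have T' := h.triangle T
  obtain ⟨o1, o2, o3⟩ := Extension.inserts_pair.1 h.insert_over
  obtain ⟨u1, u2, u3⟩ := Extension.inserts_pair.1 h.insert_under
  obtain ⟨n1, n2, n3, n4, n5⟩ := straight_triangleStrand_ne k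
  have n6 : triangleStrand (k, false) ≠ triangleStrand (k, true) := fun e => n5 (by rw [e])
  have n7 : straight (triangleStrand (k, false)) ≠ straight (triangleStrand (k, true)) :=
    fun e => n5 (by simpa [straight] using congrArg Prod.fst e)
  have ho : (trianglePass ec (triangleStrand (k, false)) : D.Pass) = .over (ec k) :=
    trianglePass_triangleStrand_over ec k
  have hu : (trianglePass ec (triangleStrand (k, true)) : D.Pass) = .under (ec k) :=
    trianglePass_triangleStrand_under ec k
  have hc := fun z => Clasped.trianglePass_crossings (E := E) (ec := ec) (k := k) z
  let W := Clasped.removal E ec k h.sign_true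
  have W1 : W.old (.over (ec k)) = E.new (.over true) := Clasped.removal_old_over h.sign_true
  have W2 : W.old (.under (ec k)) = E.new (.under true) := Clasped.removal_old_under h.sign_true
  have W3 : ∀ {p : D.Pass}, p ≠ .over (ec k) → p ≠ .under (ec k) → W.old p = E.old p :=
    fun h1 h2 => Clasped.removal_old h.sign_true h1 h2
  obtain ⟨W4, W5, W6, W7⟩ := Clasped.removal_new (E := E) (ec := ec) (k := k) h.sign_true
  have sign : D'.sign (W.eC (.inr true)) = -D'.sign (W.eC (.inr false)) := by
    have w1 : W.eC (.inr true) = E.eC (.inr false) := by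
      simp [W, Clasped.removal]
    have w2 : W.eC (.inr false) = E.eC (.inl (ec k)) := by
      simp [W, Clasped.removal, Equiv.swap_apply_def]
    rw [w1, w2, E.sign_old, h.sign_false]
  have hf₁ := T.next_first (triangleStrand (k, false)).1
  have hf₂ := T.next_first (triangleStrand (k, true)).1
  rw [h.over_first] at hf₁
  rw [h.under_first] at hf₂
  have next_over := h.next_over
  have next_under := h.next_under
  rw [h.under_first] at next_under
  have edge := h.edge
  have rest := h.rest
  let σ := D.exchange (ec 0) (ec 1) (ec 2)
  let σ' := D'.exchange (Clasped.crossings E ec k 0) (Clasped.crossings E ec k 1)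
    (Clasped.crossings E ec k 2)
  have hσ : ∀ z, σ (trianglePass ec z) = trianglePass ec (straight z) :=
    D.exchange_trianglePass ec T.injective
  have hσ' : ∀ z, σ' (trianglePass (Clasped.crossings E ec k) z) =
      trianglePass (Clasped.crossings E ec k) (straight z) :=
    D'.exchange_trianglePass _ T'.injective
  have out : ∀ {x}, x ∉ Set.range (trianglePass ec) → σ x = x :=
    fun hx => D.exchange_of_notMem _ hx
  have out' : ∀ {x}, x ∉ Set.range (trianglePass (Clasped.crossings E ec k)) → σ' x = x :=
    fun hx => D'.exchange_of_notMem _ hx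
  have next : ∀ x, (D.exchanged (ec 0) (ec 1) (ec 2)).next (σ x) = σ (D.next x) :=
    D.exchanged_next ec
  have next' : ∀ x, (D'.exchanged (Clasped.crossings E ec k 0) (Clasped.crossings E ec k 1)
      (Clasped.crossings E ec k 2)).next (σ' x) = σ' (D'.next x) :=
    D'.exchanged_next (Clasped.crossings E ec k)
  have nz : ∀ z z' : Fin 3 × Bool, straight z = z' ↔ z = straight z' := by decide
  have ss : ∀ z : Fin 3 × Bool, straight (straight z) = z := by decide
  generalize triangleStrand (k, false) = z₁ at *
  generalize triangleStrand (k, true) = z₂ at *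
  -- The exchange of passages in the two triangles.
  have e1 : σ' (E.new (.over false)) = E.old (trianglePass ec (straight z₁)) := by
    have := hσ' z₁
    rwa [hc, hc, if_pos rfl, if_neg n1, if_neg n2] at this
  have e2 : σ' (E.old (trianglePass ec (straight z₁))) = E.new (.over false) := by
    have := hσ' (straight z₁)
    rwa [hc, hc, ss, if_pos rfl, if_neg n1, if_neg n2] at this
  have e3 : σ' (E.new (.under false)) = E.old (trianglePass ec (straight z₂)) := by
    have := hσ' z₂
    rwa [hc, hc, if_neg n6.symm, if_pos rfl, if_neg n3, if_neg n4] at this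
  have e4 : σ' (E.old (trianglePass ec (straight z₂))) = E.new (.under false) := by
    have := hσ' (straight z₂)
    rwa [hc, hc, ss, if_neg n3, if_neg n4, if_neg n6.symm, if_pos rfl] at this
  have e5 : ∀ b, σ' (E.new b) = if b = .over false then E.old (trianglePass ec (straight z₁))
      else if b = .under false then E.old (trianglePass ec (straight z₂)) else E.new b := by
    intro b
    split_ifs with hb1 hb2
    · rw [hb1, e1]
    · rw [hb2, e3]
    · refine out' ?_
      rintro ⟨z, hz⟩
      rw [hc] at hz
      split_ifs at hz
      · exact hb1 (E.new_injective hz).symm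
      · exact hb2 (E.new_injective hz).symm
      · exact E.old_ne_new _ _ hz
  have e6 : ∀ z, z = z₁ ∨ z = z₂ → σ' (E.old (trianglePass ec z)) = E.old (trianglePass ec z) := by
    intro z hz
    refine out' ?_
    rintro ⟨y, hy⟩
    rw [hc] at hy
    split_ifs at hy with hy1 hy2
    · exact E.old_ne_new _ _ hy.symm
    · exact E.old_ne_new _ _ hy.symm
    · rw [inj (E.old_injective hy)] at hy1 hy2
      tauto
  have e7 : ∀ x, x ≠ trianglePass ec z₁ → x ≠ trianglePass ec z₂ →
      x ≠ trianglePass ec (straight z₁) → x ≠ trianglePass ec (straight z₂) →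
      W.old (σ x) = σ' (E.old x) := by
    intro x h1 h2 h3 h4
    by_cases hx : x ∈ Set.range (trianglePass ec)
    · obtain ⟨z, rfl⟩ := hx
      have h1 : z ≠ z₁ := fun e => h1 (by rw [e])
      have h2 : z ≠ z₂ := fun e => h2 (by rw [e])
      have h3 : straight z ≠ z₁ := fun e => h3 (by rw [(nz _ _).1 e])
      have h4 : straight z ≠ z₂ := fun e => h4 (by rw [(nz _ _).1 e])
      have := hσ' z
      rw [hc, hc, if_neg h1, if_neg h2, if_neg h3, if_neg h4] at this
      rw [this, hσ, W3]
      · rw [← ho]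
        exact fun e => h3 (inj e)
      · rw [← hu]
        exact fun e => h4 (inj e)
    · rw [out hx, out' ?_, W3]
      · rwa [← ho]
      · rwa [← hu]
      · rintro ⟨y, hy⟩
        rw [hc] at hy
        split_ifs at hy with hy1 hy2
        · exact E.old_ne_new _ _ hy.symm
        · exact E.old_ne_new _ _ hy.symm
        · exact hx ⟨_, E.old_injective hy⟩
  rw [← ho] at W1 W4
  rw [← hu] at W2 W5
  have d1 := inj.ne n1
  have d2 := inj.ne n2
  have d3 := inj.ne n3
  have d4 := inj.ne n4
  have d5 := inj.ne n6
  have d6 := inj.ne n7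
  have s1 := hσ z₁
  have s2 := hσ z₂
  have s3 : σ (trianglePass ec (straight z₁)) = trianglePass ec z₁ := by rw [hσ, ss]
  have s4 : σ (trianglePass ec (straight z₂)) = trianglePass ec z₂ := by rw [hσ, ss]
  have s5 := e6 z₁ (.inl rfl)
  have s6 := e6 z₂ (.inr rfl)
  have W8 : W.old (trianglePass ec (straight z₁)) = E.old (trianglePass ec (straight z₁)) :=
    W3 (by rwa [← ho]) (by rwa [← hu])
  have W9 : W.old (trianglePass ec (straight z₂)) = E.old (trianglePass ec (straight z₂)) :=
    W3 (by rwa [← ho]) (by rwa [← hu])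
  rw [show (trianglePass ec (z₁.1, z₁.2) : D.Pass) = trianglePass ec z₁ from rfl,
    show (trianglePass ec (z₁.1, !z₁.2) : D.Pass) = trianglePass ec (straight z₁) from rfl] at hf₁
  have hf₂' : if u then D.next (trianglePass ec (straight z₂)) = trianglePass ec z₂
      else D.next (trianglePass ec z₂) = trianglePass ec (straight z₂) := by
    cases u
    · simpa [straight] using hf₂
    · simpa [straight] using hf₂
  have next_under' : ∃ m, D.next (if u then trianglePass ec z₂ else trianglePass ec (straight z₂)) =
      .mark m := by
    cases u
    · simpa [straight] using next_under
    · simpa [straight] using next_under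
  have mark₁ := fun z m => trianglePass_ne_mark (V := D.V) (M := D.M) ec z m
  have a1 := mark₁ z₁
  have a2 := mark₁ z₂
  have a3 := mark₁ (straight z₁)
  have a4 := mark₁ (straight z₂)
  clear mark₁ e6 hσ hσ' hc inj hf₂ next_under out out' ho hu ss nz W3
  generalize trianglePass ec z₁ = o at *
  generalize trianglePass ec z₂ = n at *
  generalize trianglePass ec (straight z₁) = o' at *
  generalize trianglePass ec (straight z₂) = n' at *
  obtain ⟨m₁, hm₁⟩ := next_over
  obtain ⟨m₂, hm₂⟩ := next_under'
  -- The passages of the larger diagram which replace those of the smaller one.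
  let ρ : D.Pass → D'.Pass := fun x => if x = o then E.new (.over false) else
    if x = n then E.new (.under false) else if x = o' then E.new (.over true) else
    if x = n' then E.new (.under true) else E.old x
  have ρ1 : ρ o = E.new (.over false) := if_pos rfl
  have ρ2 : ρ n = E.new (.under false) := by simp [ρ, d5.symm]
  have ρ3 : ρ o' = E.new (.over true) := by simp [ρ, d1, d2]
  have ρ4 : ρ n' = E.new (.under true) := by simp [ρ, d3, d4, d6.symm]
  have ρ5 : ∀ x, x ≠ o → x ≠ n → x ≠ o' → x ≠ n' → ρ x = E.old x := by
    intro x h1 h2 h3 h4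
    simp [ρ, h1, h2, h3, h4]
  have hρ : ∀ x, W.old (σ x) = σ' (ρ x) := by
    intro x
    by_cases h1 : x = o
    · rw [h1, s1, W8, ρ1, e1]
    by_cases h2 : x = n
    · rw [h2, s2, W9, ρ2, e3]
    by_cases h3 : x = o'
    · rw [h3, s3, W1, ρ3, e5]
      simp
    by_cases h4 : x = n'
    · rw [h4, s4, W2, ρ4, e5]
      simp
    rw [ρ5 x h1 h2 h3 h4, e7 x h1 h2 h3 h4]
  have nil : ∀ x, D'.next (ρ x) = ρ (D.next x) → W.Inserts (σ x) [] := by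
    intro x hx
    rw [Extension.inserts_nil, hρ, next', hx, next, hρ]
  have surj : ∀ y, ∃ x, σ x = y := σ.surjective
  have e5₁ : σ' (E.new (.over true)) = E.new (.over true) := by simp [e5]
  have e5₂ : σ' (E.new (.under true)) = E.new (.under true) := by simp [e5]
  obtain ⟨p, hp⟩ := D.next.surjective o
  have p1 : p ≠ o := fun e => d1 (hf₁.symm.trans (e ▸ hp))
  have p3 : p ≠ o' := fun e => a1 m₁ (by rw [← hp, e, hm₁])
  have gen : ∀ x, x ≠ o' → x ≠ q → D'.next (E.old x) = E.old (D.next x) :=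
    fun x h1 h2 => Extension.inserts_nil.1 (rest x h1 h2)
  have inserts_over : p ≠ n → p ≠ n' → p ≠ q → o ≠ q → W.Inserts (σ p) [.over false, .over true] :=
      by
    intro h1 h2 h3 h4
    refine Extension.inserts_pair.2 ⟨?_, ?_, ?_⟩
    · rw [hρ, next', ρ5 p p1 h1 p3 h2, gen p p3 h3, hp, s5]
      exact W4.symm
    · rw [W4, ← s5, next', gen o d1.symm h4, hf₁, e2]
      exact W6.symm
    · rw [W6, ← e2, next', o1, e1, next, hp, s1, W8]
  have case_over : D'.next (ρ o) = ρ (D.next o) := by rw [ρ1, hf₁, ρ3, o2]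
  have case_over' : D'.next (ρ o') = ρ (D.next o') := by
    rw [ρ3, o3, hm₁, ρ5 _ (a1 _).symm (a2 _).symm (a3 _).symm (a4 _).symm]
  cases u
  · -- The under-strand passes the crossing first.
    simp only [Bool.false_eq_true, if_false, Bool.not_false] at *
    subst edge
    obtain ⟨y, hy⟩ := D.next.surjective n
    have y2 : y ≠ n := fun e => d4 (hf₂'.symm.trans (e ▸ hy))
    have y4 : y ≠ q := fun e => a2 m₂ (by rw [← hy, e, hm₂])
    have y1 : y ≠ o := fun e => d2 (by rw [← hf₁, ← e, hy])
    have y3 : y ≠ o' := fun e => a2 m₁ (by rw [← hy, e, hm₁])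
    have p2 : p ≠ n := fun e => d3 (by rw [← hf₂', ← e, hp])
    have p4 : p ≠ q := fun e => a1 m₂ (by rw [← hp, e, hm₂])
    refine β.multiset_reidemeister2 W (σ p) (σ y) ?_ ?_ (inserts_over p2 p4 p4 d3.symm) (.inl ?_) ?_
    · exact fun e => d5 (by rw [← hp, ← hy, σ.injective e])
    · exact sign
    · refine Extension.inserts_pair.2 ⟨?_, ?_, ?_⟩
      · rw [hρ, next', ρ5 y y1 y2 y3 y4, gen y y3 y4, hy, s6]
        exact W5.symm
      · rw [W5, ← s6, next', gen n d2.symm d4.symm, hf₂', e4]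
        exact W7.symm
      · rw [W7, ← e4, next', u1, e3, next, hy, s2, W9]
    · intro z hz1 hz2
      obtain ⟨x, rfl⟩ := surj z
      refine nil x ?_
      by_cases x1 : x = o
      · rw [x1, case_over]
      by_cases x2 : x = n
      · rw [x2, hf₂', ρ2, ρ4, u2]
      by_cases x3 : x = o'
      · rw [x3, case_over']
      by_cases x4 : x = q
      · rw [x4, ρ4, hm₂, u3, hm₂, ρ5 _ (a1 _).symm (a2 _).symm (a3 _).symm (a4 _).symm]
      rw [ρ5 x x1 x2 x3 x4, gen x x3 x4, ρ5]
      · exact fun e => hz1 (by rw [D.next.injective (e.trans hp.symm)])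
      · exact fun e => hz2 (by rw [D.next.injective (e.trans hy.symm)])
      · exact fun e => x1 (D.next.injective (e.trans hf₁.symm))
      · exact fun e => x2 (D.next.injective (e.trans hf₂'.symm))
  · -- The under-strand passes the crossing last.
    simp only [if_true, Bool.not_true] at *
    have p2 : p ≠ n := fun e => a1 m₂ (by rw [← hp, e, hm₂])
    have p4 : p ≠ n' := fun e => d5 (by rw [← hp, e, hf₂'])
    have hoq : o ≠ q := fun e => d6 (by rw [← hf₁, e, edge])
    have hnq : n ≠ q := fun e => a4 m₂ (by rw [← hm₂, e, edge])
    have hnq' : n' ≠ q := fun e => d4 (by rw [← edge, ← e, hf₂'])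
    have p5 : p ≠ q := fun e => d3 (by rw [← hp, e, edge])
    refine β.multiset_reidemeister2 W (σ p) (σ n) ?_ ?_ (inserts_over p2 p4 p5 hoq) (.inr ?_) ?_
    · exact fun e => p2 (σ.injective e)
    · exact sign
    · refine Extension.inserts_pair.2 ⟨?_, ?_, ?_⟩
      · rw [hρ, next', ρ2, u3, edge, e4]
        exact W7.symm
      · rw [W7, ← e4, next', gen n' d6.symm hnq', hf₂', s6]
        exact W5.symm
      · rw [W5, ← s6, next', gen n d2.symm hnq, hm₂, next, hm₂, hρ,
          ρ5 _ (a1 _).symm (a2 _).symm (a3 _).symm (a4 _).symm]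
    · intro z hz1 hz2
      obtain ⟨x, rfl⟩ := surj z
      refine nil x ?_
      by_cases x1 : x = o
      · rw [x1, case_over]
      have x2 : x ≠ n := fun e => hz2 (by rw [e])
      by_cases x3 : x = o'
      · rw [x3, case_over']
      by_cases x4 : x = n'
      · rw [x4, ρ4, hf₂', ρ2, u2]
      by_cases x5 : x = q
      · rw [x5, edge, ρ4, ρ5 q (x5 ▸ x1) (x5 ▸ x2) (x5 ▸ x3) (x5 ▸ x4), u1]
      rw [ρ5 x x1 x2 x3 x4, gen x x3 x5, ρ5]
      · exact fun e => hz1 (by rw [D.next.injective (e.trans hp.symm)])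
      · exact fun e => x4 (D.next.injective (e.trans hf₂'.symm))
      · exact fun e => x1 (D.next.injective (e.trans hf₁.symm))
      · exact fun e => x5 (D.next.injective (e.trans edge.symm))

end ParityBiquandleBracket

/-! ### All third Reidemeister moves from one -/

namespace ParityBiquandleBracket

open VirtualDiagram

variable {X : Type*} [Finite X] {Q : Biquandle X} {R : Type*} [CommRing R]
  {β : ParityBiquandleBracket Q R} {ε : ℤˣ} {r : Fin 3 → Bool}

/-- The strands of the triangle may be assumed to end at marked points. -/
theorem invariant_of_next_mark
    (h : ∀ (D : VirtualDiagram) (ec : Fin 3 → D.C), Triangle D ec ε r →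
      (∀ j, ∃ m, D.next (trianglePass ec (j, !r j)) = .mark m) →
      β.multiset D = β.multiset (D.exchanged (ec 0) (ec 1) (ec 2))) : β.Invariant ε r := by
  suffices H : ∀ s : Finset (Fin 3), ∀ (D : VirtualDiagram) (ec : Fin 3 → D.C), Triangle D ec ε r →
      (∀ j, j ∉ s → ∃ m, D.next (trianglePass ec (j, !r j)) = .mark m) →
      β.multiset D = β.multiset (D.exchanged (ec 0) (ec 1) (ec 2)) from
    fun D ec T => H Finset.univ D ec T fun j hj => absurd (Finset.mem_univ j) hj
  intro s
  induction s using Finset.induction_on with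
  | empty => exact fun D ec T hm => h D ec T fun j => hm j (Finset.notMem_empty j)
  | insert j s _ ih =>
    intro D ec T hm
    have inj := trianglePass_injective (V := D.V) (M := D.M) T.injective
    obtain ⟨D', E, hp, h_rest⟩ := D.exists_subdivision (trianglePass ec (j, !r j))
    have T' := T.extension E fun l => h_rest _ fun e => by
      have e := inj e
      obtain ⟨rfl, e⟩ := Prod.mk.inj e
      simp at e
    refine β.multiset_exchanged_of_subdivision T.injective E hp h_rest ?_
    refine ih D' (fun l => E.eC (.inl (ec l))) T' fun l hl => ?_
    rw [E.trianglePass_old]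
    by_cases hlj : l = j
    · subst hlj
      exact ⟨_, (Extension.inserts_singleton.1 hp).1⟩
    · obtain ⟨m, hl⟩ := hm l (by simp [hlj, hl])
      refine ⟨E.eM (.inl m), ?_⟩
      rw [Extension.inserts_nil.1 (h_rest _ fun e => hlj (congrArg Prod.fst (inj e))), hl]
      rfl

/-- The strands of the triangle may be assumed to begin at marked points. -/
theorem invariant_of_mark_next
    (h : ∀ (D : VirtualDiagram) (ec : Fin 3 → D.C), Triangle D ec ε r →
      (∀ j, ∃ m, D.next (.mark m) = trianglePass ec (j, r j)) →
      β.multiset D = β.multiset (D.exchanged (ec 0) (ec 1) (ec 2))) : β.Invariant ε r := by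
  suffices H : ∀ s : Finset (Fin 3), ∀ (D : VirtualDiagram) (ec : Fin 3 → D.C), Triangle D ec ε r →
      (∀ j, j ∉ s → ∃ m, D.next (.mark m) = trianglePass ec (j, r j)) →
      β.multiset D = β.multiset (D.exchanged (ec 0) (ec 1) (ec 2)) from
    fun D ec T => H Finset.univ D ec T fun j hj => absurd (Finset.mem_univ j) hj
  intro s
  induction s using Finset.induction_on with
  | empty => exact fun D ec T hm => h D ec T fun j => hm j (Finset.notMem_empty j)
  | insert j s _ ih =>
    intro D ec T hm
    have inj := trianglePass_injective (V := D.V) (M := D.M) T.injective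
    obtain ⟨p, hpj⟩ := D.next.surjective (trianglePass ec (j, r j))
    obtain ⟨D', E, hp, h_rest⟩ := D.exists_subdivision p
    have T' := T.extension E fun l => h_rest _ fun e => by
      rw [← e, T.next_first] at hpj
      obtain ⟨rfl, e⟩ := Prod.mk.inj (inj hpj)
      simp at e
    refine β.multiset_exchanged_of_subdivision T.injective E hp h_rest ?_
    refine ih D' (fun l => E.eC (.inl (ec l))) T' fun l hl => ?_
    rw [E.trianglePass_old]
    by_cases hlj : l = j
    · subst hlj
      exact ⟨E.eM (.inr ()), (Extension.inserts_singleton.1 hp).2.trans (by rw [hpj])⟩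
    · obtain ⟨m, hl⟩ := hm l (by simp [hlj, hl])
      refine ⟨E.eM (.inl m), ?_⟩
      have := Extension.inserts_nil.1 (h_rest (.mark m) fun e => hlj ?_)
      · rw [hl] at this
        exact this
      · rw [← e, hl] at hpj
        exact congrArg Prod.fst (inj hpj)

/-- The basic third Reidemeister move: strands directed as in a braid, and positive crossings. -/
theorem invariant_of_directions_false : β.Invariant 1 fun _ => false := by
  refine invariant_of_mark_next fun D ec T hm => ?_
  choose μ hμ using hm
  exact β.multiset_markedTriangle ⟨T.injective, hμ, T.next_first⟩ fun k => by
    rw [T.sign_eq]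
    decide

/-- A second Reidemeister move beyond the crossing `k` creates a triangle of the other type; after
the
third Reidemeister move at this triangle another second Reidemeister move restores the number of
crossings, and the result is the third Reidemeister move at the given triangle. -/
theorem Invariant.of_reversed_of_over_first {k : Fin 3} (h : β.Invariant (-ε) (reversed r k))
    (hr : r (triangleStrand (k, false)).1 = (triangleStrand (k, false)).2) : β.Invariant ε r := by
  refine invariant_of_next_mark fun D ec T hm => ?_
  have inj := trianglePass_injective (V := D.V) (M := D.M) T.injective
  obtain ⟨-, -, -, -, n5⟩ := straight_triangleStrand_ne k
  obtain ⟨u, hu⟩ : ∃ u, r (triangleStrand (k, true)).1 = xor u (triangleStrand (k, true)).2 :=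
    ⟨xor (r (triangleStrand (k, true)).1) (triangleStrand (k, true)).2, by simp⟩
  obtain ⟨m₁, hm₁⟩ := hm (triangleStrand (k, false)).1
  rw [hr] at hm₁
  obtain ⟨q, hq⟩ : ∃ q : D.Pass,
      if u then D.next q = trianglePass ec (straight (triangleStrand (k, true)))
        else q = trianglePass ec (straight (triangleStrand (k, true))) := by
    cases u
    · exact ⟨_, rfl⟩
    · exact D.next.surjective _
  have hpq : trianglePass ec (straight (triangleStrand (k, false))) ≠ q := by
    intro e
    cases u
    · simp only [Bool.false_eq_true, if_false] at hq
      exact n5 (by simpa [straight] using congrArg Prod.fst (inj (e.trans hq)))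
    · simp only [if_true] at hq
      rw [← e] at hq
      exact trianglePass_ne_mark ec _ m₁ (hq.symm.trans hm₁)
  obtain ⟨D', E, hs₁, hs₂, hp, hq', h_rest⟩ := D.exists_clasp hpq u (-D.sign (ec k))
  have hc : Clasped ec r k E u q := ⟨hr, hu, ⟨m₁, hm₁⟩, hm _, hs₁, by rw [hs₂, neg_neg], hp, hq',
      hq,
    h_rest⟩
  rw [β.multiset_reidemeister2 E _ q hpq (by rw [hs₁, hs₂]) hp ?_ h_rest,
    h D' _ (hc.triangle T), β.multiset_exchanged_of_clasped T hc]
  cases u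
  · exact .inl hq'
  · exact .inr hq'

/-- The third Reidemeister moves of one type follow from those in which the two strands of one
crossing have the opposite directions, together with second Reidemeister moves. -/
theorem Invariant.of_reversed {k : Fin 3} (h : β.Invariant (-ε) (reversed r k)) :
    β.Invariant ε r := by
  by_cases hr : r (triangleStrand (k, false)).1 = (triangleStrand (k, false)).2
  · exact h.of_reversed_of_over_first hr
  -- Otherwise the upper strand passes the crossing first in the inverse move.
  · have h' : β.Invariant (-ε) (reversed (fun j => !r j) k) := by
      have e : reversed (fun j => !r j) k = fun j => !reversed r k j := by
        funext j
        unfold reversed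
        split_ifs <;> rfl
      rw [e]
      exact h.inverse
    have := (h'.of_reversed_of_over_first (Bool.not_eq.2 hr)).inverse
    simpa using this

/-- All third Reidemeister moves follow from the one in which all strands are directed as in a
braid with positive crossings. -/
theorem invariant (ε : ℤˣ) (r : Fin 3 → Bool) : β.Invariant ε r := by
  have step : ∀ {ε r} (k : Fin 3), β.Invariant ε r → β.Invariant (-ε) (reversed r k) := by
    intro ε r k h
    have : ∀ (r : Fin 3 → Bool) k, reversed (reversed r k) k = r := by decide
    refine Invariant.of_reversed (k := k) ?_
    rwa [this, neg_neg]
  -- Reversing the strands of all three crossings changes nothing but the sign `ε`.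
  have sign : ∀ {ε r}, β.Invariant ε r → ∀ ε', β.Invariant ε' r := by
    intro ε r h ε'
    have : ∀ r : Fin 3 → Bool, reversed (reversed (reversed r 0) 1) 2 = r := by decide
    have h' := step 2 (step 1 (step 0 h))
    rw [this, neg_neg] at h'
    rcases Int.units_eq_one_or ε with rfl | rfl <;> rcases Int.units_eq_one_or ε' with rfl | rfl
    exacts [h, h', h', h]
  have h0 : β.Invariant 1 fun _ => false := invariant_of_directions_false
  -- The directions with an even number of reversed strands arise from one crossing, the others are
  -- those of inverse moves.
  have : ∀ r : Fin 3 → Bool, r = (fun _ => false) ∨ r = (fun _ => !false) ∨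
      ∃ k, r = reversed (fun _ => false) k ∨ r = reversed (fun _ => !false) k := by decide
  rcases this r with rfl | rfl | ⟨k, rfl | rfl⟩
  exacts [sign h0 ε, sign h0.inverse ε, sign (step k h0) ε, sign (step k h0.inverse) ε]

end ParityBiquandleBracket

/-! ### Invariance -/

/-- The third Reidemeister moves of `Move` are those at a `Triangle`. -/
theorem VirtualDiagram.triangle_of_consecutive {D : VirtualDiagram} {tm tb mb : D.C}
    {ε t m b : ℤˣ} (h1 : tm ≠ tb) (h2 : tm ≠ mb) (h3 : tb ≠ mb)
    (h_top : D.Consecutive t (.over tm) (.over tb))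
    (h_mid : D.Consecutive m (.under tm) (.over mb))
    (h_bot : D.Consecutive b (.under tb) (.under mb))
    (s_tm : D.sign tm = ε * (t * m)) (s_tb : D.sign tb = ε * (t * b))
    (s_mb : D.sign mb = ε * (m * b)) :
    ∃ ec r, Triangle D ec ε r ∧ ec 0 = tm ∧ ec 1 = tb ∧ ec 2 = mb := by
  have direction : ∀ {s : ℤˣ} {u v : D.Pass}, D.Consecutive s u v →
      ∃ r : Bool, s = directionSign r ∧ D.next (if r then v else u) = if r then u else v := by
    rintro s u v (⟨rfl, h⟩ | ⟨rfl, h⟩)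
    exacts [⟨false, rfl, h⟩, ⟨true, rfl, h⟩]
  obtain ⟨x, rfl, hx⟩ := direction h_top
  obtain ⟨y, rfl, hy⟩ := direction h_mid
  obtain ⟨z, rfl, hz⟩ := direction h_bot
  refine ⟨![tm, tb, mb], ![x, y, z], ⟨?_, fun j => ?_, fun k => ?_⟩, rfl, rfl, rfl⟩
  · intro k l hkl
    fin_cases k <;> fin_cases l <;> simp_all
  · fin_cases j
    · cases x <;> exact hx
    · cases y <;> exact hy
    · cases z <;> exact hz
  · fin_cases k
    exacts [s_tm, s_tb, s_mb]

theorem mainTheorem1 {X : Type*} [Finite X] (Q : Biquandle X) {R : Type*} [CommRing R]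
    (β : ParityBiquandleBracket Q R) (L₁ L₂ : VirtualDiagram) (h : L₁.SameLink L₂) :
    β.multiset L₁ = β.multiset L₂ := by
  induction h with
  | refl => rfl
  | symm _ _ _ ih => exact ih.symm
  | trans _ _ _ _ _ ih ih' => exact ih.trans ih'
  | rel _ _ h =>
    cases h with
    | iso e eC eV eM h_over h_under h_virt h_mark h_sign h_next =>
      exact β.multiset_iso e eC eV eM h_over h_under h_virt h_mark h_sign h_next
    | subdivide E p hp h_rest => exact β.multiset_subdivide E p hp h_rest
    | reidemeister1 E p hp h_rest => exact β.multiset_reidemeister1 E p hp h_rest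
    | reidemeister2 E p q hpq h_sign hp hq h_rest =>
      exact β.multiset_reidemeister2 E p q hpq h_sign hp hq h_rest
    | reidemeister3 tm tb mb ε t m b h1 h2 h3 h_top h_mid h_bot s_tm s_tb s_mb =>
      obtain ⟨ec, r, T, rfl, rfl, rfl⟩ :=
        VirtualDiagram.triangle_of_consecutive h1 h2 h3 h_top h_mid h_bot s_tm s_tb s_mb
      exact ParityBiquandleBracket.invariant ε r _ ec T
    | detour E p q hpq hp hq h_rest => exact β.multiset_detour E p q hpq hp hq h_rest
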